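/- Let $k$ be a field and let $(R,\mathfrak m)$, $(S,\mathfrak n)$ be standard graded $k$-algebras (noetherian $\mathbb N$-graded, with degree-zero part $k$, generated over $k$ in degree $1$), with graded maximal ideals $\mathfrak m,\mathfrak n$. Let $I\subseteq R$ and $J\subseteq S$ be non-zero proper homogeneous ideals, let $T=R\otimes_k S$ with its total grading, and let $P=I+J\subseteq T$, where $I$ and $J$ also denote the ideals they generate in $T$. Terminology, for a standard graded $k$-algebra $A$ with graded maximal ideal $\mathfrak a$: - A degree-preserving map $\phi:M\to N$ of graded $A$-modules is *Tor-vanishing* if $\operatorname{Tor}^A_i(k,\phi)=0$ for all $i\ge 0$. It is *doubly Tor-vanishing* if there are (possibly non-minimal) graded free resolutions $F$ of $M$ and $G$ of $N$ and a degree-preserving lifting $\varphi:F\to G$ of $\phi$ with $\varphi(F)\subseteq \mathfrak a^2G$. - A proper homogeneous ideal $Q$ of $A$ is *of small type* (resp. *of doubly small type*) if for every $r\ge 1$ the inclusion $Q^r\to Q^{r-1}$ is Tor-vanishing (resp. doubly Tor-vanishing), where $Q^0=A$. - For homogeneous ideals with $Q=Q_1+Q_2$, this decomposition is a *Betti splitting*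 if $\beta_i(Q)=\beta_i(Q_1)+\beta_i(Q_2)+\beta_{i-1}(Q_1\cap Q_2)$ for all $i\ge 0$, where $\beta_i(M)=\dim_k\operatorname{Tor}^A_i(k,M)$ and $\beta_{-1}=0$. (Zero ideals are allowed here.) Then: (i) If $I$ and $J$ are of small type, then for all $r\ge 0$ and $s\ge 1$ the decomposition $I^rP^s=I^{r+1}P^{s-1}+I^rJ^s$ holds and is a Betti splitting. Furthermore, $P$ is of small type. (ii) If $I$ and $J$ are of doubly small type, then for all $r\ge 0$ and $s\ge 1$ the inclusion maps $I^{r+1}J^s\to I^rJ^s$ and $I^{r+1}J^s\to I^{r+1}P^{s-1}$ are doubly Tor-vanishing. Furthermore, $P$ is of doubly small type. -/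

import Mathlib

open CategoryTheory
open scoped TensorProduct

universe u

noncomputable section

namespace MixedSum

section Graded

variable {k R : Type u} [Field k] [CommRing R] [Algebra k R]

/-- A standard graded `k`-algebra: a noetherian `ℕ`-graded ring `R = ⨁ R_n` with `R_0 = k`,
generated over `k` by elements of degree one. (That `R = ⨁ R_n` is a graded algebra is the
separate instance `GradedAlgebra 𝒜`.) -/
structure IsStandardGraded (𝒜 : ℕ → Submodule k R) : Prop where
  nontrivial : Nontrivial R
  noetherian : IsNoetherianRing R
  degree_zero : 𝒜 0 = LinearMap.range (Algebra.linearMap k R)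
  generated : Algebra.adjoin k (𝒜 1 : Set R) = ⊤

/-- The graded maximal ideal `𝔪`, generated by the homogeneous elements of positive degree. -/
def gradedMax (𝒜 : ℕ → Submodule k R) : Ideal R :=
  Ideal.span {x : R | ∃ n : ℕ, 1 ≤ n ∧ x ∈ 𝒜 n}

/-- The map `Tor_i^R(k, f)`, where the residue field `k` is the `R`-module `R ⧸ 𝔪`. -/
def torMap (𝒜 : ℕ → Submodule k R) {M N : Type u} [AddCommGroup M] [Module R M]
    [AddCommGroup N] [Module R N] (i : ℕ) (f : M →ₗ[R] N) :
    ((Tor (ModuleCat.{u} R) i).obj (ModuleCat.of R (R ⧸ gradedMax 𝒜))).obj (ModuleCat.of R M) ⟶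
    ((Tor (ModuleCat.{u} R) i).obj (ModuleCat.of R (R ⧸ gradedMax 𝒜))).obj (ModuleCat.of R N) :=
  ((Tor (ModuleCat.{u} R) i).obj (ModuleCat.of R (R ⧸ gradedMax 𝒜))).map (ModuleCat.ofHom f)

/-- `f` is Tor-vanishing: `Tor_i^R(k, f) = 0` for all `i ≥ 0`. -/
def IsTorVanishing (𝒜 : ℕ → Submodule k R) {M N : Type u} [AddCommGroup M] [Module R M]
    [AddCommGroup N] [Module R N] (f : M →ₗ[R] N) : Prop :=
  ∀ i : ℕ, torMap 𝒜 i f = 0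

/-- The `i`-th Betti number `β_i(M) = dim_k Tor_i^R(k, M)`. -/
def betti (𝒜 : ℕ → Submodule k R) (i : ℕ) (M : Type u) [AddCommGroup M] [Module R M] :
    Cardinal.{u} :=
  Module.rank k ((ModuleCat.restrictScalars (algebraMap k R)).obj
    (((Tor (ModuleCat.{u} R) i).obj (ModuleCat.of R (R ⧸ gradedMax 𝒜))).obj (ModuleCat.of R M)))

/-- `P = I + J` is a Betti splitting: `β_i(P) = β_i(I) + β_i(J) + β_{i-1}(I ∩ J)` for all
`i ≥ 0`, where `β_{-1} = 0`. -/
def IsBettiSplitting (𝒜 : ℕ → Submodule k R) (P I J : Ideal R) : Prop :=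
  P = I + J ∧
    ∀ i : ℕ, betti 𝒜 i P =
      betti 𝒜 i I + betti 𝒜 i J +
        (if i = 0 then 0 else betti 𝒜 (i - 1) (I ⊓ J : Ideal R))

/-- The component of degree `z ∈ ℤ` of `R`, which is zero if `z < 0`. -/
def component (𝒜 : ℕ → Submodule k R) : ℤ → Submodule k R
  | Int.ofNat n => 𝒜 n
  | Int.negSucc _ => ⊥

/-- The grading that a homogeneous ideal `I` inherits from `R`. -/
def idealComponent (𝒜 : ℕ → Submodule k R) (I : Ideal R) (z : ℤ) : AddSubgroup I :=
  (component 𝒜 z).toAddSubgroup.comap (Submodule.subtype I).toAddMonoidHom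

/-- A (possibly non-minimal) graded free resolution
`⋯ → F_1 → F_0 → M → 0` of the graded `R`-module `M = ⨁ M_z`. Here `F_n = ⨁_{j ∈ ι n} R(-deg j)`
is free on a homogeneous basis, and the maps preserve degrees. -/
structure GradedFreeResolution (𝒜 : ℕ → Submodule k R) {M : Type u} [AddCommGroup M] [Module R M]
    (ℳ : ℤ → AddSubgroup M) where
  ι : ℕ → Type u
  deg : ∀ n, ι n → ℤ
  d : ∀ n, (ι (n + 1) →₀ R) →ₗ[R] (ι n →₀ R)
  aug : (ι 0 →₀ R) →ₗ[R] M
  d_deg : ∀ n (j : ι (n + 1)) (i : ι n),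
    d n (Finsupp.single j 1) i ∈ component 𝒜 (deg (n + 1) j - deg n i)
  aug_deg : ∀ j : ι 0, aug (Finsupp.single j 1) ∈ ℳ (deg 0 j)
  aug_surjective : Function.Surjective aug
  exact_aug : Function.Exact (d 0) aug
  exact_d : ∀ n, Function.Exact (d (n + 1)) (d n)

/-- A lifting of `f : M → N` to graded free resolutions: a degree-preserving map of complexes
`F → G` that is compatible with the augmentations. -/
structure GradedLifting {𝒜 : ℕ → Submodule k R} {M N : Type u} [AddCommGroup M] [Module R M]
    [AddCommGroup N] [Module R N] {ℳ : ℤ → AddSubgroup M} {𝒩 : ℤ → AddSubgroup N}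
    (F : GradedFreeResolution 𝒜 ℳ) (G : GradedFreeResolution 𝒜 𝒩) (f : M →ₗ[R] N) where
  map : ∀ n, (F.ι n →₀ R) →ₗ[R] (G.ι n →₀ R)
  map_deg : ∀ n (j : F.ι n) (i : G.ι n),
    map n (Finsupp.single j 1) i ∈ component 𝒜 (F.deg n j - G.deg n i)
  comm_aug : G.aug ∘ₗ map 0 = f ∘ₗ F.aug
  comm_d : ∀ n, G.d n ∘ₗ map (n + 1) = map n ∘ₗ F.d n

/-- `f : M → N` is doubly Tor-vanishing: for some graded free resolutions `F` of `M` and `G` of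
`N` it has a lifting `φ : F → G` with `φ(F) ⊆ 𝔪² G`. -/
def IsDoublyTorVanishing (𝒜 : ℕ → Submodule k R) {M N : Type u} [AddCommGroup M] [Module R M]
    [AddCommGroup N] [Module R N] (ℳ : ℤ → AddSubgroup M) (𝒩 : ℤ → AddSubgroup N)
    (f : M →ₗ[R] N) : Prop :=
  ∃ (F : GradedFreeResolution 𝒜 ℳ) (G : GradedFreeResolution 𝒜 𝒩) (φ : GradedLifting F G f),
    ∀ n, LinearMap.range (φ.map n) ≤ (gradedMax 𝒜) ^ 2 • (⊤ : Submodule R (G.ι n →₀ R))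

/-- `I` is contained in `J` and the inclusion map `I → J` is Tor-vanishing. -/
def InclusionTorVanishing (𝒜 : ℕ → Submodule k R) (I J : Ideal R) : Prop :=
  ∃ h : I ≤ J, IsTorVanishing 𝒜 (Submodule.inclusion h)

/-- `I` is contained in `J` and the inclusion map `I → J` is doubly Tor-vanishing. -/
def InclusionDoublyTorVanishing (𝒜 : ℕ → Submodule k R) (I J : Ideal R) : Prop :=
  ∃ h : I ≤ J, IsDoublyTorVanishing 𝒜 (idealComponent 𝒜 I) (idealComponent 𝒜 J)
    (Submodule.inclusion h)

/-- `I` is of small type: `I^r → I^{r-1}` is Tor-vanishing for all `r ≥ 1`. -/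
def IsSmallType (𝒜 : ℕ → Submodule k R) (I : Ideal R) : Prop :=
  ∀ r : ℕ, 1 ≤ r → InclusionTorVanishing 𝒜 (I ^ r) (I ^ (r - 1))

/-- `I` is of doubly small type: `I^r → I^{r-1}` is doubly Tor-vanishing for all `r ≥ 1`. -/
def IsDoublySmallType (𝒜 : ℕ → Submodule k R) (I : Ideal R) : Prop :=
  ∀ r : ℕ, 1 ≤ r → InclusionDoublyTorVanishing 𝒜 (I ^ r) (I ^ (r - 1))

end Graded

section Tensor

variable {k R S : Type u} [Field k] [CommRing R] [Algebra k R] [CommRing S] [Algebra k S]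

/-- The total grading of `R ⊗_k S`: its component of degree `n` is `∑_{i+j=n} R_i ⊗_k S_j`. -/
def tensorGrading (𝒜 : ℕ → Submodule k R) (ℬ : ℕ → Submodule k S) (n : ℕ) :
    Submodule k (R ⊗[k] S) :=
  ⨆ p ∈ Finset.HasAntidiagonal.antidiagonal n, Submodule.map₂ (TensorProduct.mk k R S) (𝒜 p.1) (ℬ p.2)

/-- The ideal of `R ⊗_k S` generated by an ideal of `R`. -/
def extendLeft (I : Ideal R) : Ideal (R ⊗[k] S) :=
  I.map (Algebra.TensorProduct.includeLeft : R →ₐ[k] R ⊗[k] S)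

/-- The ideal of `R ⊗_k S` generated by an ideal of `S`. -/
def extendRight (J : Ideal S) : Ideal (R ⊗[k] S) :=
  J.map (Algebra.TensorProduct.includeRight : S →ₐ[k] R ⊗[k] S)

/-- The mixed sum `P = I + J ⊆ R ⊗_k S`. -/
def mixedSum (I : Ideal R) (J : Ideal S) : Ideal (R ⊗[k] S) :=
  extendLeft I + extendRight J

end Tensor

end MixedSum

end

/-!
Let `F a` be free resolutions of the powers `I ^ a`. If the inclusion `I ^ (a + 1) → I ^ a` is
Tor-vanishing, each of its lifts can be corrected by a nullhomotopy modulo `𝔪` to one with entries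
in `𝔪`, so `I` is of small type if and only if the `F a` form a tower of such lifts. Likewise `I` is
of doubly small type if and only if graded resolutions form a tower of graded lifts with entries in
`𝔪 ^ 2`; here the comparison theorem moves the given lifts, which exist between unrelated
resolutions for different `a`, to one chosen sequence of resolutions.

Given such towers `F` and `G` for `I` and `J`, the tensor products of `F r` and `G s` resolve
`I ^ r * J ^ s`. Since `I ^ r * P ^ (s + 1)` is the sum of `I ^ (r + 1) * P ^ s` and
`I ^ r * J ^ (s + 1)`, and these intersect in `I ^ (r + 1) * J ^ (s + 1)`, iterated mapping cones of
tensor products resolve all `I ^ r * P ^ s`. Both inclusions of the intersection are lifted with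
entries in the maximal ideal of `T`, so the cone splits modulo that ideal: this is the Betti
splitting. The cones of the powers of `P` again form a tower.

A resolution is encoded as one free module on a basis that carries homological and internal degrees.
The internal degrees refer to an arbitrary family of subgroups of the ring, and the trivial family
turns graded statements into ungraded ones.
-/

noncomputable section

namespace MixedSum

/-- A free module on a basis `X` carrying homological degrees `hdeg` and internal degrees `deg`,
with an endomorphism `d` and an augmentation to `R`: the data of a graded free resolution of an
ideal of `R`, with all homological degrees put together in one module. -/
structure BasedComplex (R : Type u) [CommRing R] where
  X : Type u
  hdeg : X → ℕ
  deg : X → ℤ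
  d : (X →₀ R) →ₗ[R] (X →₀ R)
  aug : (X →₀ R) →ₗ[R] R

/-- The linear maps between the free modules underlying two based complexes. -/
abbrev BasedComplex.Map {R : Type u} [CommRing R] (F G : BasedComplex R) : Type u :=
  (F.X →₀ R) →ₗ[R] (G.X →₀ R)

section FreeModules

variable {R X Y N : Type*} [CommRing R] [AddCommGroup N] [Module R N]

theorem map_single_eq_smul (f : (X →₀ R) →ₗ[R] N) (j : X) (a : R) :
    f (Finsupp.single j a) = a • f (Finsupp.single j 1) := by
  rw [← map_smul, Finsupp.smul_single, smul_eq_mul, mul_one]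

theorem map_eq_sum_smul_single (f : (X →₀ R) →ₗ[R] N) (x : X →₀ R) :
    f x = x.sum fun j a => a • f (Finsupp.single j 1) := by
  conv_lhs => rw [← Finsupp.sum_single x, map_finsuppSum]
  simp only [← map_single_eq_smul]

theorem linearMap_ext_single {f g : (X →₀ R) →ₗ[R] N}
    (h : ∀ j, f (Finsupp.single j 1) = g (Finsupp.single j 1)) : f = g :=
  Finsupp.lhom_ext' fun j => LinearMap.ext_ring (h j)

theorem map_eq_of_eqOn_support {f g : (X →₀ R) →ₗ[R] N} {x : X →₀ R}
    (h : ∀ j, x j ≠ 0 → f (Finsupp.single j 1) = g (Finsupp.single j 1)) : f x = g x := by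
  rw [map_eq_sum_smul_single f, map_eq_sum_smul_single g]
  exact Finsupp.sum_congr fun j hj => by rw [h j (Finsupp.mem_support_iff.mp hj)]

theorem map_apply_eq_sum (f : (X →₀ R) →ₗ[R] (Y →₀ R)) (x : X →₀ R) (i : Y) :
    f x i = x.sum fun j a => a * f (Finsupp.single j 1) i := by
  rw [map_eq_sum_smul_single, Finsupp.sum_apply]
  simp only [Finsupp.smul_apply, smul_eq_mul]

theorem map_apply_mem {c : Ideal R} {f : (X →₀ R) →ₗ[R] (Y →₀ R)}
    (hf : ∀ j i, f (Finsupp.single j 1) i ∈ c) (x : X →₀ R) (i : Y) : f x i ∈ c := by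
  rw [map_apply_eq_sum]
  exact c.sum_mem fun j _ => c.mul_mem_left _ (hf j i)

theorem map_apply_mem_of_forall_mem {c : Ideal R} (f : (X →₀ R) →ₗ[R] (Y →₀ R)) {x : X →₀ R}
    (hx : ∀ j, x j ∈ c) (i : Y) : f x i ∈ c := by
  rw [map_apply_eq_sum]
  exact c.sum_mem fun j _ => c.mul_mem_right _ (hx j)

theorem mem_smul_top_iff {c : Ideal R} (x : X →₀ R) :
    x ∈ c • (⊤ : Submodule R (X →₀ R)) ↔ ∀ i, x i ∈ c := by
  constructor
  · intro hx i
    refine Submodule.smul_induction_on hx (fun r hr n _ => ?_) (fun a b ha hb => ?_)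
    · exact c.mul_mem_right _ hr
    · exact c.add_mem ha hb
  · intro hx
    rw [← LinearMap.id_apply (R := R) x, map_eq_sum_smul_single]
    exact Submodule.sum_mem _ fun i _ => Submodule.smul_mem_smul (hx i) trivial

end FreeModules

section HomogeneousMaps

variable {R : Type u} [CommRing R] {𝒢 : ℤ → AddSubgroup R}
variable {F G H : BasedComplex R} {n p : ℕ} {c c' : Ideal R}

/-- The map lowers homological degrees by `n`, preserves internal degrees with respect to the
grading `𝒢` of `R`, and has matrix entries in the ideal `c`. Ungraded statements are obtained
from `𝒢 = fun _ => ⊤`. -/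
structure IsHomogeneous (𝒢 : ℤ → AddSubgroup R) (F G : BasedComplex R) (n : ℕ) (c : Ideal R)
    (φ : F.Map G) : Prop where
  hdeg_eq : ∀ j i, φ (Finsupp.single j 1) i ≠ 0 → F.hdeg j = G.hdeg i + n
  entry_mem_degree : ∀ j i, φ (Finsupp.single j 1) i ∈ 𝒢 (F.deg j - G.deg i)
  entry_mem_ideal : ∀ j i, φ (Finsupp.single j 1) i ∈ c

namespace IsHomogeneous

theorem mono {φ : F.Map G} (hφ : IsHomogeneous 𝒢 F G n c φ) (hc : c ≤ c') :
    IsHomogeneous 𝒢 F G n c' φ :=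
  { hφ with entry_mem_ideal := fun j i => hc (hφ.entry_mem_ideal j i) }

theorem apply_mem {φ : F.Map G} (hφ : IsHomogeneous 𝒢 F G n c φ) (x : F.X →₀ R) (i : G.X) :
    φ x i ∈ c :=
  map_apply_mem hφ.entry_mem_ideal x i

theorem add {φ ψ : F.Map G} (hφ : IsHomogeneous 𝒢 F G n c φ) (hψ : IsHomogeneous 𝒢 F G n c ψ) :
    IsHomogeneous 𝒢 F G n c (φ + ψ) where
  hdeg_eq j i h := by
    by_cases h₁ : φ (Finsupp.single j 1) i = 0
    · exact hψ.hdeg_eq j i (by simpa [h₁] using h)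
    · exact hφ.hdeg_eq j i h₁
  entry_mem_degree j i := add_mem (hφ.entry_mem_degree j i) (hψ.entry_mem_degree j i)
  entry_mem_ideal j i := add_mem (hφ.entry_mem_ideal j i) (hψ.entry_mem_ideal j i)

protected theorem id [SetLike.GradedOne 𝒢] : IsHomogeneous 𝒢 F F 0 ⊤ LinearMap.id where
  hdeg_eq j i h := by
    obtain rfl : j = i := by by_contra hji; exact h (by simp [hji])
    rfl
  entry_mem_degree j i := by
    by_cases hji : j = i
    · subst hji
      simpa using SetLike.GradedOne.one_mem (A := 𝒢)
    · simp [hji]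
  entry_mem_ideal _ _ := trivial

protected theorem comp [SetLike.GradedMul 𝒢] {φ : F.Map G} {ψ : G.Map H}
    (hψ : IsHomogeneous 𝒢 G H p c' ψ) (hφ : IsHomogeneous 𝒢 F G n c φ) :
    IsHomogeneous 𝒢 F H (n + p) (c * c') (ψ ∘ₗ φ) where
  hdeg_eq j i h := by
    rw [LinearMap.comp_apply, map_apply_eq_sum] at h
    obtain ⟨l, -, hl⟩ := Finset.exists_ne_zero_of_sum_ne_zero h
    rw [hφ.hdeg_eq j l (left_ne_zero_of_mul hl), hψ.hdeg_eq l i (right_ne_zero_of_mul hl)]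
    omega
  entry_mem_degree j i := by
    rw [LinearMap.comp_apply, map_apply_eq_sum]
    refine sum_mem fun l _ => ?_
    simpa using SetLike.GradedMul.mul_mem (hφ.entry_mem_degree j l) (hψ.entry_mem_degree l i)
  entry_mem_ideal j i := by
    rw [LinearMap.comp_apply, map_apply_eq_sum]
    exact sum_mem fun l _ => Ideal.mul_mem_mul (hφ.entry_mem_ideal j l) (hψ.entry_mem_ideal l i)

end IsHomogeneous

end HomogeneousMaps

section Resolutions

variable {R : Type u} [CommRing R] {𝒢 : ℤ → AddSubgroup R}
variable {F G H F' G' : BasedComplex R} {A B c c' : Ideal R}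

/-- `F` is a free resolution of the ideal `A` of `R`, graded with respect to `𝒢`. -/
structure IsResolution (𝒢 : ℤ → AddSubgroup R) (F : BasedComplex R) (A : Ideal R) : Prop where
  d_homogeneous : IsHomogeneous 𝒢 F F 1 ⊤ F.d
  aug_single_eq_zero : ∀ j, F.hdeg j ≠ 0 → F.aug (Finsupp.single j 1) = 0
  aug_single_mem : ∀ j, F.aug (Finsupp.single j 1) ∈ 𝒢 (F.deg j)
  d_d : ∀ x, F.d (F.d x) = 0
  aug_d : ∀ x, F.aug (F.d x) = 0
  exact : ∀ x, F.d x = 0 → F.aug x = 0 → ∃ y, F.d y = x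
  range_aug : LinearMap.range F.aug = A

/-- `φ` lifts an inclusion of ideals to a graded map of resolutions with entries in `c`. -/
structure IsLift (𝒢 : ℤ → AddSubgroup R) (F G : BasedComplex R) (c : Ideal R) (φ : F.Map G) :
    Prop extends IsHomogeneous 𝒢 F G 0 c φ where
  comm_d : ∀ x, G.d (φ x) = φ (F.d x)
  comm_aug : ∀ x, G.aug (φ x) = F.aug x

/-- There is a lift of an inclusion of ideals with entries in `c`. -/
def HasLift (𝒢 : ℤ → AddSubgroup R) (F G : BasedComplex R) (c : Ideal R) : Prop :=
  ∃ φ, IsLift 𝒢 F G c φ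

theorem IsLift.mono {φ : F.Map G} (hφ : IsLift 𝒢 F G c φ) (hc : c ≤ c') : IsLift 𝒢 F G c' φ :=
  { hφ with toIsHomogeneous := hφ.toIsHomogeneous.mono hc }

theorem IsLift.comp [SetLike.GradedMul 𝒢] {φ : F.Map G} {ψ : G.Map H}
    (hψ : IsLift 𝒢 G H c' ψ) (hφ : IsLift 𝒢 F G c φ) : IsLift 𝒢 F H (c * c') (ψ ∘ₗ φ) where
  toIsHomogeneous := hψ.toIsHomogeneous.comp hφ.toIsHomogeneous
  comm_d x := by simp only [LinearMap.comp_apply, hψ.comm_d, hφ.comm_d]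
  comm_aug x := by simp only [LinearMap.comp_apply, hψ.comm_aug, hφ.comm_aug]

theorem HasLift.comp [SetLike.GradedMul 𝒢] (hG : HasLift 𝒢 G H c') (hF : HasLift 𝒢 F G c) :
    HasLift 𝒢 F H (c * c') :=
  let ⟨_, hψ⟩ := hG
  let ⟨_, hφ⟩ := hF
  ⟨_, hψ.comp hφ⟩

namespace IsResolution

theorem aug_mem (hF : IsResolution 𝒢 F A) (x : F.X →₀ R) : F.aug x ∈ A :=
  hF.range_aug ▸ LinearMap.mem_range_self _ x

theorem d_single_eq_zero (hF : IsResolution 𝒢 F A) {j : F.X} (hj : F.hdeg j = 0) :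
    F.d (Finsupp.single j 1) = 0 := by
  ext i
  by_contra h
  have := hF.d_homogeneous.hdeg_eq j i h
  omega

theorem d_filter_hdeg_zero (hF : IsResolution 𝒢 F A) (x : F.X →₀ R) :
    F.d (x.filter fun j => F.hdeg j = 0) = 0 := by
  refine (map_eq_of_eqOn_support (g := 0) fun j hj => ?_).trans rfl
  refine hF.d_single_eq_zero ?_
  by_contra h
  exact hj (Finsupp.filter_apply_neg _ _ h)

theorem aug_filter_hdeg_zero (hF : IsResolution 𝒢 F A) (x : F.X →₀ R) :
    F.aug (x.filter fun j => F.hdeg j = 0) = F.aug x := by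
  conv_rhs => rw [← Finsupp.filter_add_filter_not x fun j => F.hdeg j = 0]
  rw [map_add, left_eq_add]
  refine (map_eq_of_eqOn_support (g := 0) fun j hj => ?_).trans rfl
  refine hF.aug_single_eq_zero j fun h => hj ?_
  rw [Finsupp.filter_apply_neg]
  exact not_not.mpr h

theorem exists_cycle (hF : IsResolution 𝒢 F A) {a : R} (ha : a ∈ A) :
    ∃ x, F.d x = 0 ∧ F.aug x = a := by
  obtain ⟨x, rfl⟩ := hF.range_aug.symm ▸ ha
  exact ⟨_, hF.d_filter_hdeg_zero x, hF.aug_filter_hdeg_zero x⟩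

theorem exists_preimage (hF : IsResolution 𝒢 F A) {x : F.X →₀ R} (hd : F.d x = 0)
    (haug : F.aug x = 0) : ∃ y, F.d y = x ∧ F.aug y = 0 := by
  obtain ⟨y, rfl⟩ := hF.exact x hd haug
  exact ⟨y - y.filter fun j => F.hdeg j = 0,
    by rw [map_sub, hF.d_filter_hdeg_zero, sub_zero],
    by rw [map_sub, hF.aug_filter_hdeg_zero, sub_self]⟩

end IsResolution

theorem IsLift.le {φ : F.Map G} (hφ : IsLift 𝒢 F G c φ) (hF : IsResolution 𝒢 F A)
    (hG : IsResolution 𝒢 G B) : A ≤ B := by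
  intro a ha
  obtain ⟨x, -, rfl⟩ := hF.exists_cycle ha
  exact hφ.comm_aug x ▸ hG.aug_mem _

end Resolutions

section Homogenization

variable {R : Type u} [CommRing R] {𝒢 : ℤ → AddSubgroup R}
variable {F G : BasedComplex R} {A B c : Ideal R} {n p : ℕ}

/-- Additive projections of `R` onto the members of the family `𝒢`. For a genuine grading these
are the projections onto components; the constant family `⊤` is projected by the identity. -/
structure GradingProjection (𝒢 : ℤ → AddSubgroup R) where
  proj : ℤ → R →+ R
  proj_mem : ∀ z a, proj z a ∈ 𝒢 z
  proj_eq_self : ∀ {z a}, a ∈ 𝒢 z → proj z a = a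
  proj_mul : ∀ (z a) {w b}, b ∈ 𝒢 w → proj (z + w) (a * b) = proj z a * b

/-- The projection for the trivial family, which sees no internal degrees. -/
def GradingProjection.trivial (R : Type u) [CommRing R] :
    GradingProjection (fun _ => (⊤ : AddSubgroup R)) where
  proj _ := AddMonoidHom.id R
  proj_mem _ _ := AddSubgroup.mem_top _
  proj_eq_self _ := rfl
  proj_mul _ _ _ _ _ := rfl

namespace GradingProjection

variable (π : GradingProjection 𝒢)

/-- The part of homological degree `n` and internal degree `z` of an element of a based free
module; a basis element `i` with coefficient in `𝒢 w` has internal degree `w + F.deg i`. -/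
def part (F : BasedComplex R) (n : ℕ) (z : ℤ) : (F.X →₀ R) →+ (F.X →₀ R) :=
  Finsupp.liftAddHom fun i =>
    if F.hdeg i = n then (Finsupp.singleAddHom i).comp (π.proj (z - F.deg i)) else 0

theorem part_single (n : ℕ) (z : ℤ) (i : F.X) (a : R) :
    π.part F n z (Finsupp.single i a) =
      if F.hdeg i = n then Finsupp.single i (π.proj (z - F.deg i) a) else 0 := by
  simp only [part, Finsupp.liftAddHom_apply_single]
  split_ifs <;> rfl

theorem part_apply (n : ℕ) (z : ℤ) (x : F.X →₀ R) (i : F.X) :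
    π.part F n z x i = if F.hdeg i = n then π.proj (z - F.deg i) (x i) else 0 := by
  induction x using Finsupp.induction_linear with
  | zero => simp
  | add x y hx hy => simp only [map_add, Finsupp.add_apply, hx, hy]; split_ifs <;> simp
  | single j a =>
    rw [part_single]
    by_cases hji : j = i
    · subst hji; split_ifs <;> simp
    · simp only [Finsupp.single_eq_of_ne' hji, map_zero]
      split_ifs <;> simp [hji]

theorem part_smul (n : ℕ) (z : ℤ) {w : ℤ} {a : R} (ha : a ∈ 𝒢 w) (x : F.X →₀ R) :
    π.part F n (z + w) (a • x) = a • π.part F n z x := by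
  ext i
  simp only [part_apply, Finsupp.smul_apply, smul_eq_mul]
  split_ifs
  · rw [mul_comm, add_sub_right_comm, π.proj_mul _ _ ha, mul_comm]
  · rw [mul_zero]

theorem map_part {φ : F.Map G} (hφ : IsHomogeneous 𝒢 F G n c φ) (p : ℕ) (z : ℤ)
    (x : F.X →₀ R) : φ (π.part F (p + n) z x) = π.part G p z (φ x) := by
  induction x using Finsupp.induction_linear with
  | zero => simp only [map_zero]
  | add x y hx hy => simp only [map_add, hx, hy]
  | single j a =>
    ext i
    rw [part_apply, part_single, map_single_eq_smul φ j a, Finsupp.smul_apply, smul_eq_mul]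
    have hproj := π.proj_mul (z - F.deg j) a (hφ.entry_mem_degree j i)
    rw [sub_add_sub_cancel] at hproj
    by_cases h : φ (Finsupp.single j 1) i = 0
    · rw [h, mul_zero, map_zero, ite_self]
      split_ifs
      · rw [map_single_eq_smul, Finsupp.smul_apply, h, smul_zero]
      · rw [map_zero, Finsupp.zero_apply]
    · have hdeg : F.hdeg j = p + n ↔ G.hdeg i = p := by rw [hφ.hdeg_eq j i h]; omega
      simp only [hdeg]
      split_ifs
      · rw [map_single_eq_smul, Finsupp.smul_apply, smul_eq_mul, hproj]
      · rw [map_zero, Finsupp.zero_apply]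

theorem d_part_zero (hF : IsResolution 𝒢 F A) (z : ℤ) (x : F.X →₀ R) :
    F.d (π.part F 0 z x) = 0 := by
  refine (map_eq_of_eqOn_support (g := 0) fun j hj => hF.d_single_eq_zero ?_).trans rfl
  by_contra h
  rw [part_apply, if_neg h] at hj
  exact hj rfl

theorem aug_part_zero (hF : IsResolution 𝒢 F A) (z : ℤ) (x : F.X →₀ R) :
    F.aug (π.part F 0 z x) = π.proj z (F.aug x) := by
  induction x using Finsupp.induction_linear with
  | zero => simp only [map_zero]
  | add x y hx hy => simp only [map_add, hx, hy]
  | single j a =>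
    rw [part_single, map_single_eq_smul _ j a, smul_eq_mul]
    split_ifs with h
    · rw [map_single_eq_smul, smul_eq_mul, ← π.proj_mul _ _ (hF.aug_single_mem j), sub_add_cancel]
    · rw [hF.aug_single_eq_zero j h, map_zero, mul_zero, map_zero]

theorem aug_part_of_ne_zero (hF : IsResolution 𝒢 F A) (hn : n ≠ 0) (z : ℤ) (x : F.X →₀ R) :
    F.aug (π.part F n z x) = 0 := by
  refine (map_eq_of_eqOn_support (g := 0) fun j hj => hF.aug_single_eq_zero j ?_).trans rfl
  rintro h
  rw [part_apply, if_neg (h ▸ hn.symm)] at hj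
  exact hj rfl

/-- The component of a linear map that preserves homological and internal degrees. -/
def homogenize (φ : F.Map G) : F.Map G :=
  Finsupp.linearCombination R fun j => π.part G (F.hdeg j) (F.deg j) (φ (Finsupp.single j 1))

theorem homogenize_single (φ : F.Map G) (j : F.X) :
    π.homogenize φ (Finsupp.single j 1) =
      π.part G (F.hdeg j) (F.deg j) (φ (Finsupp.single j 1)) := by
  rw [homogenize, Finsupp.linearCombination_single, one_smul]

theorem homogenize_isHomogeneous {φ : F.Map G} (hφ : ∀ j i, φ (Finsupp.single j 1) i ∈ c)
    (hc : ∀ z, ∀ a ∈ c, π.proj z a ∈ c) : IsHomogeneous 𝒢 F G 0 c (π.homogenize φ) where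
  hdeg_eq j i h := by
    by_contra hne
    rw [homogenize_single, part_apply, if_neg (by omega)] at h
    exact h rfl
  entry_mem_degree j i := by
    rw [homogenize_single, part_apply]
    split_ifs
    · exact π.proj_mem _ _
    · exact zero_mem _
  entry_mem_ideal j i := by
    rw [homogenize_single, part_apply]
    split_ifs
    · exact hc _ _ (hφ j i)
    · exact zero_mem _

theorem homogenize_apply_of_bihomogeneous (φ : F.Map G) {z : ℤ} {x : F.X →₀ R}
    (hdeg : ∀ i, x i ≠ 0 → F.hdeg i = n) (hmem : ∀ i, x i ∈ 𝒢 (z - F.deg i)) :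
    π.homogenize φ x = π.part G n z (φ x) := by
  rw [map_eq_sum_smul_single, map_eq_sum_smul_single φ, map_finsuppSum]
  refine Finsupp.sum_congr fun i hi => ?_
  rw [homogenize_single, hdeg i (Finsupp.mem_support_iff.mp hi), ← part_smul π _ _ (hmem i),
    add_sub_cancel]

theorem homogenize_isLift (hF : IsResolution 𝒢 F A) (hG : IsResolution 𝒢 G B) {φ : F.Map G}
    (hφ : ∀ j i, φ (Finsupp.single j 1) i ∈ c) (hc : ∀ z, ∀ a ∈ c, π.proj z a ∈ c)
    (comm_d : ∀ x, G.d (φ x) = φ (F.d x))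
    (comm_aug : ∀ j, F.hdeg j = 0 →
      G.aug (φ (Finsupp.single j 1)) = F.aug (Finsupp.single j 1)) :
    IsLift 𝒢 F G c (π.homogenize φ) where
  toIsHomogeneous := π.homogenize_isHomogeneous hφ hc
  comm_d x := by
    refine LinearMap.congr_fun (f := G.d ∘ₗ π.homogenize φ) (g := π.homogenize φ ∘ₗ F.d)
      (linearMap_ext_single fun j => ?_) x
    rw [LinearMap.comp_apply, LinearMap.comp_apply, homogenize_single]
    rcases hj : F.hdeg j with _ | n
    · rw [π.d_part_zero hG, hF.d_single_eq_zero hj, map_zero]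
    · rw [π.map_part hG.d_homogeneous, comm_d]
      refine (π.homogenize_apply_of_bihomogeneous φ (fun i hi => ?_)
        (hF.d_homogeneous.entry_mem_degree j)).symm
      have := hF.d_homogeneous.hdeg_eq j i hi
      omega
  comm_aug x := by
    refine LinearMap.congr_fun (f := G.aug ∘ₗ π.homogenize φ) (g := F.aug)
      (linearMap_ext_single fun j => ?_) x
    rw [LinearMap.comp_apply, homogenize_single]
    by_cases hj : F.hdeg j = 0
    · rw [hj, π.aug_part_zero hG, comm_aug j hj, π.proj_eq_self (hF.aug_single_mem j)]
    · rw [π.aug_part_of_ne_zero hG hj, hF.aug_single_eq_zero j hj]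

end GradingProjection

end Homogenization

section Comparison

variable {R : Type u} [CommRing R] {𝒢 : ℤ → AddSubgroup R}
variable {F G F' G' : BasedComplex R} {A B c : Ideal R}

theorem exists_map_single (R : Type*) [CommRing R] {X M : Type*} [AddCommGroup M] [Module R M]
    {P : X → M → Prop} (h : ∀ j, ∃ y, P j y) :
    ∃ f : (X →₀ R) →ₗ[R] M, ∀ j, P j (f (Finsupp.single j 1)) := by
  choose y hy using h
  refine ⟨Finsupp.linearCombination R y, fun j => ?_⟩
  rw [Finsupp.linearCombination_single, one_smul]
  exact hy j

namespace IsResolution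

theorem exists_map_zero (hF : IsResolution 𝒢 F A) (hG : IsResolution 𝒢 G B) (hAB : A ≤ B) :
    ∃ φ : F.Map G, (∀ x, G.d (φ x) = 0) ∧ ∀ x, G.aug (φ x) = F.aug x := by
  obtain ⟨φ, hφ⟩ := exists_map_single R fun j =>
    hG.exists_cycle (hAB (hF.aug_mem (Finsupp.single j 1)))
  exact ⟨φ, LinearMap.congr_fun (f := G.d ∘ₗ φ) (g := 0) (linearMap_ext_single fun j => (hφ j).1),
    LinearMap.congr_fun (f := G.aug ∘ₗ φ) (linearMap_ext_single fun j => (hφ j).2)⟩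

theorem exists_map_succ (hG : IsResolution 𝒢 G B) (φ : F.Map G) :
    ∃ φ' : F.Map G, ∀ j,
      G.d (φ (F.d (Finsupp.single j 1))) = 0 ∧ G.aug (φ (F.d (Finsupp.single j 1))) = 0 →
      G.d (φ' (Finsupp.single j 1)) = φ (F.d (Finsupp.single j 1)) ∧
      G.aug (φ' (Finsupp.single j 1)) = 0 := by
  refine exists_map_single R
    (P := fun j y => G.d (φ (F.d (Finsupp.single j 1))) = 0 ∧
      G.aug (φ (F.d (Finsupp.single j 1))) = 0 →
      G.d y = φ (F.d (Finsupp.single j 1)) ∧ G.aug y = 0) fun j => ?_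
  by_cases h : G.d (φ (F.d (Finsupp.single j 1))) = 0 ∧ G.aug (φ (F.d (Finsupp.single j 1))) = 0
  · obtain ⟨y, hy⟩ := hG.exists_preimage h.1 h.2
    exact ⟨y, fun _ => hy⟩
  · exact ⟨0, fun h' => absurd h' h⟩

theorem exists_maps (hF : IsResolution 𝒢 F A) (hG : IsResolution 𝒢 G B) (hAB : A ≤ B) :
    ∃ ψ : ℕ → F.Map G, (∀ x, G.d (ψ 0 x) = 0) ∧ (∀ x, G.aug (ψ 0 x) = F.aug x) ∧
      ∀ n j, F.hdeg j = n + 1 →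
        G.d (ψ (n + 1) (Finsupp.single j 1)) = ψ n (F.d (Finsupp.single j 1)) := by
  obtain ⟨φ, hφd, hφaug⟩ := hF.exists_map_zero hG hAB
  choose step hstep using hG.exists_map_succ (F := F)
  let ψ : ℕ → F.Map G := fun n => Nat.rec φ (fun _ => step) n
  have hd_support {n j} (hj : F.hdeg j = n + 1) {i} (hi : F.d (Finsupp.single j 1) i ≠ 0) :
      F.hdeg i = n := by
    have := hF.d_homogeneous.hdeg_eq j i hi
    omega
  have hcycle (n j) (hj : F.hdeg j = n + 1) : G.d (ψ n (F.d (Finsupp.single j 1))) = 0 ∧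
      G.aug (ψ n (F.d (Finsupp.single j 1))) = 0 := by
    induction n generalizing j with
    | zero => exact ⟨hφd _, (hφaug _).trans (hF.aug_d _)⟩
    | succ n ih =>
      constructor
      · refine (map_eq_of_eqOn_support (f := G.d ∘ₗ ψ (n + 1)) (g := ψ n ∘ₗ F.d) fun i hi =>
          (hstep (ψ n) i (ih i (hd_support hj hi))).1).trans ?_
        rw [LinearMap.comp_apply, hF.d_d, map_zero]
      · exact map_eq_of_eqOn_support (f := G.aug ∘ₗ ψ (n + 1)) (g := 0) fun i hi =>
          (hstep (ψ n) i (ih i (hd_support hj hi))).2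
  exact ⟨ψ, hφd, hφaug, fun n j hj => (hstep (ψ n) j (hcycle n j hj)).1⟩

end IsResolution

theorem IsResolution.hasLift (π : GradingProjection 𝒢) (hF : IsResolution 𝒢 F A)
    (hG : IsResolution 𝒢 G B) (hAB : A ≤ B) : HasLift 𝒢 F G ⊤ := by
  obtain ⟨ψ, hψd, hψaug, hψ⟩ := hF.exists_maps hG hAB
  obtain ⟨φ, hφ⟩ : ∃ φ : F.Map G, ∀ j,
      φ (Finsupp.single j 1) = ψ (F.hdeg j) (Finsupp.single j 1) :=
    exists_map_single R (P := fun j y => y = ψ (F.hdeg j) (Finsupp.single j 1))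
      fun _ => ⟨_, rfl⟩
  refine ⟨_, π.homogenize_isLift hF hG (φ := φ) (fun _ _ => trivial) (fun _ _ _ => trivial)
    (fun x => ?_) (fun j hj => by rw [hφ, hj, hψaug])⟩
  refine LinearMap.congr_fun (f := G.d ∘ₗ φ) (g := φ ∘ₗ F.d) (linearMap_ext_single fun j => ?_) x
  rw [LinearMap.comp_apply, LinearMap.comp_apply, hφ]
  rcases hj : F.hdeg j with _ | n
  · rw [hψd, hF.d_single_eq_zero hj, map_zero]
  · rw [hψ n j hj]
    refine map_eq_of_eqOn_support fun i hi => ?_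
    have hi' : F.hdeg i = n := by have := hF.d_homogeneous.hdeg_eq j i hi; omega
    rw [hφ, hi']

theorem HasLift.of_resolutions [SetLike.GradedMul 𝒢] (π : GradingProjection 𝒢)
    (h : HasLift 𝒢 F G c) (hF : IsResolution 𝒢 F A) (hG : IsResolution 𝒢 G B)
    (hF' : IsResolution 𝒢 F' A) (hG' : IsResolution 𝒢 G' B) : HasLift 𝒢 F' G' c := by
  simpa only [Ideal.mul_top, Ideal.top_mul] using
    (hG.hasLift π hG' le_rfl).comp (h.comp (hF'.hasLift π hF le_rfl))

end Comparison

section Nullhomotopy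

theorem exists_comp_comp_eq_self {K V W : Type*} [Field K] [AddCommGroup V] [Module K V]
    [AddCommGroup W] [Module K W] (f : V →ₗ[K] W) : ∃ g : W →ₗ[K] V, ∀ x, f (g (f x)) = f x := by
  obtain ⟨s, hs⟩ := f.rangeRestrict.exists_rightInverse_of_surjective f.range_rangeRestrict
  obtain ⟨g, hg⟩ := s.exists_extend
  refine ⟨g, fun x => ?_⟩
  have hgs : g (f x) = s ⟨f x, x, rfl⟩ := LinearMap.congr_fun hg ⟨f x, x, rfl⟩
  rw [hgs]
  exact congrArg Subtype.val (LinearMap.congr_fun hs ⟨f x, x, rfl⟩)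

theorem exists_nullhomotopy {K V W : Type*} [Field K] [AddCommGroup V] [Module K V]
    [AddCommGroup W] [Module K W] {d : V →ₗ[K] V} {d' : W →ₗ[K] W} {f : V →ₗ[K] W}
    (hd : ∀ x, d (d x) = 0) (hf : ∀ x, d' (f x) = f (d x))
    (hcycle : ∀ x, d x = 0 → ∃ y, d' y = f x) :
    ∃ h : V →ₗ[K] W, ∀ x, d' (h x) + h (d x) = f x := by
  obtain ⟨σ, hσ⟩ := exists_comp_comp_eq_self d
  obtain ⟨τ, hτ⟩ := exists_comp_comp_eq_self d'
  -- Use `f ∘ σ` on the boundaries and `τ ∘ f` on a complement of them in the cycles; the images of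
  -- `q` and `p - q` are these two subspaces.
  let p : V →ₗ[K] V := LinearMap.id - σ ∘ₗ d
  let q : V →ₗ[K] V := d ∘ₗ σ ∘ₗ p
  have hp x : p x = x - σ (d x) := rfl
  have hq x : q x = d (σ (p x)) := rfl
  have hdp x : d (p x) = 0 := by rw [hp, map_sub, hσ, sub_self]
  have hpd x : p (d x) = d x := by rw [hp, hd, map_zero, sub_zero]
  have hτf x : d' (τ (f (p x - q x))) = f (p x - q x) := by
    obtain ⟨y, hy⟩ := hcycle (p x - q x) (by rw [map_sub, hdp, hq, hd, sub_zero])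
    rw [← hy, hτ]
  refine ⟨f ∘ₗ σ ∘ₗ q + τ ∘ₗ f ∘ₗ (p - q), fun x => ?_⟩
  simp only [LinearMap.add_apply, LinearMap.comp_apply, LinearMap.sub_apply, map_add, hτf]
  have hdσq : d (σ (q x)) = q x := by rw [hq, hσ]
  have hqd : q (d x) = d x := by rw [hq, hpd, hσ]
  rw [hf, hdσq, hqd, hpd, sub_self, map_zero, map_zero, add_zero, ← map_add, ← map_add, hp]
  congr 1
  abel

variable {R : Type u} [CommRing R] (m : Ideal R)

/-- Reduction modulo `m` of the coefficients of an element of a free module. -/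
def reduce (X : Type*) : (X →₀ R) →ₗ[R] (X →₀ R ⧸ m) :=
  Finsupp.mapRange.linearMap (Algebra.linearMap R (R ⧸ m))

theorem reduce_surjective (X : Type*) : Function.Surjective (reduce m X) :=
  Finsupp.mapRange_surjective _ (map_zero _) Ideal.Quotient.mk_surjective

theorem reduce_eq_zero_iff {X : Type*} {x : X →₀ R} : reduce m X x = 0 ↔ ∀ i, x i ∈ m :=
  Finsupp.ext_iff.trans (forall_congr' fun _ => Ideal.Quotient.eq_zero_iff_mem)

/-- Reduction modulo `m` of a linear map between free modules. -/
def reduceMap {X Y : Type*} (φ : (X →₀ R) →ₗ[R] (Y →₀ R)) :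
    (X →₀ R ⧸ m) →ₗ[R ⧸ m] (Y →₀ R ⧸ m) :=
  Finsupp.linearCombination (R ⧸ m) fun j => reduce m Y (φ (Finsupp.single j 1))

theorem reduceMap_reduce {X Y : Type*} (φ : (X →₀ R) →ₗ[R] (Y →₀ R)) (x : X →₀ R) :
    reduceMap m φ (reduce m X x) = reduce m Y (φ x) := by
  refine LinearMap.congr_fun (f := (reduceMap m φ).restrictScalars R ∘ₗ reduce m X)
    (g := reduce m Y ∘ₗ φ) (linearMap_ext_single fun j => ?_) x
  simp [reduceMap, reduce]

theorem exists_reduce_eq {X Y : Type*} (h : (X →₀ R ⧸ m) →ₗ[R ⧸ m] (Y →₀ R ⧸ m)) :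
    ∃ H : (X →₀ R) →ₗ[R] (Y →₀ R), ∀ x, reduce m Y (H x) = h (reduce m X x) := by
  obtain ⟨H, hH⟩ := exists_map_single R
    (P := fun j y => reduce m Y y = h (reduce m X (Finsupp.single j 1)))
    fun j => reduce_surjective m Y _
  exact ⟨H, LinearMap.congr_fun (f := reduce m Y ∘ₗ H) (g := h.restrictScalars R ∘ₗ reduce m X)
    (linearMap_ext_single hH)⟩

variable {m} {𝒢 : ℤ → AddSubgroup R} {F G : BasedComplex R} {A B : Ideal R}

theorem IsLift.exists_homotopy_mod [m.IsMaximal] {φ : F.Map G} (hφ : IsLift 𝒢 F G ⊤ φ)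
    (hF : IsResolution 𝒢 F A)
    (hcycle : ∀ x, (∀ i, F.d x i ∈ m) → ∃ y, ∀ i, (φ x - G.d y) i ∈ m) :
    ∃ H : F.Map G, ∀ x i, (φ x - (G.d (H x) + H (F.d x))) i ∈ m := by
  let _ := Ideal.Quotient.field m
  obtain ⟨h, hh⟩ := exists_nullhomotopy
    (d := reduceMap m F.d) (d' := reduceMap m G.d) (f := reduceMap m φ)
    (fun x => by
      obtain ⟨x, rfl⟩ := reduce_surjective m _ x
      simp only [reduceMap_reduce, hF.d_d, map_zero])
    (fun x => by
      obtain ⟨x, rfl⟩ := reduce_surjective m _ x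
      simp only [reduceMap_reduce, hφ.comm_d])
    (fun x hx => by
      obtain ⟨x, rfl⟩ := reduce_surjective m _ x
      rw [reduceMap_reduce, reduce_eq_zero_iff] at hx
      obtain ⟨y, hy⟩ := hcycle x hx
      rw [← reduce_eq_zero_iff, map_sub, sub_eq_zero] at hy
      exact ⟨reduce m _ y, by rw [reduceMap_reduce, reduceMap_reduce, hy]⟩)
  obtain ⟨H, hH⟩ := exists_reduce_eq m h
  refine ⟨H, fun x => ?_⟩
  rw [← reduce_eq_zero_iff]
  simp only [map_sub, map_add, ← reduceMap_reduce, hH, hh, sub_self]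

theorem IsLift.hasLift_of_cycles_to_boundaries [m.IsMaximal] (π : GradingProjection 𝒢)
    (hm : ∀ z, ∀ a ∈ m, π.proj z a ∈ m) {φ : F.Map G} (hφ : IsLift 𝒢 F G ⊤ φ)
    (hF : IsResolution 𝒢 F A) (hG : IsResolution 𝒢 G B)
    (hcycle : ∀ x, (∀ i, F.d x i ∈ m) → ∃ y, ∀ i, (φ x - G.d y) i ∈ m) : HasLift 𝒢 F G m := by
  obtain ⟨H, hH⟩ := hφ.exists_homotopy_mod hF hcycle
  refine ⟨_, π.homogenize_isLift hF hG (φ := φ - (G.d ∘ₗ H + H ∘ₗ F.d)) (fun j => hH _) hm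
    (fun x => ?_) (fun j hj => ?_)⟩
  · simp only [LinearMap.sub_apply, LinearMap.add_apply, LinearMap.comp_apply, map_sub, map_add,
      hF.d_d, hG.d_d, hφ.comm_d, map_zero, zero_add, add_zero]
  · simp only [LinearMap.sub_apply, LinearMap.add_apply, LinearMap.comp_apply, map_sub,
      hF.d_single_eq_zero hj, hG.aug_d, hφ.comm_aug, map_zero, add_zero, sub_zero]

end Nullhomotopy

section Fibers

variable {R : Type u} [CommRing R]

namespace BasedComplex

/-- The basis elements of homological degree `n`. -/
abbrev Fiber (F : BasedComplex R) (n : ℕ) : Type u := {j : F.X // F.hdeg j = n}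

/-- The inclusion of the part of homological degree `n`. -/
def incl (F : BasedComplex R) (n : ℕ) : (F.Fiber n →₀ R) →ₗ[R] (F.X →₀ R) :=
  Finsupp.lmapDomain R R Subtype.val

/-- The restriction to the part of homological degree `n`. -/
def restr (F : BasedComplex R) (n : ℕ) : (F.X →₀ R) →ₗ[R] (F.Fiber n →₀ R) :=
  Finsupp.lsubtypeDomain {j : F.X | F.hdeg j = n}

/-- The block of a linear map between the parts of homological degrees `p` and `q`. -/
def block {F G : BasedComplex R} (φ : F.Map G) (p q : ℕ) :
    (F.Fiber p →₀ R) →ₗ[R] (G.Fiber q →₀ R) :=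
  G.restr q ∘ₗ φ ∘ₗ F.incl p

/-- The elements supported in homological degrees from `s`. -/
abbrev chains (F : BasedComplex R) (s : Set ℕ) : Submodule R (F.X →₀ R) :=
  Finsupp.supported R R (F.hdeg ⁻¹' s)

variable (F : BasedComplex R) (n : ℕ)

theorem incl_single (j : F.Fiber n) (a : R) :
    F.incl n (Finsupp.single j a) = Finsupp.single j.1 a :=
  Finsupp.mapDomain_single

theorem incl_apply (x : F.Fiber n →₀ R) (j : F.Fiber n) : F.incl n x j.1 = x j :=
  Finsupp.mapDomain_apply Subtype.val_injective x j

theorem restr_apply (x : F.X →₀ R) (j : F.Fiber n) : F.restr n x j = x j.1 :=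
  rfl

theorem restr_incl (x : F.Fiber n →₀ R) : F.restr n (F.incl n x) = x :=
  Finsupp.ext fun j => F.incl_apply n x j

theorem incl_mem_chains (x : F.Fiber n →₀ R) : F.incl n x ∈ F.chains {n} := by
  rw [Finsupp.mem_supported']
  exact fun i hi => Finsupp.mapDomain_of_notMem_range _ _ fun ⟨j, hj⟩ => hi (hj ▸ j.2)

variable {F n}

theorem incl_restr (x : F.X →₀ R) : F.incl n (F.restr n x) = x.filter fun j => F.hdeg j = n := by
  ext i
  by_cases hi : F.hdeg i = n
  · rw [Finsupp.filter_apply_pos (fun j => F.hdeg j = n) x hi]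
    exact F.incl_apply n (F.restr n x) ⟨i, hi⟩
  · rw [Finsupp.filter_apply_neg (fun j => F.hdeg j = n) x hi]
    exact (Finsupp.mem_supported' R _).mp (F.incl_mem_chains n _) i hi

theorem incl_restr_of_mem_chains {x : F.X →₀ R} (hx : x ∈ F.chains {n}) :
    F.incl n (F.restr n x) = x := by
  rw [incl_restr, Finsupp.filter_eq_self_iff]
  exact fun i hi => (Finsupp.mem_supported R x).mp hx (Finsupp.mem_support_iff.mpr hi)

end BasedComplex

variable {𝒢 : ℤ → AddSubgroup R} {F G : BasedComplex R} {n : ℕ} {c : Ideal R}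

theorem IsHomogeneous.map_mem_chains {φ : F.Map G} (hφ : IsHomogeneous 𝒢 F G n c φ) {p : ℕ}
    {x : F.X →₀ R} (hx : x ∈ F.chains {p + n}) : φ x ∈ G.chains {p} := by
  rw [Finsupp.mem_supported']
  intro i hi
  rw [map_apply_eq_sum]
  refine Finset.sum_eq_zero fun j hj => ?_
  by_contra h
  have hdeg : F.hdeg j = p + n := (Finsupp.mem_supported R x).mp hx hj
  exact hi (Nat.add_right_cancel (hφ.hdeg_eq j i (right_ne_zero_of_mul h) ▸ hdeg))

theorem IsHomogeneous.incl_block {φ : F.Map G} (hφ : IsHomogeneous 𝒢 F G n c φ) (p : ℕ)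
    (x : F.Fiber (p + n) →₀ R) :
    G.incl p (BasedComplex.block φ (p + n) p x) = φ (F.incl (p + n) x) :=
  BasedComplex.incl_restr_of_mem_chains (hφ.map_mem_chains (F.incl_mem_chains _ x))

theorem IsHomogeneous.block_restr {φ : F.Map G} (hφ : IsHomogeneous 𝒢 F G n c φ) (p : ℕ)
    (x : F.X →₀ R) :
    BasedComplex.block φ (p + n) p (F.restr (p + n) x) = G.restr p (φ x) := by
  ext i
  change φ (F.incl (p + n) (F.restr (p + n) x)) i.1 = φ x i.1
  rw [← sub_eq_zero, ← Finsupp.sub_apply, ← map_sub, map_apply_eq_sum]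
  refine Finset.sum_eq_zero fun j _ => ?_
  by_cases h : φ (Finsupp.single j 1) i.1 = 0
  · simp only [h, mul_zero]
  · have hj : F.hdeg j = p + n := i.2 ▸ hφ.hdeg_eq j i.1 h
    simp only [Finsupp.sub_apply, F.incl_apply _ _ ⟨j, hj⟩, F.restr_apply, sub_self, zero_mul]

theorem IsHomogeneous.block_eq_zero {φ : F.Map G} (hφ : IsHomogeneous 𝒢 F G n c φ) {p q : ℕ}
    (h : q + n ≠ p) : BasedComplex.block φ p q = 0 := by
  refine linearMap_ext_single fun j => Finsupp.ext fun i => ?_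
  change φ (F.incl p (Finsupp.single j 1)) i.1 = 0
  rw [F.incl_single]
  by_contra hne
  exact h (by rw [← j.2, ← i.2, hφ.hdeg_eq _ _ hne])

end Fibers

section ProjectiveResolutions

variable {R : Type u} [CommRing R] {𝒢 : ℤ → AddSubgroup R}
variable {F G : BasedComplex R} {A B c : Ideal R}

namespace IsResolution

theorem aug_eq_zero_of_mem_chains (hF : IsResolution 𝒢 F A) {n : ℕ} {x : F.X →₀ R}
    (hx : x ∈ F.chains {n + 1}) : F.aug x = 0 := by
  refine (map_eq_of_eqOn_support (g := 0) fun j hj => hF.aug_single_eq_zero j ?_).trans rfl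
  have hdeg : F.hdeg j = n + 1 :=
    (Finsupp.mem_supported R x).mp hx (Finsupp.mem_support_iff.mpr hj)
  rw [hdeg]
  exact n.succ_ne_zero

theorem d_eq_zero_of_mem_chains (hF : IsResolution 𝒢 F A) {x : F.X →₀ R}
    (hx : x ∈ F.chains {0}) : F.d x = 0 :=
  (map_eq_of_eqOn_support (g := 0) fun _ hj => hF.d_single_eq_zero
    ((Finsupp.mem_supported R x).mp hx (Finsupp.mem_support_iff.mpr hj))).trans rfl

theorem block_d_block_d (hF : IsResolution 𝒢 F A) (n : ℕ) (x : F.Fiber (n + 2) →₀ R) :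
    BasedComplex.block F.d (n + 1) n (BasedComplex.block F.d (n + 2) (n + 1) x) = 0 := by
  change BasedComplex.block F.d (n + 1) n (F.restr (n + 1) (F.d (F.incl (n + 2) x))) = 0
  rw [hF.d_homogeneous.block_restr, hF.d_d, map_zero]

theorem exists_block_d_eq (hF : IsResolution 𝒢 F A) {n : ℕ} {x : F.Fiber n →₀ R}
    (hd : F.d (F.incl n x) = 0) (haug : F.aug (F.incl n x) = 0) :
    ∃ y, BasedComplex.block F.d (n + 1) n y = x := by
  obtain ⟨y, hy⟩ := hF.exact _ hd haug
  exact ⟨F.restr (n + 1) y, by rw [hF.d_homogeneous.block_restr, hy, F.restr_incl]⟩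

theorem exact_block_d (hF : IsResolution 𝒢 F A) (n : ℕ) (x : F.Fiber (n + 1) →₀ R)
    (hx : BasedComplex.block F.d (n + 1) n x = 0) :
    ∃ y, BasedComplex.block F.d (n + 2) (n + 1) y = x :=
  hF.exists_block_d_eq (by rw [← hF.d_homogeneous.incl_block, hx, map_zero])
    (hF.aug_eq_zero_of_mem_chains (F.incl_mem_chains _ x))

/-- The augmentation onto the resolved ideal. -/
def augTo (hF : IsResolution 𝒢 F A) : (F.Fiber 0 →₀ R) →ₗ[R] A :=
  (F.aug ∘ₗ F.incl 0).codRestrict A fun _ => hF.aug_mem _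

theorem augTo_restr (hF : IsResolution 𝒢 F A) (x : F.X →₀ R) :
    (hF.augTo (F.restr 0 x) : R) = F.aug x := by
  rw [← hF.aug_filter_hdeg_zero x, ← BasedComplex.incl_restr]
  rfl

theorem augTo_surjective (hF : IsResolution 𝒢 F A) : Function.Surjective hF.augTo := by
  rintro ⟨a, ha⟩
  obtain ⟨x, -, rfl⟩ := hF.exists_cycle ha
  exact ⟨F.restr 0 x, Subtype.ext (hF.augTo_restr x)⟩

theorem augTo_block_d (hF : IsResolution 𝒢 F A) (x : F.Fiber 1 →₀ R) :
    hF.augTo (BasedComplex.block F.d 1 0 x) = 0 :=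
  Subtype.ext ((hF.augTo_restr _).trans (hF.aug_d _))

theorem exact_augTo (hF : IsResolution 𝒢 F A) (x : F.Fiber 0 →₀ R) (hx : hF.augTo x = 0) :
    ∃ y, BasedComplex.block F.d 1 0 y = x :=
  hF.exists_block_d_eq (hF.d_eq_zero_of_mem_chains (F.incl_mem_chains 0 x))
    (congrArg Subtype.val hx)

/-- The chain complex of modules underlying a resolution. -/
def chainComplex (hF : IsResolution 𝒢 F A) : ChainComplex (ModuleCat.{u} R) ℕ where
  X n := ModuleCat.of R (F.Fiber n →₀ R)
  d p q := ModuleCat.ofHom (BasedComplex.block F.d p q)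
  shape p q h := by
    rw [hF.d_homogeneous.block_eq_zero (by simpa using h)]
    rfl
  d_comp_d' := by
    rintro _ _ n rfl rfl
    ext1
    exact LinearMap.ext (hF.block_d_block_d n)

theorem chainComplex_d_comp_augTo (hF : IsResolution 𝒢 F A) :
    hF.chainComplex.d 1 0 ≫ ModuleCat.ofHom hF.augTo = 0 := by
  ext1
  exact LinearMap.ext hF.augTo_block_d

/-- The augmentation as a map to a complex concentrated in degree zero. -/
def chainComplexAug (hF : IsResolution 𝒢 F A) :
    hF.chainComplex ⟶ (ChainComplex.single₀ (ModuleCat.{u} R)).obj (ModuleCat.of R A) :=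
  (ChainComplex.toSingle₀Equiv _ _).symm ⟨ModuleCat.ofHom hF.augTo, hF.chainComplex_d_comp_augTo⟩

theorem chainComplexAug_f_zero (hF : IsResolution 𝒢 F A) :
    hF.chainComplexAug.f 0 = ModuleCat.ofHom hF.augTo :=
  ChainComplex.toSingle₀Equiv_symm_apply_f_zero (C := hF.chainComplex)
    (X := ModuleCat.of R A) (ModuleCat.ofHom hF.augTo) hF.chainComplex_d_comp_augTo

theorem quasiIsoAt_chainComplexAug_zero (hF : IsResolution 𝒢 F A) :
    QuasiIsoAt hF.chainComplexAug 0 := by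
  rw [ChainComplex.quasiIsoAt₀_iff, ShortComplex.quasiIso_iff_of_zeros']
  · let S := ShortComplex.mk _ _ hF.chainComplex_d_comp_augTo
    refine (ShortComplex.exact_and_epi_g_iff_of_iso (S₂ := S) ?_).2 ⟨?_, ?_⟩
    · exact ShortComplex.isoMk (Iso.refl _) (Iso.refl _) (Iso.refl _)
        (by simp [S]; rfl)
        ((Category.id_comp _).trans
          (hF.chainComplexAug_f_zero.symm.trans (Category.comp_id _).symm))
    · rw [ShortComplex.moduleCat_exact_iff]
      exact hF.exact_augTo
    · rw [ModuleCat.epi_iff_surjective]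
      exact hF.augTo_surjective
  · exact hF.chainComplex.shape _ _ (by simp)
  all_goals rfl

theorem quasiIsoAt_chainComplexAug_succ (hF : IsResolution 𝒢 F A) (n : ℕ) :
    QuasiIsoAt hF.chainComplexAug (n + 1) := by
  rw [quasiIsoAt_iff_exactAt' _ _ (ChainComplex.exactAt_succ_single_obj _ _),
    HomologicalComplex.exactAt_iff' _ (n + 2) (n + 1) n (by simp) (by simp),
    ShortComplex.moduleCat_exact_iff]
  exact hF.exact_block_d n

/-- The projective resolution in the sense of homological algebra given by a resolution. -/
def projectiveResolution (hF : IsResolution 𝒢 F A) : ProjectiveResolution (ModuleCat.of R A) where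
  complex := hF.chainComplex
  projective n := inferInstanceAs (Projective (ModuleCat.of R (F.Fiber n →₀ R)))
  π := hF.chainComplexAug
  quasiIso := ⟨fun n => match n with
    | 0 => hF.quasiIsoAt_chainComplexAug_zero
    | n + 1 => hF.quasiIsoAt_chainComplexAug_succ n⟩

end IsResolution

theorem IsLift.block_d_block {φ : F.Map G} (hφ : IsLift 𝒢 F G c φ) (hF : IsResolution 𝒢 F A)
    (hG : IsResolution 𝒢 G B) (n : ℕ) (x : F.Fiber (n + 1) →₀ R) :
    BasedComplex.block G.d (n + 1) n (BasedComplex.block φ (n + 1) (n + 1) x) =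
      BasedComplex.block φ n n (BasedComplex.block F.d (n + 1) n x) := by
  change BasedComplex.block G.d (n + 1) n (G.restr (n + 1) (φ (F.incl (n + 1) x))) =
    G.restr n (φ (F.incl n (BasedComplex.block F.d (n + 1) n x)))
  rw [hG.d_homogeneous.block_restr, hF.d_homogeneous.incl_block, hφ.comm_d]

theorem IsLift.augTo_block {φ : F.Map G} (hφ : IsLift 𝒢 F G c φ) (hF : IsResolution 𝒢 F A)
    (hG : IsResolution 𝒢 G B) (x : F.Fiber 0 →₀ R) :
    hG.augTo (BasedComplex.block φ 0 0 x) = Submodule.inclusion (hφ.le hF hG) (hF.augTo x) :=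
  Subtype.ext ((hG.augTo_restr _).trans (hφ.comm_aug _))

/-- The map of chain complexes of modules given by a lift. -/
def IsLift.chainMap {φ : F.Map G} (hφ : IsLift 𝒢 F G c φ) (hF : IsResolution 𝒢 F A)
    (hG : IsResolution 𝒢 G B) : hF.chainComplex ⟶ hG.chainComplex where
  f n := ModuleCat.ofHom (BasedComplex.block φ n n)
  comm' := by
    rintro _ n rfl
    ext1
    exact LinearMap.ext (hφ.block_d_block hF hG n)

theorem IsLift.chainMap_comp_augTo {φ : F.Map G} (hφ : IsLift 𝒢 F G c φ)
    (hF : IsResolution 𝒢 F A) (hG : IsResolution 𝒢 G B) :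
    (hφ.chainMap hF hG).f 0 ≫ hG.chainComplexAug.f 0 =
      hF.chainComplexAug.f 0 ≫ ModuleCat.ofHom (Submodule.inclusion (hφ.le hF hG)) := by
  rw [hF.chainComplexAug_f_zero, hG.chainComplexAug_f_zero]
  ext1
  exact LinearMap.ext (hφ.augTo_block hF hG)

end ProjectiveResolutions

section Subquotient

variable {R M N : Type*} [CommRing R] [AddCommGroup M] [Module R M] [AddCommGroup N] [Module R N]

/-- The module `C ⧸ (C ⊓ D)` for submodules `C` and `D`. -/
def Subquotient (C D : Submodule R M) : Type _ :=
  C ⧸ D.submoduleOf C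

instance (C D : Submodule R M) : AddCommGroup (Subquotient C D) :=
  inferInstanceAs (AddCommGroup (C ⧸ D.submoduleOf C))

instance (C D : Submodule R M) : Module R (Subquotient C D) :=
  inferInstanceAs (Module R (C ⧸ D.submoduleOf C))

/-- A surjection from `C` whose kernel is `C ⊓ D` identifies its target with the subquotient. -/
def subquotientEquiv {C D : Submodule R M} (θ : C →ₗ[R] N) (hθ : Function.Surjective θ)
    (hker : ∀ x, θ x = 0 ↔ x.1 ∈ D) : Subquotient C D ≃ₗ[R] N :=
  Submodule.quotEquivOfEq (D.submoduleOf C) (LinearMap.ker θ)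
    (Submodule.ext fun x => (hker x).symm) ≪≫ₗ θ.quotKerEquivOfSurjective hθ

end Subquotient

section HomologyMod

variable {R : Type u} [CommRing R] (m : Ideal R)

/-- The elements supported in homological degrees from `s` whose boundary vanishes modulo `m`. -/
def cyclesMod (F : BasedComplex R) (s : Set ℕ) : Submodule R (F.X →₀ R) :=
  F.chains s ⊓ LinearMap.ker (reduce m F.X ∘ₗ F.d)

/-- The elements that are boundaries modulo `m`. -/
def boundariesMod (F : BasedComplex R) : Submodule R (F.X →₀ R) :=
  (LinearMap.range (reduce m F.X ∘ₗ F.d)).comap (reduce m F.X)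

/-- The homology of `R ⧸ m ⊗ F` in the homological degrees from `s`. -/
abbrev HomologyMod (F : BasedComplex R) (s : Set ℕ) : Type u :=
  Subquotient (cyclesMod m F s) (boundariesMod m F)

variable {m} {F : BasedComplex R} {s : Set ℕ} {x : F.X →₀ R}

theorem mem_cyclesMod : x ∈ cyclesMod m F s ↔ x ∈ F.chains s ∧ ∀ i, F.d x i ∈ m :=
  and_congr_right fun _ => reduce_eq_zero_iff m

theorem mem_boundariesMod : x ∈ boundariesMod m F ↔ ∃ y, ∀ i, (x - F.d y) i ∈ m := by
  refine exists_congr fun y => ?_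
  rw [← reduce_eq_zero_iff, map_sub, sub_eq_zero, eq_comm]
  rfl

end HomologyMod

section TensorQuotient

variable {R : Type u} [CommRing R] (m : Ideal R)

open MonoidalCategory in
/-- Tensoring modules with `R ⧸ m` on the left. -/
abbrev quotTensor : ModuleCat.{u} R ⥤ ModuleCat.{u} R :=
  (tensoringLeft (ModuleCat.{u} R)).obj (ModuleCat.of R (R ⧸ m))

theorem one_tmul_eq_zero_iff {X : Type u} (x : X →₀ R) :
    (1 : R ⧸ m) ⊗ₜ[R] x = 0 ↔ ∀ i, x i ∈ m := by
  rw [← mem_smul_top_iff, ← Submodule.Quotient.mk_eq_zero,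
    ← LinearEquiv.map_eq_zero_iff (TensorProduct.quotTensorEquivQuotSMul (X →₀ R) m),
    ← map_one (Ideal.Quotient.mk m), TensorProduct.quotTensorEquivQuotSMul_mk_tmul, one_smul]

theorem one_tmul_eq_iff {X : Type u} (x y : X →₀ R) :
    (1 : R ⧸ m) ⊗ₜ[R] x = (1 : R ⧸ m) ⊗ₜ[R] y ↔ ∀ i, (x - y) i ∈ m := by
  rw [← sub_eq_zero, ← TensorProduct.tmul_sub, one_tmul_eq_zero_iff]

theorem one_tmul_surjective (M : Type u) [AddCommGroup M] [Module R M] :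
    Function.Surjective (TensorProduct.mk R (R ⧸ m) M 1) :=
  TensorProduct.mk_surjective R M (R ⧸ m) Ideal.Quotient.mk_surjective

theorem homologyπ_eq_zero_iff (S : ShortComplex (ModuleCat.{u} R)) (c : S.cycles) :
    S.homologyπ c = 0 ↔ ∃ y, S.f y = S.iCycles c := by
  have hι : Function.Injective S.homologyι := (ModuleCat.mono_iff_injective _).1 inferInstance
  have hπι : S.homologyι (S.homologyπ c) = S.pOpcycles (S.iCycles c) := by
    rw [← ConcreteCategory.comp_apply, S.homology_π_ι, ConcreteCategory.comp_apply]
  rw [← map_eq_zero_iff S.homologyι.hom hι]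
  change S.homologyι (S.homologyπ c) = 0 ↔ _
  rw [hπι, ShortComplex.moduleCat_pOpcycles_eq_zero_iff]
  rfl

end TensorQuotient

section TensoredHomology

variable {R : Type u} [CommRing R] {m : Ideal R} {𝒢 : ℤ → AddSubgroup R}
variable {F G : BasedComplex R} {A B c : Ideal R}

variable (m) in
/-- The image of an element in degree `n` of the complex `R ⧸ m ⊗ F`. -/
def toTensored (F : BasedComplex R) (n : ℕ) :
    (F.X →₀ R) →ₗ[R] (R ⧸ m) ⊗[R] (F.Fiber n →₀ R) :=
  TensorProduct.mk R (R ⧸ m) _ 1 ∘ₗ F.restr n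

namespace IsResolution

variable (m) in
/-- The complex `R ⧸ m ⊗ F`. -/
abbrev tensored (hF : IsResolution 𝒢 F A) : ChainComplex (ModuleCat.{u} R) ℕ :=
  ((quotTensor m).mapHomologicalComplex _).obj hF.chainComplex

variable (m) in
/-- The map `toTensored` on the elements that are cycles modulo `m`. -/
def cyclesModToTensored (hF : IsResolution 𝒢 F A) (n : ℕ) :
    ModuleCat.of R (cyclesMod m F {n}) ⟶ ((hF.tensored m).sc n).X₂ :=
  ModuleCat.ofHom (toTensored m F n ∘ₗ (cyclesMod m F {n}).subtype)

theorem cyclesModToTensored_comp_g (hF : IsResolution 𝒢 F A) (n : ℕ) :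
    hF.cyclesModToTensored m n ≫ ((hF.tensored m).sc n).g = 0 := by
  ext x
  change (1 : R ⧸ m) ⊗ₜ[R] F.restr _ (F.d (F.incl n (F.restr n x.1))) = 0
  obtain ⟨hx, hdx⟩ := mem_cyclesMod.mp x.2
  rw [one_tmul_eq_zero_iff, BasedComplex.incl_restr_of_mem_chains hx]
  exact fun i => hdx i.1

variable (m) in
/-- An element that is a cycle modulo `m`, as a cycle of the complex `R ⧸ m ⊗ F`. -/
def tensoredCycle (hF : IsResolution 𝒢 F A) (n : ℕ) :
    cyclesMod m F {n} →ₗ[R] (hF.tensored m).cycles n :=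
  (((hF.tensored m).sc n).liftCycles _ (hF.cyclesModToTensored_comp_g n)).hom

theorem iCycles_tensoredCycle (hF : IsResolution 𝒢 F A) {n : ℕ} (x : cyclesMod m F {n}) :
    (hF.tensored m).iCycles n (hF.tensoredCycle m n x) = toTensored m F n x :=
  ConcreteCategory.congr_hom
    (((hF.tensored m).sc n).liftCycles_i _ (hF.cyclesModToTensored_comp_g n)) x

theorem iCycles_injective (hF : IsResolution 𝒢 F A) (n : ℕ) :
    Function.Injective ((hF.tensored m).iCycles n) :=
  (ModuleCat.mono_iff_injective _).1 inferInstance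

theorem d_mem_of_block_d_mem (hF : IsResolution 𝒢 F A) {n : ℕ} {x : F.Fiber n →₀ R}
    (hx : ∀ i, BasedComplex.block F.d n ((ComplexShape.down ℕ).next n) x i ∈ m) (i : F.X) :
    F.d (F.incl n x) i ∈ m := by
  cases n with
  | zero =>
    rw [hF.d_eq_zero_of_mem_chains (F.incl_mem_chains 0 x)]
    exact m.zero_mem
  | succ n =>
    rw [ChainComplex.next_nat_succ] at hx
    rw [← hF.d_homogeneous.incl_block]
    exact map_apply_mem_of_forall_mem _ hx i

theorem tensoredCycle_surjective (hF : IsResolution 𝒢 F A) (n : ℕ) :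
    Function.Surjective (hF.tensoredCycle m n) := by
  intro c
  obtain ⟨x, hx⟩ := one_tmul_surjective m (F.Fiber n →₀ R) ((hF.tensored m).iCycles n c)
  have hg : ((hF.tensored m).sc n).g ((hF.tensored m).iCycles n c) = 0 :=
    ConcreteCategory.congr_hom ((hF.tensored m).sc n).iCycles_g c
  rw [← hx] at hg
  have hdx := (one_tmul_eq_zero_iff m
    (BasedComplex.block F.d n ((ComplexShape.down ℕ).next n) x)).mp hg
  refine ⟨⟨F.incl n x, mem_cyclesMod.mpr ⟨F.incl_mem_chains n x, hF.d_mem_of_block_d_mem hdx⟩⟩,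
    hF.iCycles_injective n ?_⟩
  rw [hF.iCycles_tensoredCycle, ← hx]
  exact congrArg ((1 : R ⧸ m) ⊗ₜ[R] ·) (F.restr_incl n x)

theorem exists_block_d_sub_mem_iff (hF : IsResolution 𝒢 F A) {n : ℕ} {x : F.X →₀ R}
    (hx : x ∈ F.chains {n}) :
    (∃ y, ∀ i, (BasedComplex.block F.d (n + 1) n y - F.restr n x) i ∈ m) ↔
      x ∈ boundariesMod m F := by
  rw [mem_boundariesMod]
  constructor
  · rintro ⟨y, hy⟩
    refine ⟨F.incl (n + 1) y, fun i => ?_⟩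
    rw [← neg_sub, ← hF.d_homogeneous.incl_block, ← BasedComplex.incl_restr_of_mem_chains hx,
      ← map_sub]
    exact m.neg_mem (map_apply_mem_of_forall_mem _ hy i)
  · rintro ⟨y, hy⟩
    refine ⟨F.restr (n + 1) y, fun i => ?_⟩
    rw [hF.d_homogeneous.block_restr, ← neg_sub, ← map_sub]
    exact m.neg_mem (hy i.1)

theorem homologyπ_tensoredCycle_eq_zero_iff (hF : IsResolution 𝒢 F A) {n : ℕ}
    (x : cyclesMod m F {n}) :
    (hF.tensored m).homologyπ n (hF.tensoredCycle m n x) = 0 ↔ x.1 ∈ boundariesMod m F := by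
  have hprev : (ComplexShape.down ℕ).prev n = n + 1 := by simp
  refine (homologyπ_eq_zero_iff ((hF.tensored m).sc n) _).trans ?_
  rw [← hF.exists_block_d_sub_mem_iff (mem_cyclesMod.mp x.2).1, ← hprev]
  refine (one_tmul_surjective m (F.Fiber _ →₀ R)).exists.trans (exists_congr fun y => ?_)
  rw [← one_tmul_eq_iff]
  exact Eq.congr_right (hF.iCycles_tensoredCycle x)

variable (m) in
/-- The homology of `R ⧸ m ⊗ F` in terms of elements of `F`. -/
def tensoredHomologyEquiv (hF : IsResolution 𝒢 F A) (n : ℕ) :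
    HomologyMod m F {n} ≃ₗ[R] (hF.tensored m).homology n :=
  subquotientEquiv (((hF.tensored m).homologyπ n).hom ∘ₗ hF.tensoredCycle m n)
    (((ModuleCat.epi_iff_surjective ((hF.tensored m).homologyπ n)).1 inferInstance).comp
      (hF.tensoredCycle_surjective n))
    hF.homologyπ_tensoredCycle_eq_zero_iff

end IsResolution

theorem IsLift.map_mem_cyclesMod {φ : F.Map G} (hφ : IsLift 𝒢 F G c φ) {n : ℕ} {x : F.X →₀ R}
    (hx : x ∈ cyclesMod m F {n}) : φ x ∈ cyclesMod m G {n} := by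
  obtain ⟨hx, hdx⟩ := mem_cyclesMod.mp hx
  refine mem_cyclesMod.mpr ⟨hφ.map_mem_chains hx, fun i => ?_⟩
  rw [hφ.comm_d]
  exact map_apply_mem_of_forall_mem φ hdx i

theorem IsLift.homologyMap_homologyπ {φ : F.Map G} (hφ : IsLift 𝒢 F G c φ)
    (hF : IsResolution 𝒢 F A) (hG : IsResolution 𝒢 G B) {n : ℕ} (x : cyclesMod m F {n}) :
    HomologicalComplex.homologyMap
        (((quotTensor m).mapHomologicalComplex _).map (hφ.chainMap hF hG)) n
        ((hF.tensored m).homologyπ n (hF.tensoredCycle m n x)) =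
      (hG.tensored m).homologyπ n
        (hG.tensoredCycle m n ⟨φ x, hφ.map_mem_cyclesMod x.2⟩) := by
  set f := ((quotTensor m).mapHomologicalComplex (ComplexShape.down ℕ)).map (hφ.chainMap hF hG)
  refine (ConcreteCategory.congr_hom (HomologicalComplex.homologyπ_naturality f n) _).trans ?_
  change (hG.tensored m).homologyπ n (HomologicalComplex.cyclesMap f n _) = _
  refine congrArg ((hG.tensored m).homologyπ n) (hG.iCycles_injective n ?_)
  refine (ConcreteCategory.congr_hom (HomologicalComplex.cyclesMap_i f n) _).trans ?_
  change f.f n ((hF.tensored m).iCycles n (hF.tensoredCycle m n x)) = _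
  rw [hF.iCycles_tensoredCycle, hG.iCycles_tensoredCycle]
  exact congrArg ((1 : R ⧸ m) ⊗ₜ[R] ·) (hφ.block_restr n x)

end TensoredHomology

section TorVanishing

variable {k R : Type u} [Field k] [CommRing R] [Algebra k R] (𝒜 : ℕ → Submodule k R)
variable {𝒢 : ℤ → AddSubgroup R} {F G : BasedComplex R} {A B c : Ideal R}

/-- `Tor` computed by a resolution. -/
def IsResolution.torIso (hF : IsResolution 𝒢 F A) (n : ℕ) :
    ((Tor (ModuleCat.{u} R) n).obj (ModuleCat.of R (R ⧸ gradedMax 𝒜))).obj (ModuleCat.of R A) ≅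
      (hF.tensored (gradedMax 𝒜)).homology n :=
  hF.projectiveResolution.isoLeftDerivedObj (quotTensor (gradedMax 𝒜)) n

theorem IsLift.torMap_comp_torIso {φ : F.Map G} (hφ : IsLift 𝒢 F G c φ)
    (hF : IsResolution 𝒢 F A) (hG : IsResolution 𝒢 G B) (n : ℕ) :
    torMap 𝒜 n (Submodule.inclusion (hφ.le hF hG)) ≫ (hG.torIso 𝒜 n).hom =
      (hF.torIso 𝒜 n).hom ≫ HomologicalComplex.homologyMap
        (((quotTensor (gradedMax 𝒜)).mapHomologicalComplex _).map (hφ.chainMap hF hG)) n :=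
  ProjectiveResolution.isoLeftDerivedObj_hom_naturality
    (ModuleCat.ofHom (Submodule.inclusion (hφ.le hF hG))) hF.projectiveResolution
    hG.projectiveResolution (hφ.chainMap hF hG) (hφ.chainMap_comp_augTo hF hG)
    (quotTensor (gradedMax 𝒜)) n

theorem IsLift.torMap_eq_zero_iff {φ : F.Map G} (hφ : IsLift 𝒢 F G c φ)
    (hF : IsResolution 𝒢 F A) (hG : IsResolution 𝒢 G B) (n : ℕ) :
    torMap 𝒜 n (Submodule.inclusion (hφ.le hF hG)) = 0 ↔
      ∀ x ∈ cyclesMod (gradedMax 𝒜) F {n}, φ x ∈ boundariesMod (gradedMax 𝒜) G := by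
  have hsurj : Function.Surjective fun x =>
      (hF.tensored (gradedMax 𝒜)).homologyπ n (hF.tensoredCycle (gradedMax 𝒜) n x) :=
    ((ModuleCat.epi_iff_surjective _).1 inferInstance).comp (hF.tensoredCycle_surjective n)
  rw [← Preadditive.IsIso.comp_right_eq_zero _ (hG.torIso 𝒜 n).hom, hφ.torMap_comp_torIso 𝒜 hF hG,
    Preadditive.IsIso.comp_left_eq_zero, ModuleCat.hom_ext_iff, LinearMap.ext_iff, hsurj.forall,
    Subtype.forall]
  refine forall₂_congr fun x hx => ?_
  rw [← hG.homologyπ_tensoredCycle_eq_zero_iff ⟨φ x, hφ.map_mem_cyclesMod hx⟩,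
    ← hφ.homologyMap_homologyπ hF hG ⟨x, hx⟩]
  rfl

theorem HasLift.inclusionTorVanishing (h : HasLift 𝒢 F G (gradedMax 𝒜))
    (hF : IsResolution 𝒢 F A) (hG : IsResolution 𝒢 G B) : InclusionTorVanishing 𝒜 A B := by
  obtain ⟨φ, hφ⟩ := h
  refine ⟨hφ.le hF hG, fun n => (hφ.torMap_eq_zero_iff 𝒜 hF hG n).mpr fun x _ => ?_⟩
  refine mem_boundariesMod.mpr ⟨0, fun i => ?_⟩
  rw [map_zero, sub_zero]
  exact hφ.apply_mem x i

theorem IsResolution.incl_restr_mem_cyclesMod {m : Ideal R} (hF : IsResolution 𝒢 F A)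
    {x : F.X →₀ R} (hx : ∀ i, F.d x i ∈ m) (n : ℕ) :
    F.incl n (F.restr n x) ∈ cyclesMod m F {n} := by
  refine mem_cyclesMod.mpr ⟨F.incl_mem_chains n _, fun i => ?_⟩
  cases n with
  | zero =>
    rw [hF.d_eq_zero_of_mem_chains (F.incl_mem_chains 0 _)]
    exact m.zero_mem
  | succ n =>
    rw [← hF.d_homogeneous.incl_block, hF.d_homogeneous.block_restr]
    exact map_apply_mem_of_forall_mem _ (fun j => hx j.1) i

theorem BasedComplex.mem_of_forall_incl_restr_mem (F : BasedComplex R) (x : F.X →₀ R)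
    {S : Submodule R (F.X →₀ R)} (h : ∀ n, F.incl n (F.restr n x) ∈ S) : x ∈ S := by
  have hx : x = ∑ n ∈ Finset.range (x.support.sup F.hdeg + 1), x.filter (F.hdeg · = n) := by
    ext i
    rw [Finsupp.finsetSum_apply]
    simp only [Finsupp.filter_apply, Finset.sum_ite_eq, Finset.mem_range]
    split_ifs with hi
    · rfl
    · exact Finsupp.notMem_support_iff.mp fun hmem =>
        hi (Nat.lt_succ_of_le (Finset.le_sup hmem))
  rw [hx]
  exact S.sum_mem fun n _ => F.incl_restr (n := n) x ▸ h n

theorem InclusionTorVanishing.hasLift [(gradedMax 𝒜).IsMaximal]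
    (h : InclusionTorVanishing 𝒜 A B) (π : GradingProjection 𝒢)
    (hm : ∀ z, ∀ a ∈ gradedMax 𝒜, π.proj z a ∈ gradedMax 𝒜)
    (hF : IsResolution 𝒢 F A) (hG : IsResolution 𝒢 G B) : HasLift 𝒢 F G (gradedMax 𝒜) := by
  obtain ⟨hAB, hvan⟩ := h
  obtain ⟨φ, hφ⟩ := hF.hasLift π hG hAB
  refine hφ.hasLift_of_cycles_to_boundaries π hm hF hG fun x hx => mem_boundariesMod.mp ?_
  refine F.mem_of_forall_incl_restr_mem x (S := (boundariesMod _ G).comap φ) fun n => ?_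
  exact (hφ.torMap_eq_zero_iff 𝒜 hF hG n).mp (hvan n) _ (hF.incl_restr_mem_cyclesMod hx n)

end TorVanishing

section Betti

variable {k R : Type u} [Field k] [CommRing R] [Algebra k R] (𝒜 : ℕ → Submodule k R)

variable (k) in
/-- The dimension over `k` of an `R`-module. -/
def rankOver (N : Type u) [AddCommGroup N] [Module R N] : Cardinal.{u} :=
  Module.rank k ((ModuleCat.restrictScalars (algebraMap k R)).obj (ModuleCat.of R N))

variable {N N' : Type u} [AddCommGroup N] [Module R N] [AddCommGroup N'] [Module R N']

theorem rankOver_congr (e : N ≃ₗ[R] N') : rankOver (R := R) k N = rankOver (R := R) k N' :=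
  ((ModuleCat.restrictScalars (algebraMap k R)).mapIso e.toModuleIso).toLinearEquiv.rank_eq

theorem rankOver_prod :
    rankOver (R := R) k (N × N') = rankOver (R := R) k N + rankOver (R := R) k N' := by
  rw [rankOver, rankOver, rankOver, ← rank_prod']
  refine LinearEquiv.rank_eq (R := k) (M := (ModuleCat.restrictScalars (algebraMap k R)).obj
    (ModuleCat.of R (N × N'))) (M₁ := (ModuleCat.restrictScalars (algebraMap k R)).obj
    (ModuleCat.of R N) × (ModuleCat.restrictScalars (algebraMap k R)).obj (ModuleCat.of R N'))
    { toFun := fun x => x, invFun := fun x => x, left_inv := fun _ => rfl,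
      right_inv := fun _ => rfl, map_add' := fun _ _ => rfl, map_smul' := fun _ _ => rfl }

theorem rankOver_eq_zero [Subsingleton N] : rankOver (R := R) k N = 0 :=
  haveI : Subsingleton ((ModuleCat.restrictScalars (algebraMap k R)).obj (ModuleCat.of R N)) :=
    ‹Subsingleton N›
  rank_subsingleton' k ((ModuleCat.restrictScalars (algebraMap k R)).obj (ModuleCat.of R N))

theorem IsResolution.betti_eq {𝒢 : ℤ → AddSubgroup R} {F : BasedComplex R} {A : Ideal R}
    (hF : IsResolution 𝒢 F A) (n : ℕ) :
    betti 𝒜 n A = rankOver (R := R) k (HomologyMod (gradedMax 𝒜) F {n}) :=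
  (((ModuleCat.restrictScalars (algebraMap k R)).mapIso
    (hF.torIso 𝒜 n)).toLinearEquiv.rank_eq).trans
      (rankOver_congr (hF.tensoredHomologyEquiv (gradedMax 𝒜) n)).symm

end Betti

section Blocks

variable (R : Type u) [CommRing R] (X Y Z : Type u)

/-- Splitting vectors indexed by a threefold disjoint union into blocks. -/
def blocks : (X ⊕ (Y ⊕ Z) →₀ R) ≃ₗ[R] (X →₀ R) × (Y →₀ R) × (Z →₀ R) :=
  Finsupp.sumFinsuppLEquivProdFinsupp R ≪≫ₗ
    (LinearEquiv.refl R (X →₀ R)).prodCongr (Finsupp.sumFinsuppLEquivProdFinsupp R)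

variable {R X Y Z} (v : (X →₀ R) × (Y →₀ R) × (Z →₀ R))

@[simp]
theorem blocks_symm_inl (i : X) : (blocks R X Y Z).symm v (Sum.inl i) = v.1 i := by
  conv_rhs => rw [← (blocks R X Y Z).apply_symm_apply v]
  rfl

@[simp]
theorem blocks_symm_inr_inl (i : Y) :
    (blocks R X Y Z).symm v (Sum.inr (Sum.inl i)) = v.2.1 i := by
  conv_rhs => rw [← (blocks R X Y Z).apply_symm_apply v]
  rfl

@[simp]
theorem blocks_symm_inr_inr (i : Z) :
    (blocks R X Y Z).symm v (Sum.inr (Sum.inr i)) = v.2.2 i := by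
  conv_rhs => rw [← (blocks R X Y Z).apply_symm_apply v]
  rfl

@[simp]
theorem blocks_single_inl (j : X) (a : R) :
    blocks R X Y Z (Finsupp.single (Sum.inl j) a) = (Finsupp.single j a, 0, 0) := by
  classical
  rw [← LinearEquiv.eq_symm_apply]
  ext (i | i | i) <;> simp [Finsupp.single_apply]

@[simp]
theorem blocks_single_inr_inl (j : Y) (a : R) :
    blocks R X Y Z (Finsupp.single (Sum.inr (Sum.inl j)) a) = (0, Finsupp.single j a, 0) := by
  classical
  rw [← LinearEquiv.eq_symm_apply]
  ext (i | i | i) <;> simp [Finsupp.single_apply]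

@[simp]
theorem blocks_single_inr_inr (j : Z) (a : R) :
    blocks R X Y Z (Finsupp.single (Sum.inr (Sum.inr j)) a) = (0, 0, Finsupp.single j a) := by
  classical
  rw [← LinearEquiv.eq_symm_apply]
  ext (i | i | i) <;> simp [Finsupp.single_apply]

theorem blocks_symm_mem_iff {m : Ideal R} :
    (∀ i, (blocks R X Y Z).symm v i ∈ m) ↔
      (∀ i, v.1 i ∈ m) ∧ (∀ i, v.2.1 i ∈ m) ∧ ∀ i, v.2.2 i ∈ m := by
  simp only [Sum.forall, blocks_symm_inl, blocks_symm_inr_inl, blocks_symm_inr_inr]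

end Blocks

section Cone

variable {R : Type u} [CommRing R] {𝒢 : ℤ → AddSubgroup R} {a b c : Ideal R}
variable {A B K A' B' K' G : BasedComplex R} (φ : K.Map A) (ψ : K.Map B)
variable (φ' : K'.Map A') (ψ' : K'.Map B')

/-- The mapping cone of `(φ, -ψ) : K → A ⊕ B`. -/
abbrev cone : BasedComplex R where
  X := A.X ⊕ (B.X ⊕ K.X)
  hdeg := Sum.elim A.hdeg (Sum.elim B.hdeg fun j => K.hdeg j + 1)
  deg := Sum.elim A.deg (Sum.elim B.deg K.deg)
  d := (blocks R A.X B.X K.X).symm.toLinearMap ∘ₗ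
    ((A.d ∘ₗ LinearMap.fst R _ _ + φ ∘ₗ LinearMap.snd R _ _ ∘ₗ LinearMap.snd R _ _).prod
      (LinearMap.prod (B.d.coprod (-ψ)) (-K.d ∘ₗ LinearMap.snd R _ _) ∘ₗ
        LinearMap.snd R _ _)) ∘ₗ (blocks R A.X B.X K.X).toLinearMap
  aug := (A.aug.coprod (B.aug.coprod 0)) ∘ₗ (blocks R A.X B.X K.X).toLinearMap

variable (v : (A.X →₀ R) × (B.X →₀ R) × (K.X →₀ R))

theorem cone_d :
    (cone φ ψ).d ((blocks R A.X B.X K.X).symm v) = (blocks R A.X B.X K.X).symm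
      (A.d v.1 + φ v.2.2, B.d v.2.1 - ψ v.2.2, -K.d v.2.2) := by
  simp [sub_eq_add_neg]

theorem cone_aug :
    (cone φ ψ).aug ((blocks R A.X B.X K.X).symm v) = A.aug v.1 + B.aug v.2.1 := by
  simp

variable {φ ψ φ' ψ'}

theorem cone_d_homogeneous (hA : IsHomogeneous 𝒢 A A 1 ⊤ A.d) (hB : IsHomogeneous 𝒢 B B 1 ⊤ B.d)
    (hK : IsHomogeneous 𝒢 K K 1 ⊤ K.d) (hφ : IsHomogeneous 𝒢 K A 0 c φ)
    (hψ : IsHomogeneous 𝒢 K B 0 c ψ) :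
    IsHomogeneous 𝒢 (cone φ ψ) (cone φ ψ) 1 ⊤ (cone φ ψ).d where
  hdeg_eq := by
    rintro (j | j | j) (i | i | i) h
    case inl.inl => exact hA.hdeg_eq j i (by simpa using h)
    case inr.inl.inr.inl => exact hB.hdeg_eq j i (by simpa using h)
    case inr.inr.inl => exact congrArg (· + 1) (hφ.hdeg_eq j i (by simpa using h))
    case inr.inr.inr.inl => exact congrArg (· + 1) (hψ.hdeg_eq j i (by simpa using h))
    case inr.inr.inr.inr => exact congrArg (· + 1) (hK.hdeg_eq j i (by simpa using h))
    all_goals simp at h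
  entry_mem_degree := by
    rintro (j | j | j) (i | i | i) <;>
      simp [hA.entry_mem_degree, hB.entry_mem_degree, hK.entry_mem_degree, hφ.entry_mem_degree,
        hψ.entry_mem_degree]
  entry_mem_ideal _ _ := trivial

theorem cone_d_d (hA : IsResolution 𝒢 A a) (hB : IsResolution 𝒢 B b)
    (hK : IsResolution 𝒢 K (a ⊓ b)) (hφ : IsLift 𝒢 K A c φ) (hψ : IsLift 𝒢 K B c ψ)
    (x : (cone φ ψ).X →₀ R) : (cone φ ψ).d ((cone φ ψ).d x) = 0 := by
  obtain ⟨v, rfl⟩ := (blocks R A.X B.X K.X).symm.surjective x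
  rw [cone_d, cone_d, LinearEquiv.map_eq_zero_iff]
  simp [hA.d_d, hB.d_d, hK.d_d, hφ.comm_d, hψ.comm_d]

theorem cone_aug_d (hA : IsResolution 𝒢 A a) (hB : IsResolution 𝒢 B b)
    (hφ : IsLift 𝒢 K A c φ) (hψ : IsLift 𝒢 K B c ψ) (x : (cone φ ψ).X →₀ R) :
    (cone φ ψ).aug ((cone φ ψ).d x) = 0 := by
  obtain ⟨v, rfl⟩ := (blocks R A.X B.X K.X).symm.surjective x
  rw [cone_d, cone_aug]
  simp [hA.aug_d, hB.aug_d, hφ.comm_aug, hψ.comm_aug]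

theorem range_cone_aug (hA : IsResolution 𝒢 A a) (hB : IsResolution 𝒢 B b) :
    LinearMap.range (cone φ ψ).aug = a + b := by
  rw [LinearMap.range_comp, LinearEquiv.range, Submodule.map_top, LinearMap.range_coprod,
    LinearMap.range_coprod, LinearMap.range_zero, sup_bot_eq, hA.range_aug, hB.range_aug]
  rfl

theorem cone_exact (hA : IsResolution 𝒢 A a) (hB : IsResolution 𝒢 B b)
    (hK : IsResolution 𝒢 K (a ⊓ b)) (hφ : IsLift 𝒢 K A c φ) (hψ : IsLift 𝒢 K B c ψ)
    {x : (cone φ ψ).X →₀ R} (hd : (cone φ ψ).d x = 0) (haug : (cone φ ψ).aug x = 0) :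
    ∃ y, (cone φ ψ).d y = x := by
  obtain ⟨⟨p, q, r⟩, rfl⟩ := (blocks R A.X B.X K.X).symm.surjective x
  rw [cone_d, LinearEquiv.map_eq_zero_iff] at hd
  rw [cone_aug] at haug
  obtain ⟨hp, hq, hr⟩ : A.d p + φ r = 0 ∧ B.d q - ψ r = 0 ∧ -K.d r = 0 := by
    simpa [Prod.ext_iff] using hd
  obtain ⟨r₀, rfl⟩ : ∃ r₀, K.d r₀ = r := by
    refine hK.exact r (neg_eq_zero.mp hr) ?_
    rw [← hφ.comm_aug, eq_neg_of_add_eq_zero_right hp, map_neg, hA.aug_d, neg_zero]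
  have hpq : A.aug p = -B.aug q := eq_neg_of_add_eq_zero_left haug
  obtain ⟨s, hs, hs'⟩ : ∃ s, K.d s = 0 ∧ K.aug s = A.aug p + K.aug r₀ :=
    hK.exists_cycle (add_mem ⟨hA.aug_mem p, hpq ▸ b.neg_mem (hB.aug_mem q)⟩ (hK.aug_mem r₀))
  obtain ⟨p', hp'⟩ := hA.exact (p + φ r₀ - φ s)
    (by rw [map_sub, map_add, hφ.comm_d, hφ.comm_d, hs, map_zero, sub_zero, hp])
    (by rw [map_sub, map_add, hφ.comm_aug, hφ.comm_aug, hs', sub_self])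
  obtain ⟨q', hq'⟩ := hB.exact (q - ψ r₀ + ψ s)
    (by rw [map_add, map_sub, hψ.comm_d, hψ.comm_d, hs, map_zero, add_zero, hq])
    (by rw [map_add, map_sub, hψ.comm_aug, hψ.comm_aug, hs', hpq]; ring)
  refine ⟨(blocks R A.X B.X K.X).symm (p', q', s - r₀), ?_⟩
  rw [cone_d]
  refine congrArg _ (Prod.ext ?_ (Prod.ext ?_ ?_))
  · simp only [hp', map_sub]; abel
  · simp only [hq', map_sub]; abel
  · simp only [map_sub, hs, zero_sub, neg_neg]

theorem cone_isResolution (hA : IsResolution 𝒢 A a) (hB : IsResolution 𝒢 B b)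
    (hK : IsResolution 𝒢 K (a ⊓ b)) (hφ : IsLift 𝒢 K A c φ) (hψ : IsLift 𝒢 K B c ψ) :
    IsResolution 𝒢 (cone φ ψ) (a + b) where
  d_homogeneous := cone_d_homogeneous hA.d_homogeneous hB.d_homogeneous hK.d_homogeneous
    hφ.toIsHomogeneous hψ.toIsHomogeneous
  aug_single_eq_zero := by
    rintro (j | j | j) h
    · simpa using hA.aug_single_eq_zero j h
    · simpa using hB.aug_single_eq_zero j h
    · simp
  aug_single_mem := by
    rintro (j | j | j) <;> simp [hA.aug_single_mem, hB.aug_single_mem]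
  d_d := cone_d_d hA hB hK hφ hψ
  aug_d := cone_aug_d hA hB hφ hψ
  exact _ := cone_exact hA hB hK hφ hψ
  range_aug := range_cone_aug hA hB

variable (φ ψ φ' ψ')

/-- The inclusion of the second summand in a cone. -/
def coneInr : B.Map (cone φ ψ) :=
  (blocks R A.X B.X K.X).symm.toLinearMap ∘ₗ LinearMap.inr R _ _ ∘ₗ LinearMap.inl R _ _

/-- The block diagonal map of cones. -/
def coneMap (α : A.Map A') (β : B.Map B') (γ : K.Map K') : (cone φ ψ).Map (cone φ' ψ') :=
  (blocks R A'.X B'.X K'.X).symm.toLinearMap ∘ₗ (α.prodMap (β.prodMap γ)) ∘ₗ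
    (blocks R A.X B.X K.X).toLinearMap

/-- The map out of a cone given by maps out of the two summands of its target. -/
def coneDesc (α : A.Map G) (β : B.Map G) : (cone φ ψ).Map G :=
  (α.coprod (β.coprod 0)) ∘ₗ (blocks R A.X B.X K.X).toLinearMap

variable {α : A.Map A'} {β : B.Map B'} {γ : K.Map K'} {α' : A.Map G} {β' : B.Map G}

theorem coneInr_apply (x : B.X →₀ R) :
    coneInr φ ψ x = (blocks R A.X B.X K.X).symm (0, x, 0) :=
  rfl

theorem coneMap_apply :
    coneMap φ ψ φ' ψ' α β γ ((blocks R A.X B.X K.X).symm v) =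
      (blocks R A'.X B'.X K'.X).symm (α v.1, β v.2.1, γ v.2.2) := by
  simp [coneMap]

theorem coneDesc_apply :
    coneDesc φ ψ α' β' ((blocks R A.X B.X K.X).symm v) = α' v.1 + β' v.2.1 := by
  simp [coneDesc]

theorem coneDesc_coneInr (x : B.X →₀ R) : coneDesc φ ψ α' β' (coneInr φ ψ x) = β' x := by
  rw [coneInr_apply, coneDesc_apply, map_zero, zero_add]

theorem coneMap_coneInr (x : B.X →₀ R) :
    coneMap φ ψ φ' ψ' α β γ (coneInr φ ψ x) = coneInr φ' ψ' (β x) := by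
  rw [coneInr_apply, coneMap_apply, map_zero, map_zero, coneInr_apply]

theorem coneInr_isLift [SetLike.GradedOne 𝒢] : IsLift 𝒢 B (cone φ ψ) ⊤ (coneInr φ ψ) where
  hdeg_eq := by
    rintro j (i | i | i) h
    case inr.inl => exact IsHomogeneous.id.hdeg_eq (𝒢 := 𝒢) j i (by simpa [coneInr_apply] using h)
    all_goals simp [coneInr_apply] at h
  entry_mem_degree := by
    rintro j (i | i | i)
    case inr.inl => simpa [coneInr_apply] using IsHomogeneous.id.entry_mem_degree j i
    all_goals simp [coneInr_apply]
  entry_mem_ideal _ _ := trivial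
  comm_d x := by rw [coneInr_apply, coneInr_apply, cone_d]; simp
  comm_aug x := by rw [coneInr_apply, cone_aug]; simp

variable {φ ψ φ' ψ'}

theorem coneMap_isLift (hα : IsLift 𝒢 A A' c α) (hβ : IsLift 𝒢 B B' c β) (hγ : IsLift 𝒢 K K' c γ)
    (hφ : ∀ x, α (φ x) = φ' (γ x)) (hψ : ∀ x, β (ψ x) = ψ' (γ x)) :
    IsLift 𝒢 (cone φ ψ) (cone φ' ψ') c (coneMap φ ψ φ' ψ' α β γ) where
  hdeg_eq := by
    rintro (j | j | j) (i | i | i) h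
    case inl.inl => exact hα.hdeg_eq j i (by simpa [coneMap] using h)
    case inr.inl.inr.inl => exact hβ.hdeg_eq j i (by simpa [coneMap] using h)
    case inr.inr.inr.inr => exact congrArg (· + 1) (hγ.hdeg_eq j i (by simpa [coneMap] using h))
    all_goals simp [coneMap] at h
  entry_mem_degree := by
    rintro (j | j | j) (i | i | i) <;>
      simp [coneMap, hα.entry_mem_degree, hβ.entry_mem_degree, hγ.entry_mem_degree]
  entry_mem_ideal := by
    rintro (j | j | j) (i | i | i) <;>
      simp [coneMap, hα.entry_mem_ideal, hβ.entry_mem_ideal, hγ.entry_mem_ideal]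
  comm_d x := by
    obtain ⟨v, rfl⟩ := (blocks R A.X B.X K.X).symm.surjective x
    rw [coneMap_apply, cone_d, cone_d, coneMap_apply]
    simp [hα.comm_d, hβ.comm_d, hγ.comm_d, hφ, hψ]
  comm_aug x := by
    obtain ⟨v, rfl⟩ := (blocks R A.X B.X K.X).symm.surjective x
    rw [coneMap_apply, cone_aug, cone_aug, hα.comm_aug, hβ.comm_aug]

theorem coneDesc_isLift (hα : IsLift 𝒢 A G c α') (hβ : IsLift 𝒢 B G c β')
    (h : ∀ x, α' (φ x) = β' (ψ x)) : IsLift 𝒢 (cone φ ψ) G c (coneDesc φ ψ α' β') where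
  hdeg_eq := by
    rintro (j | j | j) i h
    · exact hα.hdeg_eq j i (by simpa [coneDesc] using h)
    · exact hβ.hdeg_eq j i (by simpa [coneDesc] using h)
    · simp [coneDesc] at h
  entry_mem_degree := by
    rintro (j | j | j) i <;> simp [coneDesc, hα.entry_mem_degree, hβ.entry_mem_degree]
  entry_mem_ideal := by
    rintro (j | j | j) i <;> simp [coneDesc, hα.entry_mem_ideal, hβ.entry_mem_ideal]
  comm_d x := by
    obtain ⟨v, rfl⟩ := (blocks R A.X B.X K.X).symm.surjective x
    rw [coneDesc_apply, cone_d, coneDesc_apply]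
    simp [hα.comm_d, hβ.comm_d, h]
  comm_aug x := by
    obtain ⟨v, rfl⟩ := (blocks R A.X B.X K.X).symm.surjective x
    rw [coneDesc_apply, cone_aug, map_add, hα.comm_aug, hβ.comm_aug]

end Cone

section SubquotientProd

variable {R M N N' : Type*} [CommRing R] [AddCommGroup M] [Module R M] [AddCommGroup N]
  [Module R N] [AddCommGroup N'] [Module R N']

/-- The projection onto a subquotient. -/
def Subquotient.mk (C D : Submodule R M) : C →ₗ[R] Subquotient C D :=
  (D.submoduleOf C).mkQ

theorem Subquotient.mk_surjective (C D : Submodule R M) : Function.Surjective (mk C D) :=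
  (D.submoduleOf C).mkQ_surjective

theorem Subquotient.mk_eq_zero_iff {C D : Submodule R M} (x : C) : mk C D x = 0 ↔ x.1 ∈ D :=
  Submodule.Quotient.mk_eq_zero (D.submoduleOf C)

/-- A decomposition of a module that is compatible with two submodules decomposes their
subquotient. -/
def subquotientProdEquiv (e : M ≃ₗ[R] N × N') {C D : Submodule R M} {C₁ D₁ : Submodule R N}
    {C₂ D₂ : Submodule R N'} (hC : C = (C₁.prod C₂).comap e.toLinearMap)
    (hD : D = (D₁.prod D₂).comap e.toLinearMap) :
    Subquotient C D ≃ₗ[R] Subquotient C₁ D₁ × Subquotient C₂ D₂ :=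
  subquotientEquiv
    ((Subquotient.mk C₁ D₁ ∘ₗ (LinearMap.fst R N N' ∘ₗ e.toLinearMap).restrict
        fun x hx => (hC.le hx).1).prod
      (Subquotient.mk C₂ D₂ ∘ₗ (LinearMap.snd R N N' ∘ₗ e.toLinearMap).restrict
        fun x hx => (hC.le hx).2))
    (by
      rintro ⟨y₁, y₂⟩
      obtain ⟨x₁, rfl⟩ := Subquotient.mk_surjective C₁ D₁ y₁
      obtain ⟨x₂, rfl⟩ := Subquotient.mk_surjective C₂ D₂ y₂
      have hx : e.symm (x₁.1, x₂.1) ∈ C := by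
        rw [hC, Submodule.mem_comap, LinearEquiv.coe_coe, e.apply_symm_apply]
        exact ⟨x₁.2, x₂.2⟩
      refine ⟨⟨_, hx⟩, Prod.ext (congrArg (Subquotient.mk C₁ D₁) (Subtype.ext ?_))
        (congrArg (Subquotient.mk C₂ D₂) (Subtype.ext ?_))⟩
      · exact congrArg Prod.fst (e.apply_symm_apply _)
      · exact congrArg Prod.snd (e.apply_symm_apply _))
    fun x => by
      rw [hD]
      exact Prod.ext_iff.trans
        (and_congr (Subquotient.mk_eq_zero_iff _) (Subquotient.mk_eq_zero_iff _))

end SubquotientProd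

section BettiSplitting

variable {R : Type u} [CommRing R] {𝒢 : ℤ → AddSubgroup R} {m : Ideal R}
variable {A B K : BasedComplex R} {φ : K.Map A} {ψ : K.Map B}

theorem blocks_symm_mem_chains_cone_iff {s : Set ℕ} (v : (A.X →₀ R) × (B.X →₀ R) × (K.X →₀ R)) :
    (blocks R A.X B.X K.X).symm v ∈ (cone φ ψ).chains s ↔
      v.1 ∈ A.chains s ∧ v.2.1 ∈ B.chains s ∧ v.2.2 ∈ K.chains (Nat.succ ⁻¹' s) := by
  simp only [BasedComplex.chains, Finsupp.mem_supported', Sum.forall, blocks_symm_inl,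
    blocks_symm_inr_inl, blocks_symm_inr_inr, Set.mem_preimage, Sum.elim_inl, Sum.elim_inr,
    Nat.succ_eq_add_one]

theorem mem_cyclesMod_cone_iff (hφ : ∀ x i, φ x i ∈ m) (hψ : ∀ x i, ψ x i ∈ m) {s : Set ℕ}
    (v : (A.X →₀ R) × (B.X →₀ R) × (K.X →₀ R)) :
    (blocks R A.X B.X K.X).symm v ∈ cyclesMod m (cone φ ψ) s ↔
      v.1 ∈ cyclesMod m A s ∧ v.2.1 ∈ cyclesMod m B s ∧
        v.2.2 ∈ cyclesMod m K (Nat.succ ⁻¹' s) := by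
  rw [mem_cyclesMod, blocks_symm_mem_chains_cone_iff, cone_d, blocks_symm_mem_iff]
  simp only [mem_cyclesMod, Finsupp.add_apply, Finsupp.sub_apply, Finsupp.neg_apply, neg_mem_iff,
    m.add_mem_iff_left (hφ _ _), m.sub_mem_iff_left (hψ _ _)]
  tauto

theorem mem_boundariesMod_cone_iff (hφ : ∀ x i, φ x i ∈ m) (hψ : ∀ x i, ψ x i ∈ m)
    (v : (A.X →₀ R) × (B.X →₀ R) × (K.X →₀ R)) :
    (blocks R A.X B.X K.X).symm v ∈ boundariesMod m (cone φ ψ) ↔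
      v.1 ∈ boundariesMod m A ∧ v.2.1 ∈ boundariesMod m B ∧ v.2.2 ∈ boundariesMod m K := by
  have hd (p q r) : (∀ i, ((blocks R A.X B.X K.X).symm v -
        (cone φ ψ).d ((blocks R A.X B.X K.X).symm (p, q, r))) i ∈ m) ↔
      (∀ i, (v.1 - A.d p) i ∈ m) ∧ (∀ i, (v.2.1 - B.d q) i ∈ m) ∧
        ∀ i, (v.2.2 - K.d (-r)) i ∈ m := by
    rw [cone_d, ← map_sub, blocks_symm_mem_iff]
    simp only [Prod.fst_sub, Prod.snd_sub, Finsupp.sub_apply, Finsupp.add_apply, map_neg,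
      ← sub_sub, sub_sub_eq_add_sub, add_sub_right_comm,
      m.sub_mem_iff_left (hφ _ _), m.add_mem_iff_left (hψ _ _)]
  have hneg := (neg_surjective (G := K.X →₀ R)).exists (p := fun r => ∀ i, (v.2.2 - K.d r) i ∈ m)
  rw [mem_boundariesMod, (blocks R A.X B.X K.X).symm.surjective.exists]
  simp only [mem_boundariesMod, Prod.exists, hd, hneg, exists_and_left, exists_and_right]

/-- A cone of maps that vanish modulo `m` has the homology modulo `m` of its three summands. -/
def homologyModConeEquiv (hφ : ∀ x i, φ x i ∈ m) (hψ : ∀ x i, ψ x i ∈ m) (s : Set ℕ) :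
    HomologyMod m (cone φ ψ) s ≃ₗ[R]
      HomologyMod m A s × HomologyMod m B s × HomologyMod m K (Nat.succ ⁻¹' s) :=
  subquotientProdEquiv (blocks R A.X B.X K.X)
    (Submodule.ext fun x => by
      simpa using mem_cyclesMod_cone_iff hφ hψ (blocks R A.X B.X K.X x))
    (Submodule.ext fun x => by
      simpa using mem_boundariesMod_cone_iff hφ hψ (blocks R A.X B.X K.X x)) ≪≫ₗ
  (LinearEquiv.refl R _).prodCongr
    (subquotientProdEquiv (LinearEquiv.refl R _) rfl rfl)

instance subsingleton_homologyMod_empty (F : BasedComplex R) :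
    Subsingleton (HomologyMod m F ∅) := by
  have h : cyclesMod m F ∅ = ⊥ := by
    rw [cyclesMod, BasedComplex.chains, Set.preimage_empty, Finsupp.supported_empty, bot_inf_eq]
  have : Subsingleton (cyclesMod m F ∅) := h ▸ inferInstance
  exact (Subquotient.mk_surjective _ _).subsingleton

variable {k : Type u} [Field k] [Algebra k R] (𝒜 : ℕ → Submodule k R) {a b : Ideal R}

theorem isBettiSplitting_of_hasLift (hA : IsResolution 𝒢 A a) (hB : IsResolution 𝒢 B b)
    (hK : IsResolution 𝒢 K (a ⊓ b)) (hKA : HasLift 𝒢 K A (gradedMax 𝒜))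
    (hKB : HasLift 𝒢 K B (gradedMax 𝒜)) : IsBettiSplitting 𝒜 (a + b) a b := by
  obtain ⟨φ, hφ⟩ := hKA
  obtain ⟨ψ, hψ⟩ := hKB
  refine ⟨rfl, fun n => ?_⟩
  have e := homologyModConeEquiv hφ.apply_mem hψ.apply_mem {n}
  rw [(cone_isResolution hA hB hK hφ hψ).betti_eq, hA.betti_eq, hB.betti_eq, hK.betti_eq,
    rankOver_congr e, rankOver_prod, rankOver_prod, ← add_assoc]
  cases n with
  | zero =>
    have hpre : Nat.succ ⁻¹' {0} = (∅ : Set ℕ) := by ext; simp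
    rw [hpre, if_pos rfl, rankOver_eq_zero (N := HomologyMod (gradedMax 𝒜) K ∅)]
  | succ n =>
    have hpre : Nat.succ ⁻¹' {n + 1} = ({n} : Set ℕ) := by ext; simp
    rw [hpre, if_neg n.succ_ne_zero, Nat.add_sub_cancel]

end BettiSplitting

section Sign

variable {R : Type u} [CommRing R] {𝒢 : ℤ → AddSubgroup R}
variable {F G : BasedComplex R} {n : ℕ} {c : Ideal R}

/-- The automorphism of a based complex that is `(-1) ^ n` in homological degree `n`. -/
def BasedComplex.sign (F : BasedComplex R) : F.Map F :=
  Finsupp.linearCombination R fun j => Finsupp.single j ((-1) ^ F.hdeg j)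

theorem BasedComplex.sign_single (F : BasedComplex R) (j : F.X) :
    F.sign (Finsupp.single j 1) = (-1 : R) ^ F.hdeg j • Finsupp.single j 1 := by
  rw [sign, Finsupp.linearCombination_single, one_smul, Finsupp.smul_single, smul_eq_mul, mul_one]

theorem BasedComplex.sign_apply (F : BasedComplex R) (x : F.X →₀ R) (i : F.X) :
    F.sign x i = (-1) ^ F.hdeg i * x i := by
  classical
  rw [map_apply_eq_sum]
  simp +contextual [F.sign_single, Finsupp.single_apply, mul_comm]

theorem BasedComplex.sign_sign (F : BasedComplex R) (x : F.X →₀ R) : F.sign (F.sign x) = x := by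
  ext i
  rw [F.sign_apply, F.sign_apply, ← mul_assoc, ← mul_pow, neg_one_mul, neg_neg, one_pow, one_mul]

theorem BasedComplex.sign_isHomogeneous [SetLike.GradedOne 𝒢] (F : BasedComplex R) :
    IsHomogeneous 𝒢 F F 0 ⊤ F.sign := by
  have hid : IsHomogeneous 𝒢 F F 0 ⊤ LinearMap.id := .id
  refine ⟨fun j i h => hid.hdeg_eq j i fun h0 => h ?_, fun j i => ?_, fun _ _ => trivial⟩
  · rw [F.sign_apply]
    exact mul_eq_zero_of_right _ h0
  · rw [F.sign_apply]
    obtain h | h := neg_one_pow_eq_or R (F.hdeg i) <;> rw [h]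
    · rw [one_mul]
      exact hid.entry_mem_degree j i
    · rw [neg_one_mul]
      exact neg_mem (hid.entry_mem_degree j i)

theorem IsHomogeneous.map_sign {φ : F.Map G} (hφ : IsHomogeneous 𝒢 F G n c φ) (x : F.X →₀ R) :
    φ (F.sign x) = (-1 : R) ^ n • G.sign (φ x) := by
  suffices h : φ ∘ₗ F.sign = (-1 : R) ^ n • (G.sign ∘ₗ φ) from LinearMap.congr_fun h x
  refine linearMap_ext_single fun j => Finsupp.ext fun i => ?_
  rw [LinearMap.comp_apply, F.sign_single, map_smul, LinearMap.smul_apply, LinearMap.comp_apply,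
    Finsupp.smul_apply, Finsupp.smul_apply, G.sign_apply, smul_eq_mul, smul_eq_mul]
  by_cases h : φ (Finsupp.single j 1) i = 0
  · rw [h, mul_zero, mul_zero, mul_zero]
  · rw [hφ.hdeg_eq j i h, pow_add]
    ring

end Sign

section Contraction

variable {k R : Type u} [Field k] [CommRing R] [Algebra k R] {𝒢 : ℤ → AddSubgroup R}
variable {F : BasedComplex R} {A : Ideal R}

theorem IsResolution.d_sign (hF : IsResolution 𝒢 F A) (x : F.X →₀ R) :
    F.d (F.sign x) = -F.sign (F.d x) := by
  rw [hF.d_homogeneous.map_sign, pow_one, neg_smul, one_smul]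

variable (k) in
theorem IsResolution.exists_contraction (hF : IsResolution 𝒢 F A) :
    ∃ (i : R →ₗ[k] (F.X →₀ R)) (h : (F.X →₀ R) →ₗ[k] (F.X →₀ R)),
      (∀ r, F.d (i r) = 0) ∧ ∀ x, F.d (h x) + h (F.d x) = x - i (F.aug x) := by
  obtain ⟨i₀, hi₀⟩ := exists_comp_comp_eq_self (F.aug.restrictScalars k)
  let i : R →ₗ[k] (F.X →₀ R) := (F.incl 0 ∘ₗ F.restr 0).restrictScalars k ∘ₗ i₀
  have hi r : i r = (i₀ r).filter (F.hdeg · = 0) := F.incl_restr (i₀ r)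
  have hdi r : F.d (i r) = 0 := by rw [hi, hF.d_filter_hdeg_zero]
  have haugi x : F.aug (i (F.aug x)) = F.aug x := by
    rw [hi, hF.aug_filter_hdeg_zero]
    exact hi₀ x
  let p : (F.X →₀ R) →ₗ[k] (F.X →₀ R) := LinearMap.id - i ∘ₗ F.aug.restrictScalars k
  have hp x : p x = x - i (F.aug x) := rfl
  obtain ⟨h, hh⟩ := exists_nullhomotopy (d := F.d.restrictScalars k) (d' := F.d.restrictScalars k)
    (f := p) hF.d_d
    (fun x => by
      simp only [hp, LinearMap.restrictScalars_apply, map_sub, hdi, hF.aug_d, map_zero])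
    (fun x hx => hF.exact (p x) (by rw [hp, map_sub, hdi, sub_zero]; exact hx)
      (by rw [hp, map_sub, haugi, sub_self]))
  exact ⟨i, h, hdi, hh⟩

end Contraction

section TensorProductMaps

variable {k R S : Type u} [Field k] [CommRing R] [Algebra k R] [CommRing S] [Algebra k S]
variable {X Y X' Y' : Type u}

variable (k) in
/-- The external product of coordinate vectors over `R` and `S`. -/
def tp : (X →₀ R) →ₗ[k] (Y →₀ S) →ₗ[k] (X × Y →₀ R ⊗[k] S) :=
  (TensorProduct.mk k (X →₀ R) (Y →₀ S)).compr₂ (finsuppTensorFinsupp k k R S X Y).toLinearMap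

theorem tp_apply (a : X →₀ R) (b : Y →₀ S) (p : X × Y) : tp k a b p = a p.1 ⊗ₜ b p.2 :=
  finsuppTensorFinsupp_apply k k R S X Y a b p.1 p.2

theorem tp_single (x : X) (y : Y) (r : R) (s : S) :
    tp k (Finsupp.single x r) (Finsupp.single y s) = Finsupp.single (x, y) (r ⊗ₜ[k] s) :=
  finsuppTensorFinsupp_single k k R S X Y x r y s

theorem smul_tp (r : R) (s : S) (a : X →₀ R) (b : Y →₀ S) :
    (r ⊗ₜ[k] s) • tp k a b = tp k (r • a) (s • b) := by
  ext p
  simp [tp_apply]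

theorem eq_of_eqOn_tp {N Φ : Type*} [AddCommGroup N] [FunLike Φ (X × Y →₀ R ⊗[k] S) N]
    [AddMonoidHomClass Φ (X × Y →₀ R ⊗[k] S) N] (f g : Φ)
    (h : ∀ a b, f (tp k a b) = g (tp k a b)) (z : X × Y →₀ R ⊗[k] S) : f z = g z := by
  obtain ⟨w, rfl⟩ := (finsuppTensorFinsupp k k R S X Y).surjective z
  induction w with
  | zero => rw [map_zero, map_zero, map_zero]
  | tmul a b => exact h a b
  | add a b ha hb => rw [map_add, map_add, map_add, ha, hb]

section Lift

variable {M N P : Type*} [AddCommGroup M] [Module k M] [Module R M] [AddCommGroup N] [Module k N]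
  [Module S N] [AddCommGroup P] [Module k P] [Module (R ⊗[k] S) P]

/-- The linear map over `R ⊗ S` determined by two linear maps over `R` and `S` and a pairing of
their targets. -/
def tpLift (β : M →ₗ[k] N →ₗ[k] P) (f : (X →₀ R) →ₗ[R] M) (g : (Y →₀ S) →ₗ[S] N) :
    (X × Y →₀ R ⊗[k] S) →ₗ[R ⊗[k] S] P :=
  Finsupp.linearCombination (R ⊗[k] S) fun p =>
    β (f (Finsupp.single p.1 1)) (g (Finsupp.single p.2 1))

theorem tpLift_tp {β : M →ₗ[k] N →ₗ[k] P}
    (hβ : ∀ (r : R) (s : S) m n, (r ⊗ₜ[k] s) • β m n = β (r • m) (s • n))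
    (f : (X →₀ R) →ₗ[R] M) (g : (Y →₀ S) →ₗ[S] N) (a : X →₀ R) (b : Y →₀ S) :
    tpLift β f g (tp k a b) = β (f a) (g b) := by
  induction a using Finsupp.induction_linear with
  | zero => simp only [map_zero, LinearMap.zero_apply]
  | add a a' ha ha' => simp only [map_add, LinearMap.add_apply, ha, ha']
  | single x r =>
    induction b using Finsupp.induction_linear with
    | zero => simp only [map_zero]
    | add b b' hb hb' => simp only [map_add, hb, hb']
    | single y s =>
      rw [tp_single, tpLift, Finsupp.linearCombination_single, hβ, ← map_single_eq_smul,
        ← map_single_eq_smul]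

end Lift

/-- The tensor product of two maps of free modules. -/
def box (f : (X →₀ R) →ₗ[R] (X' →₀ R)) (g : (Y →₀ S) →ₗ[S] (Y' →₀ S)) :
    (X × Y →₀ R ⊗[k] S) →ₗ[R ⊗[k] S] (X' × Y' →₀ R ⊗[k] S) :=
  tpLift (tp k) f g

/-- The tensor product of two augmentations. -/
def boxAug (f : (X →₀ R) →ₗ[R] R) (g : (Y →₀ S) →ₗ[S] S) :
    (X × Y →₀ R ⊗[k] S) →ₗ[R ⊗[k] S] R ⊗[k] S :=
  tpLift (TensorProduct.mk k R S) f g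

@[simp]
theorem box_tp (f : (X →₀ R) →ₗ[R] (X' →₀ R)) (g : (Y →₀ S) →ₗ[S] (Y' →₀ S)) (a : X →₀ R)
    (b : Y →₀ S) : box f g (tp k a b) = tp k (f a) (g b) :=
  tpLift_tp smul_tp f g a b

@[simp]
theorem boxAug_tp (f : (X →₀ R) →ₗ[R] R) (g : (Y →₀ S) →ₗ[S] S) (a : X →₀ R) (b : Y →₀ S) :
    boxAug f g (tp k a b) = f a ⊗ₜ[k] g b :=
  tpLift_tp (fun _ _ _ _ => Algebra.TensorProduct.tmul_mul_tmul _ _ _ _) f g a b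

theorem box_single_apply (f : (X →₀ R) →ₗ[R] (X' →₀ R)) (g : (Y →₀ S) →ₗ[S] (Y' →₀ S))
    (p : X × Y) (q : X' × Y') : box (k := k) f g (Finsupp.single p 1) q =
      f (Finsupp.single p.1 1) q.1 ⊗ₜ[k] g (Finsupp.single p.2 1) q.2 := by
  rw [Algebra.TensorProduct.one_def, ← tp_single, box_tp, tp_apply]

theorem boxAug_single (f : (X →₀ R) →ₗ[R] R) (g : (Y →₀ S) →ₗ[S] S) (p : X × Y) :
    boxAug (k := k) f g (Finsupp.single p 1) =
      f (Finsupp.single p.1 1) ⊗ₜ[k] g (Finsupp.single p.2 1) := by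
  rw [Algebra.TensorProduct.one_def, ← tp_single, boxAug_tp]

theorem tmul_mem_extendLeft_mul_extendRight {c : Ideal R} {c' : Ideal S} {r : R} {s : S}
    (hr : r ∈ c) (hs : s ∈ c') : r ⊗ₜ[k] s ∈ extendLeft c * extendRight c' := by
  rw [← mul_one r, ← one_mul s, ← Algebra.TensorProduct.tmul_mul_tmul]
  exact Ideal.mul_mem_mul (Ideal.mem_map_of_mem Algebra.TensorProduct.includeLeft hr)
    (Ideal.mem_map_of_mem Algebra.TensorProduct.includeRight hs)

theorem range_boxAug {f : (X →₀ R) →ₗ[R] R} {g : (Y →₀ S) →ₗ[S] S} :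
    LinearMap.range (boxAug (k := k) f g) =
      extendLeft (LinearMap.range f) * extendRight (LinearMap.range g) := by
  refine le_antisymm ?_ ?_
  · rw [boxAug, tpLift, Finsupp.range_linearCombination, Submodule.span_le]
    rintro _ ⟨p, rfl⟩
    exact tmul_mem_extendLeft_mul_extendRight ⟨_, rfl⟩ ⟨_, rfl⟩
  · rw [extendLeft, extendRight, Ideal.map, Ideal.map, Ideal.span_mul_span', Ideal.span_le]
    rintro _ ⟨_, ⟨_, ⟨a, rfl⟩, rfl⟩, _, ⟨_, ⟨b, rfl⟩, rfl⟩, rfl⟩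
    exact ⟨tp k a b, by simp⟩

end TensorProductMaps

section TensorComplex

variable {k R S : Type u} [Field k] [CommRing R] [Algebra k R] [CommRing S] [Algebra k S]
variable {𝒢 : ℤ → AddSubgroup R} {ℋ : ℤ → AddSubgroup S} {𝒯 : ℤ → AddSubgroup (R ⊗[k] S)}

/-- `𝒯` contains the tensor products of homogeneous elements for `𝒢` and `ℋ`, in the degree that is
the sum of their degrees. -/
def IsTensorGraded (𝒢 : ℤ → AddSubgroup R) (ℋ : ℤ → AddSubgroup S)
    (𝒯 : ℤ → AddSubgroup (R ⊗[k] S)) : Prop :=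
  ∀ ⦃p q : ℤ⦄ ⦃r : R⦄ ⦃s : S⦄, r ∈ 𝒢 p → s ∈ ℋ q → r ⊗ₜ[k] s ∈ 𝒯 (p + q)

variable (k) in
/-- The tensor product over `k` of two based complexes. -/
abbrev tensorComplex (F : BasedComplex R) (G : BasedComplex S) : BasedComplex (R ⊗[k] S) where
  X := F.X × G.X
  hdeg p := F.hdeg p.1 + G.hdeg p.2
  deg p := F.deg p.1 + G.deg p.2
  d := box F.d LinearMap.id + box F.sign G.d
  aug := boxAug F.aug G.aug

variable {F F' F'' : BasedComplex R} {G G' G'' : BasedComplex S} {n n' : ℕ}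
variable {A c : Ideal R} {B c' : Ideal S} {φ : F.Map F'} {ψ : G.Map G'}

theorem tensorComplex_d_tp (a : F.X →₀ R) (b : G.X →₀ S) :
    (tensorComplex k F G).d (tp k a b) = tp k (F.d a) b + tp k (F.sign a) (G.d b) := by
  simp

theorem IsHomogeneous.box (h𝒯 : IsTensorGraded 𝒢 ℋ 𝒯) (hφ : IsHomogeneous 𝒢 F F' n c φ)
    (hψ : IsHomogeneous ℋ G G' n' c' ψ) :
    IsHomogeneous 𝒯 (tensorComplex k F G) (tensorComplex k F' G') (n + n')
      (extendLeft c * extendRight c') (box φ ψ) where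
  hdeg_eq p q h := by
    rw [box_single_apply] at h
    have h₁ := hφ.hdeg_eq p.1 q.1 fun h0 => h (by rw [h0, TensorProduct.zero_tmul])
    have h₂ := hψ.hdeg_eq p.2 q.2 fun h0 => h (by rw [h0, TensorProduct.tmul_zero])
    dsimp only
    omega
  entry_mem_degree p q := by
    rw [box_single_apply, add_sub_add_comm]
    exact h𝒯 (hφ.entry_mem_degree p.1 q.1) (hψ.entry_mem_degree p.2 q.2)
  entry_mem_ideal p q := by
    rw [box_single_apply]
    exact tmul_mem_extendLeft_mul_extendRight (hφ.entry_mem_ideal p.1 q.1)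
      (hψ.entry_mem_ideal p.2 q.2)

theorem IsLift.box (h𝒯 : IsTensorGraded 𝒢 ℋ 𝒯) (hφ : IsLift 𝒢 F F' c φ)
    (hψ : IsLift ℋ G G' c' ψ) :
    IsLift 𝒯 (tensorComplex k F G) (tensorComplex k F' G') (extendLeft c * extendRight c')
      (box φ ψ) where
  toIsHomogeneous := hφ.toIsHomogeneous.box h𝒯 hψ.toIsHomogeneous
  comm_d := by
    refine eq_of_eqOn_tp ((tensorComplex k F' G').d ∘ₗ MixedSum.box φ ψ)
      (MixedSum.box φ ψ ∘ₗ (tensorComplex k F G).d) fun a b => ?_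
    rw [LinearMap.comp_apply, LinearMap.comp_apply, box_tp, tensorComplex_d_tp,
      tensorComplex_d_tp, map_add, box_tp, box_tp, hφ.comm_d, hψ.comm_d, hφ.map_sign, pow_zero,
      one_smul]
  comm_aug := by
    refine eq_of_eqOn_tp ((tensorComplex k F' G').aug ∘ₗ MixedSum.box φ ψ)
      (tensorComplex k F G).aug fun a b => ?_
    rw [LinearMap.comp_apply, box_tp, boxAug_tp, boxAug_tp, hφ.comm_aug, hψ.comm_aug]

theorem tensorComplex_d_d (hF : IsResolution 𝒢 F A) (hG : IsResolution ℋ G B)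
    (z : F.X × G.X →₀ R ⊗[k] S) : (tensorComplex k F G).d ((tensorComplex k F G).d z) = 0 := by
  refine eq_of_eqOn_tp ((tensorComplex k F G).d ∘ₗ (tensorComplex k F G).d) 0 (fun a b => ?_) z
  rw [LinearMap.comp_apply, tensorComplex_d_tp, map_add, tensorComplex_d_tp, tensorComplex_d_tp,
    hF.d_d, hG.d_d, hF.d_sign]
  simp

theorem tensorComplex_aug_d (hF : IsResolution 𝒢 F A) (hG : IsResolution ℋ G B)
    (z : F.X × G.X →₀ R ⊗[k] S) : (tensorComplex k F G).aug ((tensorComplex k F G).d z) = 0 := by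
  refine eq_of_eqOn_tp ((tensorComplex k F G).aug ∘ₗ (tensorComplex k F G).d) 0 (fun a b => ?_) z
  rw [LinearMap.comp_apply, tensorComplex_d_tp, map_add, boxAug_tp, boxAug_tp, hF.aug_d, hG.aug_d]
  simp

theorem exists_tensorComplex_contraction (hF : IsResolution 𝒢 F A) (hG : IsResolution ℋ G B) :
    ∃ (i : R ⊗[k] S →ₗ[k] (F.X × G.X →₀ R ⊗[k] S))
      (h : (F.X × G.X →₀ R ⊗[k] S) →ₗ[k] (F.X × G.X →₀ R ⊗[k] S)),
      ∀ z, (tensorComplex k F G).d (h z) + h ((tensorComplex k F G).d z) =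
        z - i ((tensorComplex k F G).aug z) := by
  obtain ⟨i, h, -, hh⟩ := hF.exists_contraction k
  obtain ⟨i', h', hdi', hh'⟩ := hG.exists_contraction k
  let ε' : (G.X →₀ S) →ₗ[k] (G.X →₀ S) := i' ∘ₗ G.aug.restrictScalars k
  let e := finsuppTensorFinsupp k k R S F.X G.X
  let H : (F.X × G.X →₀ R ⊗[k] S) →ₗ[k] (F.X × G.X →₀ R ⊗[k] S) :=
    e.toLinearMap ∘ₗ (TensorProduct.map (F.sign.restrictScalars k) h' + TensorProduct.map h ε') ∘ₗ
      e.symm.toLinearMap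
  let I : R ⊗[k] S →ₗ[k] (F.X × G.X →₀ R ⊗[k] S) := e.toLinearMap ∘ₗ TensorProduct.map i i'
  let D : (F.X × G.X →₀ R ⊗[k] S) →ₗ[k] (F.X × G.X →₀ R ⊗[k] S) :=
    (tensorComplex k F G).d.restrictScalars k
  let E : (F.X × G.X →₀ R ⊗[k] S) →ₗ[k] R ⊗[k] S := (tensorComplex k F G).aug.restrictScalars k
  have hH a b : H (tp k a b) = tp k (F.sign a) (h' b) + tp k (h a) (ε' b) := by
    simp [H, e, tp]
  have hI r s : I (r ⊗ₜ s) = tp k (i r) (i' s) := rfl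
  have hD a b : D (tp k a b) = tp k (F.d a) b + tp k (F.sign a) (G.d b) := tensorComplex_d_tp a b
  have hE a b : E (tp k a b) = F.aug a ⊗ₜ G.aug b := boxAug_tp ..
  have hε' b : ε' b = i' (G.aug b) := rfl
  have hεd b : ε' (G.d b) = 0 := by rw [hε', hG.aug_d, map_zero]
  have hdε b : G.d (ε' b) = 0 := hdi' _
  have hDH : D ∘ₗ H + H ∘ₗ D = LinearMap.id - I ∘ₗ E := by
    refine LinearMap.ext (eq_of_eqOn_tp _ _ fun a b => ?_)
    have h₁ : tp k (F.d (h a)) (ε' b) + tp k (h (F.d a)) (ε' b) =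
        tp k a (ε' b) - tp k (i (F.aug a)) (ε' b) := by
      rw [← LinearMap.add_apply, ← map_add, hh, map_sub, LinearMap.sub_apply]
    have h₂ : tp k a (G.d (h' b)) + tp k a (h' (G.d b)) = tp k a b - tp k a (ε' b) := by
      rw [← map_add, hh', map_sub, hε']
    calc D (H (tp k a b)) + H (D (tp k a b))
        = tp k a (G.d (h' b)) + tp k a (h' (G.d b)) +
            (tp k (F.d (h a)) (ε' b) + tp k (h (F.d a)) (ε' b)) := by
          simp only [hH, map_add, hD, hF.d_sign, F.sign_sign, hεd, hdε, map_zero,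
            map_neg, LinearMap.neg_apply]
          abel
      _ = tp k a b - I (E (tp k a b)) := by
          rw [h₁, h₂, hE, hI, sub_add_sub_cancel, hε']
  exact ⟨I, H, DFunLike.congr_fun hDH⟩

theorem tensorComplex_isResolution [SetLike.GradedOne 𝒢] [SetLike.GradedOne ℋ]
    (h𝒯 : IsTensorGraded 𝒢 ℋ 𝒯) (hF : IsResolution 𝒢 F A) (hG : IsResolution ℋ G B) :
    IsResolution 𝒯 (tensorComplex k F G) (extendLeft A * extendRight B) where
  d_homogeneous :=
    ((hF.d_homogeneous.box h𝒯 .id).mono le_top).add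
      ((F.sign_isHomogeneous.box h𝒯 hG.d_homogeneous).mono le_top)
  aug_single_eq_zero p h := by
    rw [boxAug_single]
    have h' : F.hdeg p.1 + G.hdeg p.2 ≠ 0 := h
    by_cases h₁ : F.hdeg p.1 = 0
    · rw [hG.aug_single_eq_zero p.2 (by omega), TensorProduct.tmul_zero]
    · rw [hF.aug_single_eq_zero p.1 h₁, TensorProduct.zero_tmul]
  aug_single_mem p := by
    rw [boxAug_single]
    exact h𝒯 (hF.aug_single_mem p.1) (hG.aug_single_mem p.2)
  d_d := tensorComplex_d_d hF hG
  aug_d := tensorComplex_aug_d hF hG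
  exact z hd haug := by
    obtain ⟨i, h, hh⟩ := exists_tensorComplex_contraction (k := k) hF hG
    refine ⟨h z, ?_⟩
    have hz := hh z
    rwa [hd, haug, map_zero, map_zero, add_zero, sub_zero] at hz
  range_aug := by rw [range_boxAug, hF.range_aug, hG.range_aug]

end TensorComplex

section Ideals

variable {k R S : Type u} [Field k] [CommRing R] [Algebra k R] [CommRing S] [Algebra k S]

variable (k) in
theorem exists_linearMap_eq_self_of_mem (A : Ideal R) :
    ∃ e : R →ₗ[k] R, (∀ r, e r ∈ A) ∧ ∀ r ∈ A, e r = r := by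
  obtain ⟨g, hg⟩ := (A.restrictScalars k).subtype.exists_leftInverse_of_injective
    (Submodule.ker_subtype _)
  exact ⟨(A.restrictScalars k).subtype ∘ₗ g, fun r => (g r).2,
    fun r hr => congrArg Subtype.val (LinearMap.congr_fun hg ⟨r, hr⟩)⟩

theorem map_id_eq_self_of_mem_extendLeft {A : Ideal R} {e : R →ₗ[k] R} (he : ∀ r ∈ A, e r = r)
    {x : R ⊗[k] S} (hx : x ∈ extendLeft (k := k) A) :
    TensorProduct.map e LinearMap.id x = x := by
  have hxA : x ∈ (extendLeft (k := k) (S := S) A).restrictScalars k := hx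
  rw [extendLeft, Ideal.map_includeLeft_eq] at hxA
  obtain ⟨y, rfl⟩ := hxA
  have heA : e ∘ₗ (A.restrictScalars k).subtype = (A.restrictScalars k).subtype :=
    LinearMap.ext fun r => he r r.2
  change (e.rTensor S ∘ₗ (A.restrictScalars k).subtype.rTensor S) y = _
  rw [← LinearMap.rTensor_comp, heA]

theorem map_id_eq_self_of_mem_extendRight {B : Ideal S} {f : S →ₗ[k] S} (hf : ∀ s ∈ B, f s = s)
    {x : R ⊗[k] S} (hx : x ∈ extendRight (k := k) B) :
    TensorProduct.map LinearMap.id f x = x := by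
  have hxB : x ∈ (extendRight (k := k) (R := R) B).restrictScalars k := hx
  rw [extendRight, Ideal.map_includeRight_eq] at hxB
  obtain ⟨y, rfl⟩ := hxB
  have hfB : f ∘ₗ (B.restrictScalars k).subtype = (B.restrictScalars k).subtype :=
    LinearMap.ext fun s => hf s s.2
  change (f.lTensor R ∘ₗ (B.restrictScalars k).subtype.lTensor R) y = _
  rw [← LinearMap.lTensor_comp, hfB]

theorem extendLeft_inf_extendRight (A : Ideal R) (B : Ideal S) :
    extendLeft (k := k) A ⊓ extendRight B = extendLeft A * extendRight B := by
  refine le_antisymm (fun x ⟨hxA, hxB⟩ => ?_) Ideal.mul_le_inf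
  obtain ⟨e, he_mem, he⟩ := exists_linearMap_eq_self_of_mem k A
  obtain ⟨f, hf_mem, hf⟩ := exists_linearMap_eq_self_of_mem k B
  have hx : TensorProduct.map e f x = x := by
    conv_rhs => rw [← map_id_eq_self_of_mem_extendLeft he hxA,
      ← map_id_eq_self_of_mem_extendRight hf hxB]
    rw [← LinearMap.comp_apply, ← TensorProduct.map_comp, LinearMap.comp_id, LinearMap.id_comp]
  have hmem (y : R ⊗[k] S) : TensorProduct.map e f y ∈ extendLeft A * extendRight B := by
    induction y with
    | zero => exact map_zero (TensorProduct.map e f) ▸ Ideal.zero_mem _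
    | tmul r s => exact tmul_mem_extendLeft_mul_extendRight (he_mem r) (hf_mem s)
    | add y z hy hz => exact map_add (TensorProduct.map e f) y z ▸ Ideal.add_mem _ hy hz
  exact hx ▸ hmem x

theorem add_pow_succ_eq {T : Type u} [CommRing T] (A B : Ideal T) (s : ℕ) :
    (A + B) ^ (s + 1) = A * (A + B) ^ s + B ^ (s + 1) := by
  induction s with
  | zero => simp
  | succ s ih =>
    have h : A * B * (A + B) ^ s ≤ A * (A + B) ^ (s + 1) := by
      rw [mul_assoc, pow_succ' (A + B)]
      exact Ideal.mul_mono_right (Ideal.mul_mono_left le_sup_right)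
    calc (A + B) ^ (s + 2) = A * (A + B) ^ (s + 1) + B * (A + B) ^ (s + 1) := by ring
      _ = A * (A + B) ^ (s + 1) + B * (A * (A + B) ^ s + B ^ (s + 1)) := by rw [← ih]
      _ = (A * (A + B) ^ (s + 1) + A * B * (A + B) ^ s) + B ^ (s + 2) := by ring
      _ = _ := by rw [Submodule.add_eq_sup (A * (A + B) ^ (s + 1)), sup_eq_left.2 h]

variable (I : Ideal R) (J : Ideal S)

variable (k) in
theorem extendLeft_pow (r : ℕ) : extendLeft (k := k) (S := S) (I ^ r) = extendLeft I ^ r :=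
  Ideal.map_pow _ _ _

variable (k) in
theorem extendRight_pow (s : ℕ) : extendRight (k := k) (R := R) (J ^ s) = extendRight J ^ s :=
  Ideal.map_pow _ _ _

theorem extendLeft_pow_mul_mixedSum_pow_succ (r s : ℕ) :
    extendLeft (k := k) I ^ r * mixedSum I J ^ (s + 1) =
      extendLeft I ^ (r + 1) * mixedSum I J ^ s + extendLeft I ^ r * extendRight J ^ (s + 1) := by
  rw [mixedSum, add_pow_succ_eq]
  ring

theorem extendLeft_pow_mul_mixedSum_pow_inf (r s : ℕ) :
    (extendLeft (k := k) I ^ (r + 1) * mixedSum I J ^ s) ⊓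
        (extendLeft I ^ r * extendRight J ^ (s + 1)) =
      extendLeft I ^ (r + 1) * extendRight J ^ (s + 1) := by
  apply le_antisymm
  · rw [← extendLeft_pow k I (r + 1), ← extendRight_pow k J (s + 1),
      ← extendLeft_inf_extendRight]
    exact inf_le_inf Ideal.mul_le_left Ideal.mul_le_right
  · refine le_inf (Ideal.mul_mono_right ?_) (Ideal.mul_mono_left (Ideal.pow_le_pow_right
      r.le_succ))
    exact (Ideal.pow_le_pow_right s.le_succ).trans (Ideal.pow_right_mono le_sup_right s)

end Ideals

section TotalComplex

variable {k R S : Type u} [Field k] [CommRing R] [Algebra k R] [CommRing S] [Algebra k S]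

theorem IsLift.id {𝒢 : ℤ → AddSubgroup R} [SetLike.GradedOne 𝒢] (F : BasedComplex R) :
    IsLift 𝒢 F F ⊤ LinearMap.id where
  toIsHomogeneous := .id
  comm_d _ := rfl
  comm_aug _ := rfl

/-- Graded free resolutions of all powers of the ideal `I`, with lifts of the inclusions
`I ^ (a + 1) → I ^ a` whose entries are in `c`. -/
structure PowerTower (𝒢 : ℤ → AddSubgroup R) (I c : Ideal R) where
  res : ℕ → BasedComplex R
  lift : ∀ a, (res (a + 1)).Map (res a)
  isResolution : ∀ a, IsResolution 𝒢 (res a) (I ^ a)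
  isLift : ∀ a, IsLift 𝒢 (res (a + 1)) (res a) c (lift a)

variable {𝒢 : ℤ → AddSubgroup R} {ℋ : ℤ → AddSubgroup S} {𝒯 : ℤ → AddSubgroup (R ⊗[k] S)}
variable {I c : Ideal R} {J c' : Ideal S} {e : Ideal (R ⊗[k] S)}

theorem box_comp {X Y X' Y' X'' Y'' : Type u} (f : (X →₀ R) →ₗ[R] (X' →₀ R))
    (g : (Y →₀ S) →ₗ[S] (Y' →₀ S)) (f' : (X' →₀ R) →ₗ[R] (X'' →₀ R))
    (g' : (Y' →₀ S) →ₗ[S] (Y'' →₀ S)) (z : X × Y →₀ R ⊗[k] S) :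
    box f' g' (box f g z) = box (f' ∘ₗ f) (g' ∘ₗ g) z := by
  refine eq_of_eqOn_tp (box f' g' ∘ₗ box f g) _ (fun a b => ?_) z
  simp

namespace PowerTower

variable (k) (F : PowerTower 𝒢 I c) (G : PowerTower ℋ J c')

/-- The tensor product of the resolutions of `I ^ r` and `J ^ s`. -/
abbrev tensor (r s : ℕ) : BasedComplex (R ⊗[k] S) :=
  tensorComplex k (F.res r) (G.res s)

/-- The lift of `I ^ (r + 1) * J ^ s → I ^ r * J ^ s` to the tensor products of resolutions. -/
abbrev tensorLeft (r s : ℕ) : (F.tensor k G (r + 1) s).Map (F.tensor k G r s) :=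
  box (F.lift r) LinearMap.id

/-- The lift of `I ^ r * J ^ (s + 1) → I ^ r * J ^ s` to the tensor products of resolutions. -/
abbrev tensorRight (r s : ℕ) : (F.tensor k G r (s + 1)).Map (F.tensor k G r s) :=
  box LinearMap.id (G.lift s)

/-- The resolution of `I ^ r * (I + J) ^ s` by iterated mapping cones, paired with the lift of the
inclusion of `I ^ r * J ^ s`; the recursion needs both. -/
def totalWithIncl : ∀ s r : ℕ, Σ C : BasedComplex (R ⊗[k] S), (F.tensor k G r s).Map C
  | 0, r => ⟨F.tensor k G r 0, LinearMap.id⟩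
  | s + 1, r =>
    ⟨cone (A := (totalWithIncl s (r + 1)).1) ((totalWithIncl s (r + 1)).2 ∘ₗ
        F.tensorRight k G (r + 1) s) (F.tensorLeft k G r (s + 1)), coneInr _ _⟩

/-- The resolution of `I ^ r * (I + J) ^ s` by iterated mapping cones. -/
abbrev total (s r : ℕ) : BasedComplex (R ⊗[k] S) :=
  (F.totalWithIncl k G s r).1

/-- The lift of the inclusion of `I ^ r * J ^ s` in `I ^ r * (I + J) ^ s`. -/
abbrev incl (s r : ℕ) : (F.tensor k G r s).Map (F.total k G s r) :=
  (F.totalWithIncl k G s r).2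

/-- The lift of the inclusion of `I ^ r * (I + J) ^ (s + 1)` in `I ^ r * (I + J) ^ s`. -/
def totalMap : ∀ s r : ℕ, (F.total k G (s + 1) r).Map (F.total k G s r)
  | 0, r => coneDesc _ _ (F.tensorLeft k G r 0) (F.tensorRight k G r 0)
  | s + 1, r => coneMap _ _ _ _ (totalMap s (r + 1)) (F.tensorRight k G r (s + 1))
      (F.tensorRight k G (r + 1) (s + 1))

theorem totalMap_incl (s r : ℕ) (x : (F.tensor k G r (s + 1)).X →₀ R ⊗[k] S) :
    F.totalMap k G s r (F.incl k G (s + 1) r x) = F.incl k G s r (F.tensorRight k G r s x) := by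
  cases s with
  | zero => exact coneDesc_coneInr (x := x) ..
  | succ s => exact coneMap_coneInr (x := x) ..

theorem tensorLeft_tensorRight (r s : ℕ) (x : (F.tensor k G (r + 1) (s + 1)).X →₀ R ⊗[k] S) :
    F.tensorLeft k G r s (F.tensorRight k G (r + 1) s x) =
      F.tensorRight k G r s (F.tensorLeft k G r (s + 1) x) :=
  (box_comp LinearMap.id (G.lift s) (F.lift r) LinearMap.id x).trans
    (box_comp (F.lift r) LinearMap.id LinearMap.id (G.lift s) x).symm

theorem incl_isLift [SetLike.GradedOne 𝒯] (s r : ℕ) :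
    IsLift 𝒯 (F.tensor k G r s) (F.total k G s r) ⊤ (F.incl k G s r) := by
  cases s with
  | zero => exact .id _
  | succ s => exact coneInr_isLift _ _

variable {k} (h𝒯 : IsTensorGraded 𝒢 ℋ 𝒯)
include h𝒯

theorem tensorLeft_isLift [SetLike.GradedOne ℋ] (r s : ℕ) :
    IsLift 𝒯 (F.tensor k G (r + 1) s) (F.tensor k G r s) (extendLeft c) (F.tensorLeft k G r s) :=
  ((F.isLift r).box h𝒯 (.id _)).mono Ideal.mul_le_left

variable [SetLike.GradedOne 𝒢]

theorem tensorRight_isLift (r s : ℕ) :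
    IsLift 𝒯 (F.tensor k G r (s + 1)) (F.tensor k G r s) (extendRight c')
      (F.tensorRight k G r s) :=
  ((IsLift.id _).box h𝒯 (G.isLift s)).mono Ideal.mul_le_right

theorem incl_comp_tensorRight_isLift [SetLike.GradedMonoid 𝒯] (s r : ℕ) :
    IsLift 𝒯 (F.tensor k G r (s + 1)) (F.total k G s r) (extendRight c')
      (F.incl k G s r ∘ₗ F.tensorRight k G r s) :=
  ((F.incl_isLift k G s r).comp (F.tensorRight_isLift G h𝒯 r s)).mono Ideal.mul_le_left

variable [SetLike.GradedOne ℋ]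

theorem tensor_isResolution (r s : ℕ) :
    IsResolution 𝒯 (F.tensor k G r s) (extendLeft I ^ r * extendRight J ^ s) := by
  rw [← extendLeft_pow, ← extendRight_pow]
  exact tensorComplex_isResolution h𝒯 (F.isResolution r) (G.isResolution s)

theorem totalMap_isLift (hc : extendLeft c ≤ e) (hc' : extendRight c' ≤ e) (s r : ℕ) :
    IsLift 𝒯 (F.total k G (s + 1) r) (F.total k G s r) e (F.totalMap k G s r) := by
  have hright (r s : ℕ) := (F.tensorRight_isLift G h𝒯 r s).mono hc'
  induction s generalizing r with
  | zero =>
    exact coneDesc_isLift ((F.tensorLeft_isLift G h𝒯 r 0).mono hc) (hright r 0)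
      (F.tensorLeft_tensorRight k G r 0)
  | succ s ih =>
    exact coneMap_isLift (ih (r + 1)) (hright _ _) (hright _ _)
      (fun x => F.totalMap_incl k G s (r + 1) _)
      fun x => (F.tensorLeft_tensorRight k G r (s + 1) x).symm

variable [SetLike.GradedMonoid 𝒯]

theorem total_isResolution (s r : ℕ) :
    IsResolution 𝒯 (F.total k G s r) (extendLeft I ^ r * mixedSum I J ^ s) := by
  induction s generalizing r with
  | zero =>
    have h := F.tensor_isResolution G h𝒯 r 0
    rwa [pow_zero, ← pow_zero (mixedSum I J)] at h
  | succ s ih =>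
    rw [extendLeft_pow_mul_mixedSum_pow_succ]
    refine cone_isResolution (c := ⊤) (ih (r + 1)) (F.tensor_isResolution G h𝒯 r (s + 1)) ?_
      ((F.incl_comp_tensorRight_isLift G h𝒯 s (r + 1)).mono le_top)
      ((F.tensorLeft_isLift G h𝒯 r (s + 1)).mono le_top)
    rw [extendLeft_pow_mul_mixedSum_pow_inf]
    exact F.tensor_isResolution G h𝒯 (r + 1) (s + 1)

/-- The tower of the powers of `I + J` given by the total complexes. -/
protected def mixedSum (hc : extendLeft c ≤ e) (hc' : extendRight c' ≤ e) :
    PowerTower 𝒯 (mixedSum I J) e where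
  res s := F.total k G s 0
  lift s := F.totalMap k G s 0
  isResolution s := by simpa using F.total_isResolution G h𝒯 s 0
  isLift s := F.totalMap_isLift G h𝒯 hc hc' s 0

end PowerTower

end TotalComplex

section Gradings

section Trivial

variable {k R S : Type u} [Field k] [CommRing R] [Algebra k R] [CommRing S] [Algebra k S]

instance trivialGrading_gradedMonoid :
    SetLike.GradedMonoid (fun _ : ℤ => (⊤ : AddSubgroup R)) where
  one_mem := AddSubgroup.mem_top _
  mul_mem _ _ _ _ _ _ := AddSubgroup.mem_top _

theorem isTensorGraded_trivial :
    IsTensorGraded (fun _ => (⊤ : AddSubgroup R)) (fun _ => (⊤ : AddSubgroup S))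
      (fun _ => (⊤ : AddSubgroup (R ⊗[k] S))) :=
  fun _ _ _ _ _ _ => AddSubgroup.mem_top _

end Trivial

section IntGrading

variable {k R : Type u} [Field k] [CommRing R] [Algebra k R] (𝒜 : ℕ → Submodule k R)

/-- The family of additive groups indexed by `ℤ` that extends `𝒜` by zero in negative degrees. -/
abbrev intGrading (z : ℤ) : AddSubgroup R :=
  (component 𝒜 z).toAddSubgroup

instance intGrading_gradedMonoid [SetLike.GradedMonoid 𝒜] :
    SetLike.GradedMonoid (intGrading 𝒜) where
  one_mem := SetLike.GradedOne.one_mem (A := 𝒜)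
  mul_mem z w x y hx hy := by
    rcases z with m | m <;> rcases w with n | n
    · exact SetLike.mul_mem_graded (A := 𝒜) hx hy
    · rw [(Submodule.mem_bot k).1 hy, mul_zero]
      exact zero_mem _
    all_goals
      rw [(Submodule.mem_bot k).1 hx, zero_mul]
      exact zero_mem _

/-- The projections onto the homogeneous components of a graded algebra. -/
def intGradingProjection [GradedAlgebra 𝒜] : GradingProjection (intGrading 𝒜) where
  proj
    | Int.ofNat n => GradedRing.proj 𝒜 n
    | Int.negSucc _ => 0
  proj_mem
    | Int.ofNat n, a => (DirectSum.decompose 𝒜 a n).2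
    | Int.negSucc _, _ => zero_mem _
  proj_eq_self := by
    rintro (n | n) a ha
    · exact DirectSum.decompose_of_mem_same 𝒜 ha
    · exact ((Submodule.mem_bot k).1 ha).symm
  proj_mul := by
    rintro z a (n | n) b hb
    · rcases z with m | m
      · exact DirectSum.coe_decompose_mul_add_of_right_mem 𝒜 hb
      · refine Eq.trans ?_ (zero_mul b).symm
        generalize hp : Int.negSucc m + Int.ofNat n = p
        rcases p with p | p
        · exact DirectSum.coe_decompose_mul_of_right_mem_of_not_le 𝒜 hb (by grind)
        · rfl
    · rw [(Submodule.mem_bot k).1 hb, mul_zero, mul_zero, map_zero]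

theorem gradedMax_eq_irrelevant [GradedAlgebra 𝒜] :
    gradedMax 𝒜 = (HomogeneousIdeal.irrelevant 𝒜).toIdeal := by
  rw [HomogeneousIdeal.irrelevant_eq_span, gradedMax]
  congr 1
  ext x
  simp [Nat.one_le_iff_ne_zero, Nat.pos_iff_ne_zero]

theorem mem_gradedMax_iff [GradedAlgebra 𝒜] {x : R} :
    x ∈ gradedMax 𝒜 ↔ GradedRing.proj 𝒜 0 x = 0 := by
  rw [gradedMax_eq_irrelevant]
  exact HomogeneousIdeal.mem_irrelevant_iff 𝒜 x

variable {𝒜} in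
theorem IsStandardGraded.gradedMax_isMaximal [GradedAlgebra 𝒜] (h : IsStandardGraded 𝒜) :
    (gradedMax 𝒜).IsMaximal := by
  have := h.nontrivial
  have proj_of_mem : ∀ x ∈ 𝒜 0, GradedRing.proj 𝒜 0 x = x := fun x hx =>
    DirectSum.decompose_of_mem_same 𝒜 hx
  have : Nontrivial (R ⧸ gradedMax 𝒜) := Ideal.Quotient.nontrivial_iff.2 <| by
    rw [Ideal.ne_top_iff_one, mem_gradedMax_iff, proj_of_mem 1 SetLike.GradedOne.one_mem]
    exact one_ne_zero
  have surjective : Function.Surjective (algebraMap k (R ⧸ gradedMax 𝒜)) := fun y => by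
    obtain ⟨x, rfl⟩ := Ideal.Quotient.mk_surjective y
    have hx : GradedRing.proj 𝒜 0 x ∈ 𝒜 0 := (DirectSum.decompose 𝒜 x 0).2
    obtain ⟨a, ha⟩ := h.degree_zero ▸ hx
    refine ⟨a, Ideal.Quotient.eq.2 ?_⟩
    rw [mem_gradedMax_iff, map_sub, ← Algebra.linearMap_apply, ha, proj_of_mem _ hx, sub_self]
  exact Ideal.Quotient.maximal_of_isField _ ((RingEquiv.ofBijective _
    ⟨(algebraMap k _).injective, surjective⟩).toMulEquiv.symm.isField (Field.toIsField k))

end IntGrading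

section TensorGrading

variable {k R S : Type u} [Field k] [CommRing R] [Algebra k R] [CommRing S] [Algebra k S]
  (𝒜 : ℕ → Submodule k R) (ℬ : ℕ → Submodule k S)

variable {𝒜 ℬ} in
theorem tmul_mem_tensorGrading {m n : ℕ} {r : R} {s : S} (hr : r ∈ 𝒜 m) (hs : s ∈ ℬ n) :
    r ⊗ₜ[k] s ∈ tensorGrading 𝒜 ℬ (m + n) :=
  Submodule.mem_iSup_of_mem (m, n) (Submodule.mem_iSup_of_mem
    (Finset.HasAntidiagonal.mem_antidiagonal.2 rfl) (Submodule.apply_mem_map₂ _ hr hs))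

variable {𝒜 ℬ} in
theorem tensorGrading_le {n : ℕ} {N : Submodule k (R ⊗[k] S)}
    (h : ∀ p q, p + q = n → ∀ r ∈ 𝒜 p, ∀ s ∈ ℬ q, r ⊗ₜ[k] s ∈ N) :
    tensorGrading 𝒜 ℬ n ≤ N :=
  iSup₂_le fun p hp => Submodule.map₂_le.2 fun r hr s hs =>
    h p.1 p.2 (Finset.HasAntidiagonal.mem_antidiagonal.1 hp) r hr s hs

variable {𝒜 ℬ} in
theorem tmul_mul_mem_tensorGrading [SetLike.GradedMul 𝒜] [SetLike.GradedMul ℬ] {p q n : ℕ}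
    {r : R} {s : S} (hr : r ∈ 𝒜 p) (hs : s ∈ ℬ q) {y : R ⊗[k] S}
    (hy : y ∈ tensorGrading 𝒜 ℬ n) : r ⊗ₜ[k] s * y ∈ tensorGrading 𝒜 ℬ (p + q + n) := by
  suffices h : tensorGrading 𝒜 ℬ n ≤
      (tensorGrading 𝒜 ℬ (p + q + n)).comap (LinearMap.mulLeft k (r ⊗ₜ[k] s)) from h hy
  refine tensorGrading_le fun p' q' hn r' hr' s' hs' => ?_
  rw [Submodule.mem_comap, LinearMap.mulLeft_apply, Algebra.TensorProduct.tmul_mul_tmul, ← hn,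
    add_add_add_comm p q p' q']
  exact tmul_mem_tensorGrading (SetLike.mul_mem_graded hr hr') (SetLike.mul_mem_graded hs hs')

instance tensorGrading_gradedMonoid [SetLike.GradedMonoid 𝒜] [SetLike.GradedMonoid ℬ] :
    SetLike.GradedMonoid (tensorGrading 𝒜 ℬ) where
  one_mem := by
    rw [Algebra.TensorProduct.one_def, ← add_zero 0]
    exact tmul_mem_tensorGrading (SetLike.one_mem_graded 𝒜) (SetLike.one_mem_graded ℬ)
  mul_mem m n x y hx hy := by
    suffices h : tensorGrading 𝒜 ℬ m ≤
        (tensorGrading 𝒜 ℬ (m + n)).comap (LinearMap.mulRight k y) from h hx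
    refine tensorGrading_le fun p q hm r hr s hs => ?_
    rw [Submodule.mem_comap, LinearMap.mulRight_apply, ← hm]
    exact tmul_mul_mem_tensorGrading hr hs hy

theorem isTensorGraded_intGrading :
    IsTensorGraded (intGrading 𝒜) (intGrading ℬ) (intGrading (tensorGrading 𝒜 ℬ)) := by
  rintro (m | m) (n | n) r s hr hs
  · exact tmul_mem_tensorGrading hr hs
  · rw [(Submodule.mem_bot k).1 hs, TensorProduct.tmul_zero]
    exact zero_mem _
  all_goals
    rw [(Submodule.mem_bot k).1 hr, TensorProduct.zero_tmul]
    exact zero_mem _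

theorem extendLeft_gradedMax_pow_le [SetLike.GradedOne ℬ] (e : ℕ) :
    extendLeft (gradedMax 𝒜 ^ e) ≤ gradedMax (tensorGrading 𝒜 ℬ) ^ e := by
  rw [extendLeft_pow]
  refine Ideal.pow_right_mono ?_ e
  rw [extendLeft, gradedMax, Ideal.map_span, Ideal.span_le]
  rintro _ ⟨x, ⟨n, hn, hx⟩, rfl⟩
  exact Ideal.subset_span ⟨n, hn, add_zero n ▸ tmul_mem_tensorGrading hx (SetLike.one_mem_graded ℬ)⟩

theorem extendRight_gradedMax_pow_le [SetLike.GradedOne 𝒜] (e : ℕ) :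
    extendRight (gradedMax ℬ ^ e) ≤ gradedMax (tensorGrading 𝒜 ℬ) ^ e := by
  rw [extendRight_pow]
  refine Ideal.pow_right_mono ?_ e
  rw [extendRight, gradedMax, Ideal.map_span, Ideal.span_le]
  rintro _ ⟨x, ⟨n, hn, hx⟩, rfl⟩
  exact Ideal.subset_span ⟨n, hn, zero_add n ▸ tmul_mem_tensorGrading (SetLike.one_mem_graded 𝒜) hx⟩

end TensorGrading

end Gradings

section GradedFreeResolutions

variable {k R : Type u} [Field k] [CommRing R] [Algebra k R] {𝒜 : ℕ → Submodule k R}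
variable {F G : BasedComplex R} {A B : Ideal R}

theorem IsHomogeneous.block_single_mem {𝒢 : ℤ → AddSubgroup R} {n : ℕ} {c : Ideal R} {φ : F.Map G}
    (hφ : IsHomogeneous 𝒢 F G n c φ) {p q : ℕ} (j : F.Fiber p) (i : G.Fiber q) :
    BasedComplex.block φ p q (Finsupp.single j 1) i ∈ 𝒢 (F.deg j.1 - G.deg i.1) := by
  change φ (F.incl p (Finsupp.single j 1)) i.1 ∈ _
  rw [F.incl_single]
  exact hφ.entry_mem_degree j.1 i.1

/-- The graded free resolution by the parts of a resolution in each homological degree. -/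
def IsResolution.gradedFreeResolution (hF : IsResolution (intGrading 𝒜) F A) :
    GradedFreeResolution 𝒜 (idealComponent 𝒜 A) where
  ι := F.Fiber
  deg _ j := F.deg j.1
  d n := BasedComplex.block F.d (n + 1) n
  aug := hF.augTo
  d_deg _ := hF.d_homogeneous.block_single_mem
  aug_deg j := by
    change F.aug (F.incl 0 (Finsupp.single j 1)) ∈ component 𝒜 (F.deg j.1)
    rw [F.incl_single]
    exact hF.aug_single_mem j.1
  aug_surjective := hF.augTo_surjective
  exact_aug x := ⟨hF.exact_augTo x, by rintro ⟨y, rfl⟩; exact hF.augTo_block_d y⟩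
  exact_d n x := ⟨hF.exact_block_d n x, by rintro ⟨y, rfl⟩; exact hF.block_d_block_d n y⟩

/-- The lifting between graded free resolutions by the parts of a lift. -/
def IsLift.gradedLifting {c : Ideal R} {φ : F.Map G} (hφ : IsLift (intGrading 𝒜) F G c φ)
    (hF : IsResolution (intGrading 𝒜) F A) (hG : IsResolution (intGrading 𝒜) G B) :
    GradedLifting hF.gradedFreeResolution hG.gradedFreeResolution
      (Submodule.inclusion (hφ.le hF hG)) where
  map n := BasedComplex.block φ n n
  map_deg _ := hφ.block_single_mem
  comm_aug := LinearMap.ext (hφ.augTo_block hF hG)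
  comm_d n := LinearMap.ext (hφ.block_d_block hF hG n)

theorem HasLift.inclusionDoublyTorVanishing
    (h : HasLift (intGrading 𝒜) F G (gradedMax 𝒜 ^ 2))
    (hF : IsResolution (intGrading 𝒜) F A) (hG : IsResolution (intGrading 𝒜) G B) :
    InclusionDoublyTorVanishing 𝒜 A B := by
  obtain ⟨φ, hφ⟩ := h
  refine ⟨hφ.le hF hG, hF.gradedFreeResolution, hG.gradedFreeResolution,
    hφ.gradedLifting hF hG, ?_⟩
  rintro n _ ⟨x, rfl⟩
  exact (mem_smul_top_iff _).2 fun i => hφ.apply_mem _ i.1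

end GradedFreeResolutions

section Sequences

section Levels

variable {R : Type u} [CommRing R] {ι : ℕ → Type u} {N : Type*} [AddCommGroup N] [Module R N]

/-- The inclusion of the `n`-th module of a sequence of free modules in their direct sum. -/
def levelIncl (ι : ℕ → Type u) (n : ℕ) : (ι n →₀ R) →ₗ[R] ((Σ n, ι n) →₀ R) :=
  Finsupp.lmapDomain R R (Sigma.mk n)

/-- The projection of a direct sum of free modules onto the `n`-th summand. -/
def levelProj (ι : ℕ → Type u) (n : ℕ) : ((Σ n, ι n) →₀ R) →ₗ[R] (ι n →₀ R) :=
  Finsupp.lcomapDomain (Sigma.mk n) sigma_mk_injective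

/-- The map out of a direct sum of free modules that is `f n` on the `n`-th summand. -/
def ofLevels (f : ∀ n, (ι n →₀ R) →ₗ[R] N) : ((Σ n, ι n) →₀ R) →ₗ[R] N :=
  Finsupp.linearCombination R fun j => f j.1 (Finsupp.single j.2 1)

theorem levelIncl_single {n : ℕ} (j : ι n) (a : R) :
    levelIncl ι n (Finsupp.single j a) = Finsupp.single ⟨n, j⟩ a :=
  Finsupp.mapDomain_single

theorem levelIncl_apply_self {n : ℕ} (x : ι n →₀ R) (i : ι n) : levelIncl ι n x ⟨n, i⟩ = x i :=
  Finsupp.mapDomain_apply sigma_mk_injective x i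

theorem levelIncl_apply_of_ne {m n : ℕ} (h : m ≠ n) (x : ι n →₀ R) (i : ι m) :
    levelIncl ι n x ⟨m, i⟩ = 0 :=
  Finsupp.mapDomain_of_notMem_range _ _ fun ⟨_, hj⟩ => h (congrArg Sigma.fst hj).symm

theorem levelIncl_apply_mem {n : ℕ} {x : ι n →₀ R} (S : (Σ n, ι n) → AddSubgroup R)
    (hx : ∀ i, x i ∈ S ⟨n, i⟩) (i : Σ n, ι n) : levelIncl ι n x i ∈ S i := by
  obtain ⟨m, i⟩ := i
  by_cases h : m = n
  · subst h
    exact levelIncl_apply_self x i ▸ hx i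
  · exact levelIncl_apply_of_ne h x i ▸ (S _).zero_mem

theorem linearMap_ext_levels {f g : ((Σ n, ι n) →₀ R) →ₗ[R] N}
    (h : ∀ n x, f (levelIncl ι n x) = g (levelIncl ι n x)) : f = g :=
  linearMap_ext_single fun j => levelIncl_single j.2 (1 : R) ▸ h j.1 (Finsupp.single j.2 1)

theorem ofLevels_levelIncl (f : ∀ n, (ι n →₀ R) →ₗ[R] N) (n : ℕ) (x : ι n →₀ R) :
    ofLevels f (levelIncl ι n x) = f n x := by
  refine LinearMap.congr_fun (f := ofLevels f ∘ₗ levelIncl ι n)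
    (linearMap_ext_single fun j => ?_) x
  rw [LinearMap.comp_apply, levelIncl_single, ofLevels, Finsupp.linearCombination_single, one_smul]

theorem levelProj_levelIncl (n : ℕ) (x : ι n →₀ R) :
    levelProj ι n (levelIncl ι n x) = x :=
  Finsupp.ext fun i => levelIncl_apply_self x i

theorem levelProj_levelIncl_of_ne {m n : ℕ} (h : m ≠ n) (x : ι n →₀ R) :
    levelProj ι m (levelIncl ι n x) = 0 :=
  Finsupp.ext fun i => levelIncl_apply_of_ne h x i

theorem sum_levelIncl_levelProj (x : (Σ n, ι n) →₀ R) :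
    ∑ n ∈ x.splitSupport, levelIncl ι n (levelProj ι n x) = x := by
  ext ⟨m, i⟩
  rw [Finsupp.finsetSum_apply, Finset.sum_eq_single m]
  · exact levelIncl_apply_self _ i
  · exact fun n _ hn => levelIncl_apply_of_ne hn.symm _ _
  · intro hm
    rw [Finsupp.mem_splitSupport_iff_nonzero, not_not] at hm
    exact (levelIncl_apply_self _ i).trans (DFunLike.congr_fun hm i)

end Levels

variable {R : Type u} [CommRing R] {𝒢 : ℤ → AddSubgroup R}
variable (ι : ℕ → Type u) (deg : ∀ n, ι n → ℤ)
  (d : ∀ n, (ι (n + 1) →₀ R) →ₗ[R] (ι n →₀ R)) (aug : (ι 0 →₀ R) →ₗ[R] R)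

namespace BasedComplex

/-- The differential of `ofSequence` on each level. -/
def ofSequenceD : ∀ n, (ι n →₀ R) →ₗ[R] ((Σ n, ι n) →₀ R)
  | 0 => 0
  | n + 1 => levelIncl ι n ∘ₗ d n

/-- The augmentation of `ofSequence` on each level. -/
def ofSequenceAug : ∀ n, (ι n →₀ R) →ₗ[R] R
  | 0 => aug
  | _ + 1 => 0

/-- The direct sum of the modules in a sequence of based free modules. -/
abbrev ofSequence : BasedComplex R where
  X := Σ n, ι n
  hdeg := Sigma.fst
  deg j := deg j.1 j.2
  d := ofLevels (ofSequenceD ι d)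
  aug := ofLevels (ofSequenceAug ι aug)

theorem ofSequence_d_zero (x : ι 0 →₀ R) :
    (ofSequence ι deg d aug).d (levelIncl ι 0 x) = 0 :=
  ofLevels_levelIncl (ofSequenceD ι d) 0 x

theorem ofSequence_d_succ (n : ℕ) (x : ι (n + 1) →₀ R) :
    (ofSequence ι deg d aug).d (levelIncl ι (n + 1) x) = levelIncl ι n (d n x) :=
  ofLevels_levelIncl (ofSequenceD ι d) (n + 1) x

theorem ofSequence_aug_zero (x : ι 0 →₀ R) :
    (ofSequence ι deg d aug).aug (levelIncl ι 0 x) = aug x :=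
  ofLevels_levelIncl (ofSequenceAug ι aug) 0 x

theorem ofSequence_aug_succ (n : ℕ) (x : ι (n + 1) →₀ R) :
    (ofSequence ι deg d aug).aug (levelIncl ι (n + 1) x) = 0 :=
  ofLevels_levelIncl (ofSequenceAug ι aug) (n + 1) x

theorem levelProj_ofSequence_d (n : ℕ) (x : (Σ n, ι n) →₀ R) :
    levelProj ι n ((ofSequence ι deg d aug).d x) =
      d n (levelProj ι (n + 1) x) := by
  refine LinearMap.congr_fun (f := levelProj ι n ∘ₗ (ofSequence ι deg d aug).d)
    (g := d n ∘ₗ levelProj ι (n + 1)) (linearMap_ext_levels fun m x => ?_) x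
  rw [LinearMap.comp_apply, LinearMap.comp_apply]
  rcases m with _ | m
  · rw [ofSequence_d_zero, map_zero, levelProj_levelIncl_of_ne n.succ_ne_zero, map_zero]
  · rw [ofSequence_d_succ]
    by_cases h : n = m
    · subst h
      rw [levelProj_levelIncl, levelProj_levelIncl]
    · rw [levelProj_levelIncl_of_ne h, levelProj_levelIncl_of_ne (by omega), map_zero]

theorem aug_levelProj (x : (Σ n, ι n) →₀ R) :
    aug (levelProj ι 0 x) = (ofSequence ι deg d aug).aug x := by
  refine LinearMap.congr_fun (f := aug ∘ₗ levelProj ι 0) (g := (ofSequence ι deg d aug).aug)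
    (linearMap_ext_levels fun m x => ?_) x
  rw [LinearMap.comp_apply]
  rcases m with _ | m
  · rw [ofSequence_aug_zero, levelProj_levelIncl]
  · rw [ofSequence_aug_succ, levelProj_levelIncl_of_ne m.succ_ne_zero.symm, map_zero]

end BasedComplex

open BasedComplex

variable {ι deg d aug}

theorem ofSequence_d_homogeneous
    (hd : ∀ n j i, d n (Finsupp.single j 1) i ∈ 𝒢 (deg (n + 1) j - deg n i)) :
    IsHomogeneous 𝒢 (ofSequence ι deg d aug) (ofSequence ι deg d aug) 1 ⊤
      (ofSequence ι deg d aug).d where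
  hdeg_eq := by
    rintro ⟨_ | n, j⟩ ⟨m, i⟩ h
    · rw [← levelIncl_single, ofSequence_d_zero] at h
      exact absurd rfl h
    · rw [← levelIncl_single, ofSequence_d_succ] at h
      by_contra hne
      exact h (levelIncl_apply_of_ne (fun hmn => hne (by subst hmn; rfl)) _ _)
  entry_mem_degree := by
    rintro ⟨_ | n, j⟩ i
    · rw [← levelIncl_single, ofSequence_d_zero]
      exact zero_mem _
    · rw [← levelIncl_single, ofSequence_d_succ]
      exact levelIncl_apply_mem (fun i => 𝒢 (deg (n + 1) j - deg i.1 i.2)) (hd n j) i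
  entry_mem_ideal _ _ := Submodule.mem_top

theorem exists_ofSequence_d_eq (hexact_aug : Function.Exact (d 0) aug)
    (hexact : ∀ n, Function.Exact (d (n + 1)) (d n)) {x : (Σ n, ι n) →₀ R}
    (hx : (ofSequence ι deg d aug).d x = 0) (hx' : (ofSequence ι deg d aug).aug x = 0) :
    ∃ y, (ofSequence ι deg d aug).d y = x := by
  have exists_level : ∀ n, ∃ y, d n y = levelProj ι n x := by
    rintro (_ | n)
    · exact (hexact_aug _).1 (by rw [aug_levelProj ι deg d, hx'])
    · exact (hexact n _).1 (by rw [← levelProj_ofSequence_d ι deg d aug, hx, map_zero])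
  choose y hy using exists_level
  refine ⟨∑ n ∈ x.splitSupport, levelIncl ι (n + 1) (y n), ?_⟩
  rw [map_sum]
  refine (Finset.sum_congr rfl fun n _ => ?_).trans (sum_levelIncl_levelProj x)
  rw [ofSequence_d_succ, hy]

theorem ofSequence_isResolution {A : Ideal R}
    (hd : ∀ n j i, d n (Finsupp.single j 1) i ∈ 𝒢 (deg (n + 1) j - deg n i))
    (haug : ∀ j, aug (Finsupp.single j 1) ∈ 𝒢 (deg 0 j)) (hrange : LinearMap.range aug = A)
    (hexact_aug : Function.Exact (d 0) aug) (hexact : ∀ n, Function.Exact (d (n + 1)) (d n)) :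
    IsResolution 𝒢 (ofSequence ι deg d aug) A where
  d_homogeneous := ofSequence_d_homogeneous hd
  aug_single_eq_zero := by
    rintro ⟨_ | n, j⟩ h
    · exact absurd rfl h
    · rw [← levelIncl_single, ofSequence_aug_succ]
  aug_single_mem := by
    rintro ⟨_ | n, j⟩
    · rw [← levelIncl_single, ofSequence_aug_zero]
      exact haug j
    · rw [← levelIncl_single, ofSequence_aug_succ]
      exact zero_mem _
  d_d x := by
    refine LinearMap.congr_fun (f := (ofSequence ι deg d aug).d ∘ₗ (ofSequence ι deg d aug).d)
      (g := 0) (linearMap_ext_levels fun n x => ?_) x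
    rw [LinearMap.comp_apply, LinearMap.zero_apply]
    rcases n with _ | _ | n
    · rw [ofSequence_d_zero, map_zero]
    · rw [ofSequence_d_succ, ofSequence_d_zero]
    · rw [ofSequence_d_succ, ofSequence_d_succ, (hexact n).apply_apply_eq_zero, map_zero]
  aug_d x := by rw [← aug_levelProj, levelProj_ofSequence_d, hexact_aug.apply_apply_eq_zero]
  exact _ := exists_ofSequence_d_eq hexact_aug hexact
  range_aug := by
    rw [← hrange]
    refine le_antisymm ?_ ?_
    · rintro _ ⟨x, rfl⟩
      exact ⟨_, aug_levelProj ι deg d aug x⟩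
    · rintro _ ⟨x, rfl⟩
      exact ⟨_, ofSequence_aug_zero ι deg d aug x⟩

theorem ofSequence_hasLift {ι' : ℕ → Type u} {deg' : ∀ n, ι' n → ℤ}
    {d' : ∀ n, (ι' (n + 1) →₀ R) →ₗ[R] (ι' n →₀ R)} {aug' : (ι' 0 →₀ R) →ₗ[R] R} {c : Ideal R}
    (φ : ∀ n, (ι n →₀ R) →ₗ[R] (ι' n →₀ R))
    (hφ : ∀ n j i, φ n (Finsupp.single j 1) i ∈ 𝒢 (deg n j - deg' n i))
    (hc : ∀ n j i, φ n (Finsupp.single j 1) i ∈ c)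
    (comm_d : ∀ n x, d' n (φ (n + 1) x) = φ n (d n x)) (comm_aug : ∀ x, aug' (φ 0 x) = aug x) :
    HasLift 𝒢 (ofSequence ι deg d aug) (ofSequence ι' deg' d' aug') c := by
  let Φ := ofLevels fun n => levelIncl ι' n ∘ₗ φ n
  have hΦ : ∀ n x, Φ (levelIncl ι n x) = levelIncl ι' n (φ n x) := ofLevels_levelIncl _
  refine ⟨Φ, ⟨?_, ?_, ?_⟩, fun x => ?_, fun x => ?_⟩
  · rintro ⟨n, j⟩ ⟨m, i⟩ h
    rw [← levelIncl_single, hΦ] at h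
    by_contra hne
    exact h (levelIncl_apply_of_ne (Ne.symm hne) _ _)
  · rintro ⟨n, j⟩ i
    rw [← levelIncl_single, hΦ]
    exact levelIncl_apply_mem (fun i => 𝒢 (deg n j - deg' i.1 i.2)) (hφ n j) i
  · rintro ⟨n, j⟩ i
    rw [← levelIncl_single, hΦ]
    exact levelIncl_apply_mem (fun _ => c.toAddSubgroup) (hc n j) i
  · refine LinearMap.congr_fun (f := (ofSequence ι' deg' d' aug').d ∘ₗ Φ)
      (g := Φ ∘ₗ (ofSequence ι deg d aug).d) (linearMap_ext_levels fun n x => ?_) x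
    rw [LinearMap.comp_apply, LinearMap.comp_apply, hΦ]
    rcases n with _ | n
    · rw [ofSequence_d_zero, ofSequence_d_zero, map_zero]
    · rw [ofSequence_d_succ, ofSequence_d_succ, hΦ, comm_d]
  · refine LinearMap.congr_fun (f := (ofSequence ι' deg' d' aug').aug ∘ₗ Φ)
      (g := (ofSequence ι deg d aug).aug) (linearMap_ext_levels fun n x => ?_) x
    rw [LinearMap.comp_apply, hΦ]
    rcases n with _ | n
    · rw [ofSequence_aug_zero, ofSequence_aug_zero, comm_aug]
    · rw [ofSequence_aug_succ, ofSequence_aug_succ]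

end Sequences

section Existence

variable {R : Type u} [CommRing R]

/-- The iterated syzygies of an ideal in the free resolution whose basis in each step is the whole
preceding syzygy: an index type together with a submodule of the free module on it. -/
def syzygy (A : Ideal R) : ℕ → Σ ι : Type u, Submodule R (ι →₀ R)
  | 0 => ⟨A, LinearMap.ker (Finsupp.linearCombination R (Subtype.val : A → R))⟩
  | n + 1 => ⟨(syzygy A n).2, LinearMap.ker (Finsupp.linearCombination R
      (Subtype.val : (syzygy A n).2 → ((syzygy A n).1 →₀ R)))⟩

theorem range_linearCombination_val {M : Type u} [AddCommGroup M] [Module R M]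
    (N : Submodule R M) :
    LinearMap.range (Finsupp.linearCombination R (Subtype.val : N → M)) = N := by
  rw [Finsupp.range_linearCombination, Subtype.range_coe_subtype]
  exact Submodule.span_eq N

theorem exists_isResolution (A : Ideal R) :
    ∃ F : BasedComplex R, IsResolution (fun _ => ⊤) F A :=
  ⟨BasedComplex.ofSequence (fun n => (syzygy A n).1) (fun _ _ => 0)
      (fun n => Finsupp.linearCombination R
        (Subtype.val : (syzygy A n).2 → ((syzygy A n).1 →₀ R)))
      (Finsupp.linearCombination R (Subtype.val : A → R)),
    ofSequence_isResolution (fun _ _ _ => AddSubgroup.mem_top _) (fun _ => AddSubgroup.mem_top _)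
      (range_linearCombination_val A)
      (LinearMap.exact_iff.2 (range_linearCombination_val (syzygy A 0).2).symm)
      fun n => LinearMap.exact_iff.2 (range_linearCombination_val (syzygy A (n + 1)).2).symm⟩

variable {k : Type u} [Field k] [Algebra k R] {𝒜 : ℕ → Submodule k R} {A B : Ideal R}

/-- The direct sum of the modules of a graded free resolution of an ideal. -/
abbrev GradedFreeResolution.basedComplex (F : GradedFreeResolution 𝒜 (idealComponent 𝒜 A)) :
    BasedComplex R :=
  BasedComplex.ofSequence F.ι F.deg F.d (A.subtype ∘ₗ F.aug)

theorem GradedFreeResolution.basedComplex_isResolution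
    (F : GradedFreeResolution 𝒜 (idealComponent 𝒜 A)) :
    IsResolution (intGrading 𝒜) F.basedComplex A :=
  ofSequence_isResolution F.d_deg F.aug_deg
    (by rw [LinearMap.range_comp, LinearMap.range_eq_top.2 F.aug_surjective, Submodule.map_top,
      Submodule.range_subtype])
    (fun x => Iff.trans (by simp) (F.exact_aug x)) F.exact_d

theorem InclusionDoublyTorVanishing.exists_hasLift (h : InclusionDoublyTorVanishing 𝒜 A B) :
    ∃ F G : BasedComplex R, IsResolution (intGrading 𝒜) F A ∧ IsResolution (intGrading 𝒜) G B ∧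
      HasLift (intGrading 𝒜) F G (gradedMax 𝒜 ^ 2) := by
  obtain ⟨_, F, G, φ, hφ⟩ := h
  exact ⟨F.basedComplex, G.basedComplex, F.basedComplex_isResolution, G.basedComplex_isResolution,
    ofSequence_hasLift φ.map φ.map_deg (fun n j i => (mem_smul_top_iff _).1 (hφ n ⟨_, rfl⟩) i)
      (fun n x => LinearMap.congr_fun (φ.comm_d n) x)
      fun x => congrArg Subtype.val (LinearMap.congr_fun φ.comm_aug x)⟩

end Existence

section SmallType

variable {k R S : Type u} [Field k] [CommRing R] [Algebra k R] [CommRing S] [Algebra k S]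
variable {𝒜 : ℕ → Submodule k R} {ℬ : ℕ → Submodule k S} {I : Ideal R} {J : Ideal S}

theorem IsSmallType.nonempty_powerTower [(gradedMax 𝒜).IsMaximal] (h : IsSmallType 𝒜 I) :
    Nonempty (PowerTower (fun _ => ⊤) I (gradedMax 𝒜)) := by
  choose F hF using fun a => exists_isResolution (I ^ a)
  choose φ hφ using fun a => (h (a + 1) a.succ_pos).hasLift 𝒜 (.trivial R) (fun _ _ => id)
    (hF (a + 1)) (hF a)
  exact ⟨⟨F, φ, hF, hφ⟩⟩

theorem IsDoublySmallType.nonempty_powerTower [GradedAlgebra 𝒜] (h : IsDoublySmallType 𝒜 I) :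
    Nonempty (PowerTower (intGrading 𝒜) I (gradedMax 𝒜 ^ 2)) := by
  choose K F hK hF hKF using fun a => (h (a + 1) a.succ_pos).exists_hasLift
  choose φ hφ using fun a => (hKF a).of_resolutions (intGradingProjection 𝒜) (hK a) (hF a)
    (hF (a + 1)) (hF a)
  exact ⟨⟨F, φ, hF, hφ⟩⟩

theorem PowerTower.isSmallType {𝒢 : ℤ → AddSubgroup R} (F : PowerTower 𝒢 I (gradedMax 𝒜)) :
    IsSmallType 𝒜 I := by
  rintro (_ | r) hr
  · exact absurd hr (by decide)
  · exact HasLift.inclusionTorVanishing 𝒜 ⟨_, F.isLift r⟩ (F.isResolution (r + 1))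
      (F.isResolution r)

theorem PowerTower.isDoublySmallType (F : PowerTower (intGrading 𝒜) I (gradedMax 𝒜 ^ 2)) :
    IsDoublySmallType 𝒜 I := by
  rintro (_ | r) hr
  · exact absurd hr (by decide)
  · exact HasLift.inclusionDoublyTorVanishing ⟨_, F.isLift r⟩ (F.isResolution (r + 1))
      (F.isResolution r)

theorem PowerTower.isBettiSplitting {𝒞 : ℕ → Submodule k (R ⊗[k] S)} {𝒢 : ℤ → AddSubgroup R}
    {ℋ : ℤ → AddSubgroup S} {𝒯 : ℤ → AddSubgroup (R ⊗[k] S)} [SetLike.GradedOne 𝒢]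
    [SetLike.GradedOne ℋ] [SetLike.GradedMonoid 𝒯] {c : Ideal R} {c' : Ideal S}
    (F : PowerTower 𝒢 I c) (G : PowerTower ℋ J c') (h𝒯 : IsTensorGraded 𝒢 ℋ 𝒯)
    (hc : extendLeft c ≤ gradedMax 𝒞) (hc' : extendRight c' ≤ gradedMax 𝒞) (r s : ℕ) :
    IsBettiSplitting 𝒞 (extendLeft I ^ r * mixedSum I J ^ (s + 1))
      (extendLeft I ^ (r + 1) * mixedSum I J ^ s) (extendLeft I ^ r * extendRight J ^ (s + 1)) := by
  rw [extendLeft_pow_mul_mixedSum_pow_succ]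
  refine isBettiSplitting_of_hasLift 𝒞 (F.total_isResolution G h𝒯 s (r + 1))
    (F.tensor_isResolution G h𝒯 r (s + 1)) ?_
    ⟨_, (F.incl_comp_tensorRight_isLift G h𝒯 s (r + 1)).mono hc'⟩
    ⟨_, (F.tensorLeft_isLift G h𝒯 r (s + 1)).mono hc⟩
  rw [extendLeft_pow_mul_mixedSum_pow_inf]
  exact F.tensor_isResolution G h𝒯 (r + 1) (s + 1)

variable (𝒜 ℬ) in
theorem extendLeft_gradedMax_le [SetLike.GradedOne ℬ] :
    extendLeft (gradedMax 𝒜) ≤ gradedMax (tensorGrading 𝒜 ℬ) := by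
  simpa only [pow_one] using extendLeft_gradedMax_pow_le 𝒜 ℬ 1

variable (𝒜 ℬ) in
theorem extendRight_gradedMax_le [SetLike.GradedOne 𝒜] :
    extendRight (gradedMax ℬ) ≤ gradedMax (tensorGrading 𝒜 ℬ) := by
  simpa only [pow_one] using extendRight_gradedMax_pow_le 𝒜 ℬ 1

section TensorGrading

variable [GradedAlgebra 𝒜] [GradedAlgebra ℬ]

theorem IsSmallType.isBettiSplitting [(gradedMax 𝒜).IsMaximal] [(gradedMax ℬ).IsMaximal]
    (hI : IsSmallType 𝒜 I) (hJ : IsSmallType ℬ J) (r s : ℕ) :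
    IsBettiSplitting (tensorGrading 𝒜 ℬ) (extendLeft I ^ r * mixedSum I J ^ (s + 1))
      (extendLeft I ^ (r + 1) * mixedSum I J ^ s) (extendLeft I ^ r * extendRight J ^ (s + 1)) := by
  obtain ⟨F⟩ := hI.nonempty_powerTower
  obtain ⟨G⟩ := hJ.nonempty_powerTower
  exact F.isBettiSplitting G isTensorGraded_trivial (extendLeft_gradedMax_le 𝒜 ℬ)
    (extendRight_gradedMax_le 𝒜 ℬ) r s

theorem IsSmallType.mixedSum [(gradedMax 𝒜).IsMaximal] [(gradedMax ℬ).IsMaximal]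
    (hI : IsSmallType 𝒜 I) (hJ : IsSmallType ℬ J) :
    IsSmallType (tensorGrading 𝒜 ℬ) (mixedSum I J) := by
  obtain ⟨F⟩ := hI.nonempty_powerTower
  obtain ⟨G⟩ := hJ.nonempty_powerTower
  exact (F.mixedSum G isTensorGraded_trivial (extendLeft_gradedMax_le 𝒜 ℬ)
    (extendRight_gradedMax_le 𝒜 ℬ)).isSmallType

theorem IsDoublySmallType.inclusionDoublyTorVanishing_mul_extendRight
    (hI : IsDoublySmallType 𝒜 I) (hJ : IsDoublySmallType ℬ J) (r s : ℕ) :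
    InclusionDoublyTorVanishing (tensorGrading 𝒜 ℬ) (extendLeft I ^ (r + 1) * extendRight J ^ s)
      (extendLeft I ^ r * extendRight J ^ s) := by
  obtain ⟨F⟩ := hI.nonempty_powerTower
  obtain ⟨G⟩ := hJ.nonempty_powerTower
  have h𝒯 := isTensorGraded_intGrading 𝒜 ℬ
  have hlift := (F.tensorLeft_isLift G h𝒯 r s).mono (extendLeft_gradedMax_pow_le 𝒜 ℬ 2)
  exact HasLift.inclusionDoublyTorVanishing ⟨_, hlift⟩ (F.tensor_isResolution G h𝒯 (r + 1) s)
    (F.tensor_isResolution G h𝒯 r s)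

theorem IsDoublySmallType.inclusionDoublyTorVanishing_mul_mixedSum
    (hI : IsDoublySmallType 𝒜 I) (hJ : IsDoublySmallType ℬ J) (r s : ℕ) :
    InclusionDoublyTorVanishing (tensorGrading 𝒜 ℬ)
      (extendLeft I ^ r * extendRight J ^ (s + 1)) (extendLeft I ^ r * mixedSum I J ^ s) := by
  obtain ⟨F⟩ := hI.nonempty_powerTower
  obtain ⟨G⟩ := hJ.nonempty_powerTower
  have h𝒯 := isTensorGraded_intGrading 𝒜 ℬ
  have hlift := (F.incl_comp_tensorRight_isLift G h𝒯 s r).mono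
    (extendRight_gradedMax_pow_le 𝒜 ℬ 2)
  exact HasLift.inclusionDoublyTorVanishing ⟨_, hlift⟩ (F.tensor_isResolution G h𝒯 r (s + 1))
    (F.total_isResolution G h𝒯 s r)

theorem IsDoublySmallType.mixedSum (hI : IsDoublySmallType 𝒜 I) (hJ : IsDoublySmallType ℬ J) :
    IsDoublySmallType (tensorGrading 𝒜 ℬ) (mixedSum I J) := by
  obtain ⟨F⟩ := hI.nonempty_powerTower
  obtain ⟨G⟩ := hJ.nonempty_powerTower
  exact (F.mixedSum G (isTensorGraded_intGrading 𝒜 ℬ) (extendLeft_gradedMax_pow_le 𝒜 ℬ 2)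
    (extendRight_gradedMax_pow_le 𝒜 ℬ 2)).isDoublySmallType

end TensorGrading

end SmallType

end MixedSum

end

open MixedSum in
theorem mainTheorem4_general {k R S : Type u} [Field k] [CommRing R] [Algebra k R] [CommRing S]
    [Algebra k S] (𝒜 : ℕ → Submodule k R) [GradedAlgebra 𝒜] (h𝒜 : (gradedMax 𝒜).IsMaximal)
    (ℬ : ℕ → Submodule k S) [GradedAlgebra ℬ] (hℬ : (gradedMax ℬ).IsMaximal)
    (I : Ideal R) (J : Ideal S) :
    (IsSmallType 𝒜 I → IsSmallType ℬ J →
      (∀ r s : ℕ, 1 ≤ s →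
        IsBettiSplitting (tensorGrading 𝒜 ℬ) (extendLeft I ^ r * mixedSum I J ^ s)
          (extendLeft I ^ (r + 1) * mixedSum I J ^ (s - 1))
          (extendLeft I ^ r * extendRight J ^ s)) ∧
      IsSmallType (tensorGrading 𝒜 ℬ) (mixedSum I J)) ∧
    (IsDoublySmallType 𝒜 I → IsDoublySmallType ℬ J →
      (∀ r s : ℕ, 1 ≤ s →
        InclusionDoublyTorVanishing (tensorGrading 𝒜 ℬ)
          (extendLeft I ^ (r + 1) * extendRight J ^ s) (extendLeft I ^ r * extendRight J ^ s) ∧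
        InclusionDoublyTorVanishing (tensorGrading 𝒜 ℬ)
          (extendLeft I ^ (r + 1) * extendRight J ^ s)
          (extendLeft I ^ (r + 1) * mixedSum I J ^ (s - 1))) ∧
      IsDoublySmallType (tensorGrading 𝒜 ℬ) (mixedSum I J)) := by
  refine ⟨fun hI hJ => ⟨fun r s hs => ?_, hI.mixedSum hJ⟩,
    fun hI hJ => ⟨fun r s hs => ⟨hI.inclusionDoublyTorVanishing_mul_extendRight hJ r s, ?_⟩,
      hI.mixedSum hJ⟩⟩
  all_goals obtain ⟨s, rfl⟩ := Nat.exists_eq_add_of_le' hs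
  · exact hI.isBettiSplitting hJ r s
  · exact hI.inclusionDoublyTorVanishing_mul_mixedSum hJ (r + 1) s

theorem mainTheorem4 {k R S : Type u} [Field k] [CommRing R] [Algebra k R]
    [CommRing S] [Algebra k S]
    (𝒜 : ℕ → Submodule k R) [GradedAlgebra 𝒜] (hR : MixedSum.IsStandardGraded 𝒜)
    (ℬ : ℕ → Submodule k S) [GradedAlgebra ℬ] (hS : MixedSum.IsStandardGraded ℬ)
    (I : Ideal R) (hI : I.IsHomogeneous 𝒜) (hI_ne_bot : I ≠ ⊥) (hI_ne_top : I ≠ ⊤)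
    (J : Ideal S) (hJ : J.IsHomogeneous ℬ) (hJ_ne_bot : J ≠ ⊥) (hJ_ne_top : J ≠ ⊤)
    (𝒯 : ℕ → Submodule k (R ⊗[k] S)) (h𝒯 : 𝒯 = MixedSum.tensorGrading 𝒜 ℬ)
    (I' J' P : Ideal (R ⊗[k] S)) (hI' : I' = MixedSum.extendLeft I)
    (hJ' : J' = MixedSum.extendRight J) (hP : P = MixedSum.mixedSum I J) :
    (MixedSum.IsSmallType 𝒜 I → MixedSum.IsSmallType ℬ J →
      (∀ r s : ℕ, 1 ≤ s →
        MixedSum.IsBettiSplitting 𝒯 (I' ^ r * P ^ s)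
          (I' ^ (r + 1) * P ^ (s - 1)) (I' ^ r * J' ^ s)) ∧
      MixedSum.IsSmallType 𝒯 P) ∧
    (MixedSum.IsDoublySmallType 𝒜 I → MixedSum.IsDoublySmallType ℬ J →
      (∀ r s : ℕ, 1 ≤ s →
        MixedSum.InclusionDoublyTorVanishing 𝒯 (I' ^ (r + 1) * J' ^ s) (I' ^ r * J' ^ s) ∧
        MixedSum.InclusionDoublyTorVanishing 𝒯 (I' ^ (r + 1) * J' ^ s)
          (I' ^ (r + 1) * P ^ (s - 1))) ∧
      MixedSum.IsDoublySmallType 𝒯 P) := by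
  subst h𝒯 hI' hJ' hP
  exact mainTheorem4_general 𝒜 hR.gradedMax_isMaximal ℬ hS.gradedMax_isMaximal I J
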